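/- Let $\mathbb F=\mathbb Z/2$ and let $\mathbf I=\mathbf I_0\oplus \mathbf I_1$ with $\mathbf I_0\cong\mathbf I_1\cong\mathbb F$. Let $\mathcal K^!$ be the curved dg-algebra over $\mathbf I$ with $$\mathbf I_0\mathcal K^!\mathbf I_0=\frac{\mathbb F\langle w,z,\theta\rangle}{w^2=z^2=[w,\theta]=[z,\theta]=\theta^2=0},\qquad \mathbf I_1\mathcal K^!\mathbf I_1=\frac{\mathbb F\langle \varphi_+,\varphi_-,\theta\rangle}{\varphi_\pm^2=[\theta,\varphi_\pm]=\theta^2=0},\qquad \mathbf I_1\mathcal K^!\mathbf I_0=0,$$ and with $\mathbf I_0\mathcal K^!\mathbf I_1$ generated as a bimodule by $s,t$ subject to $ws=s\varphi_-=0$, $zt=t\varphi_+=0$, $s\theta=\theta s$, $t\theta=\theta t$, $zs=s\varphi_+$, $wt=t\varphi_-$ (so it has $\mathbb F$-basis $s,zs,t,wt$ and their multiples by $\theta$). The differential is determined by the Leibniz rule and $\mu_1(\theta)=wz+zw$ in $\mathbf I_0\mathcal K^!\mathbf I_0$ (and $\mu_1=0$ on all other generators), and the curvature is $\mu_0=\varphi_-\varphi_++\varphi_+\varphi_-$.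 Let $\boldsymbol{\mathcal K}^!$ be obtained from $\mathcal K^!$ by allowing infinite sums of monomials in $\mathbf I_0\mathcal K^!\mathbf I_0$ (completion of this summand along the filtration by word length). For a monomial $a$ in $\mathbf I_0\mathcal K^!\mathbf I_0$ let $\mathrm{wt}(a)$ be its number of letters, $\mathrm{wt}_\theta(a)\in\{0,1\}$ its number of letters $\theta$, and $\mathrm{wt}_+(a)=\mathrm{wt}(a)+\mathrm{wt}_\theta(a)$; let $a'$ be $a$ with its last two letters different from $\theta$ removed. Fix an integer $N\ge 4$. Let $\iota\colon\mathcal K^!\to\boldsymbol{\mathcal K}^!$ have $\iota_1$ the inclusion and $\iota_n=0$ for $n\neq 1$. Let $\phi\colon\boldsymbol{\mathcal K}^!\to\mathcal K^!$ have the following operations. The map $\phi_1$ fixes all monomials, except that $\phi_1(a)=0$ for monomials $a$ in $\mathbf I_0\mathcal K^!\mathbf I_0$ with $\mathrm{wt}_+(a)>N$. For monomials $a,b$, $\phi_2(a,b)=(ab)'\theta$ if $a,b$ lie in $\mathbf I_0\mathcal K^!\mathbf I_0$, $ab\ne0$, $\mathrm{wt}_+(ab)>N$, $\mathrm{wt}_+(a)\le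 N$ and $\mathrm{wt}_+(b)\le N$, and $\phi_2(a,b)=0$ otherwise. Finally $\phi_n=0$ for $n\ne 1,2$. (Both $\phi_1$ and $\phi_2$ are extended to infinite sums termwise.) Then: 1. $\iota$ and $\phi$ are $A_\infty$-morphisms of curved dg-algebras over $\mathbf I$. 2. Let ${}^{\boldsymbol{\mathcal K}^!}[\iota]_{\mathcal K^!}$ and ${}^{\mathcal K^!}[\phi]_{\boldsymbol{\mathcal K}^!}$ be the induced rank-one type-$DA$ bimodules (with underlying bimodule $\mathbf I$ and structure maps $\delta^1_{n+1}(1,a_1,\dots,a_n)=\iota_n(a_1,\dots,a_n)\otimes 1$, respectively $\phi_n(a_1,\dots,a_n)\otimes 1$). These and their two box tensor products are bounded type-$DA$ bimodules, and there are isomorphisms of type-$DA$ bimodules, given by mutually inverse bounded closed morphisms, $$ {}^{\mathcal K^!}[\phi]_{\boldsymbol{\mathcal K}^!}\boxtimes{}^{\boldsymbol{\mathcal K}^!}[\iota]_{\mathcal K^!}\cong{}^{\mathcal K^!}\mathbb I_{\mathcal K^!},\qquad {}^{\boldsymbol{\mathcal K}^!}[\iota]_{\mathcal K^!}\boxtimes{}^{\mathcal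 K^!}[\phi]_{\boldsymbol{\mathcal K}^!}\cong{}^{\boldsymbol{\mathcal K}^!}\mathbb I_{\boldsymbol{\mathcal K}^!}.$$ 3. For a curved dg-algebra $\mathcal A$ over $\mathbf I$ let ${}^{\mathcal A}\mathrm{MOD}$ be the dg-category of left type-$D$ modules over $\mathcal A$: objects are $\mathbf I$-modules $X$ with an $\mathbf I$-linear map $\delta\colon X\to\mathcal A\otimes_{\mathbf I}X$ such that $(\mu_2\otimes\mathrm{id})(\mathrm{id}\otimes\delta)\delta+(\mu_1\otimes\mathrm{id})\delta+\mu_0\otimes\mathrm{id}=0$, and morphisms are $\mathbf I$-linear maps $X\to\mathcal A\otimes_{\mathbf I}Y$ with the usual composition and differential. (Each $\mathbf I$-module is presented by an $\mathbb F$-basis of elements fixed by $\mathbf I_0$ or $\mathbf I_1$; such a basis always exists and morphisms do not refer to it.) An $A_\infty$-morphism $\psi\in\{\iota,\phi\}$ sends a type-$D$ module $(X,\delta)$ to the type-$D$ module $\bigl(X,\sum_n(\psi_n\otimes\mathrm{id})\delta^n\bigr)$, where $\delta^n\colon X\to\mathcal A^{\otimes n}\otimes X$ is the $n$-fold iterate,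 and composable morphisms $f_1,\dots,f_n$ to the sum of $(\psi\otimes\mathrm{id})(\delta,\dots,\delta,f_1,\delta,\dots,\delta,f_n,\delta,\dots,\delta)$ over all numbers of inserted copies of $\delta$. These are $A_\infty$-functors $$\iota_*\colon{}^{\mathcal K^!}\mathrm{MOD}\to{}^{\boldsymbol{\mathcal K}^!}\mathrm{MOD},\qquad \phi_*\colon{}^{\boldsymbol{\mathcal K}^!}\mathrm{MOD}\to{}^{\mathcal K^!}\mathrm{MOD},$$ and they are mutually inverse $A_\infty$-equivalences of categories: $\phi_*\circ\iota_*$ and $\iota_*\circ\phi_*$ are isomorphic to the identity functors through $A_\infty$-natural transformations. -/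

import Mathlib

universe u

/-! ## Monomials of the Koszul dual algebra, without the letter `θ` -/

namespace SurgeryKoszul

/-- The letters of idempotent `(0,0)`. -/
inductive L0 where
  | w | z
  deriving DecidableEq

/-- The letters of idempotent `(1,1)`: `plus` is `φ₊` and `minus` is `φ₋`. -/
inductive L1 where
  | plus | minus
  deriving DecidableEq

instance : Finite L0 := Finite.of_surjective (fun b : Bool => cond b L0.w L0.z)
  (fun x => by cases x; exacts [⟨true, rfl⟩, ⟨false, rfl⟩])

instance : Finite L1 := Finite.of_surjective (fun b : Bool => cond b L1.plus L1.minus)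
  (fun x => by cases x; exacts [⟨true, rfl⟩, ⟨false, rfl⟩])

/-- Words with no letter repeated twice in a row: the nonzero monomials of the free algebra on `L`
modulo the squares of the letters. -/
@[ext]
structure Word (L : Type) where
  letters : List L
  chain : letters.IsChain (· ≠ ·)
  deriving DecidableEq

/-- Concatenation; `none` stands for the value zero. -/
def Word.mul {L : Type} [DecidableEq L] (u v : Word L) : Option (Word L) :=
  if h : (u.letters ++ v.letters).IsChain (· ≠ ·) then some ⟨u.letters ++ v.letters, h⟩ else none

/-- The empty word. -/
def Word.nil {L : Type} : Word L := ⟨[], List.IsChain.nil⟩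

/-- The word `u'` obtained from `u` by removing its last two letters. -/
def Word.shorten {L : Type} (u : Word L) : Word L :=
  ⟨u.letters.take (u.letters.length - 2), u.chain.take _⟩

/-- The monomials of `I₀ K! I₁`. -/
inductive Mid where
  | s | zs | t | wt
  deriving DecidableEq

instance : Finite Mid := Finite.of_surjective
  (fun b : Bool × Bool => cond b.1 (cond b.2 Mid.s Mid.zs) (cond b.2 Mid.t Mid.wt))
  (fun x => by
    cases x
    exacts [⟨(true, true), rfl⟩, ⟨(true, false), rfl⟩, ⟨(false, true), rfl⟩, ⟨(false, false), rfl⟩])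

/-- Left multiplication of a letter on `I₀ K! I₁`: `z · s = zs`, `w · t = wt`, all others vanish. -/
def Mid.lmul : L0 → Mid → Option Mid
  | L0.z, Mid.s => some Mid.zs
  | L0.w, Mid.t => some Mid.wt
  | _, _ => none

/-- Right multiplication of a letter on `I₀ K! I₁`: `s · φ₊ = zs`, `t · φ₋ = wt`, all others
vanish. -/
def Mid.rmul : Mid → L1 → Option Mid
  | Mid.s, L1.plus => some Mid.zs
  | Mid.t, L1.minus => some Mid.wt
  | _, _ => none

/-- The number of letters. -/
def Mid.len : Mid → ℕ
  | Mid.s => 1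
  | Mid.zs => 2
  | Mid.t => 1
  | Mid.wt => 2

/-- The monomials, without `θ`, of the Koszul dual algebra: those in `I₀ K! I₀`, in `I₀ K! I₁` and
in `I₁ K! I₁`. -/
inductive Core where
  | zero (u : Word L0)
  | mid (m : Mid)
  | one (v : Word L1)
  deriving DecidableEq

/-- Multiplication of monomials; `none` stands for the value zero. -/
def Core.mul : Core → Core → Option Core
  | .zero u, .zero v => (u.mul v).map .zero
  | .one u, .one v => (u.mul v).map .one
  | .zero u, .mid m => (u.letters.foldrM Mid.lmul m).map .mid
  | .mid m, .one v => (v.letters.foldlM Mid.rmul m).map .mid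
  | _, _ => none

/-- The number of letters. -/
def Core.len : Core → ℕ
  | .zero u => u.letters.length
  | .mid m => m.len
  | .one v => v.letters.length

theorem Word.mul_eq_some {L : Type} [DecidableEq L] {u v x : Word L} :
    u.mul v = some x ↔ u.letters ++ v.letters = x.letters := by
  unfold Word.mul
  split_ifs with h
  · simp [Word.ext_iff]
  · constructor
    · simp
    · intro hx
      exact absurd (hx ▸ x.chain) h

theorem Word.mul_assoc {L : Type} [DecidableEq L] (u v x : Word L) :
    (u.mul v).bind (·.mul x) = (v.mul x).bind (u.mul ·) := by
  ext y
  simp only [Option.bind_eq_some_iff, Word.mul_eq_some]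
  constructor
  · rintro ⟨a, ha, h⟩
    have hy := y.chain
    rw [← h, ← ha, List.append_assoc] at hy
    exact ⟨⟨v.letters ++ x.letters, (List.isChain_append.1 hy).2.1⟩, rfl, by rw [← h, ← ha, List.append_assoc]⟩
  · rintro ⟨a, ha, h⟩
    have hy := y.chain
    rw [← h, ← ha, ← List.append_assoc] at hy
    exact ⟨⟨u.letters ++ v.letters, (List.isChain_append.1 hy).1⟩, rfl, by rw [← h, ← ha, List.append_assoc]⟩

theorem Mid.lmul_lmul (a b : L0) (m : Mid) : (Mid.lmul b m).bind (Mid.lmul a) = none := by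
  cases a <;> cases b <;> cases m <;> rfl

theorem Mid.rmul_rmul (a b : L1) (m : Mid) :
    (Mid.rmul m a).bind (fun x => Mid.rmul x b) = none := by
  cases a <;> cases b <;> cases m <;> rfl

theorem Mid.lmul_rmul (a : L0) (b : L1) (m : Mid) :
    (Mid.lmul a m).bind (fun x => Mid.rmul x b) = none := by
  cases a <;> cases b <;> cases m <;> rfl

theorem Mid.rmul_lmul (a : L0) (b : L1) (m : Mid) :
    (Mid.rmul m b).bind (Mid.lmul a) = none := by
  cases a <;> cases b <;> cases m <;> rfl

theorem Mid.foldr_two (a b : L0) (l : List L0) (m : Mid) :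
    (a :: b :: l).foldrM Mid.lmul m = none := by
  rw [List.foldrM_cons, List.foldrM_cons]
  cases h : l.foldrM Mid.lmul m with
  | none => rfl
  | some x => exact Mid.lmul_lmul a b x

theorem Mid.foldl_two (a b : L1) (l : List L1) (m : Mid) :
    (a :: b :: l).foldlM Mid.rmul m = none := by
  rw [List.foldlM_cons]
  have := Mid.rmul_rmul a b m
  cases h : Mid.rmul m a with
  | none => rfl
  | some x =>
    rw [h] at this
    change (b :: l).foldlM Mid.rmul x = none
    rw [List.foldlM_cons]
    rw [show Mid.rmul x b = none from this]
    rfl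

theorem bind_map_eq {α β γ : Type} (o : Option α) (g : α → Option β) (f : β → γ) :
    (o.bind fun a => (g a).map f) = (o.bind g).map f := by cases o <;> rfl

theorem Core.mul_assoc (a b c : Core) :
    (a.mul b).bind (·.mul c) = (b.mul c).bind (a.mul ·) := by
  cases a with
  | zero u =>
    cases b with
    | zero v =>
      cases c with
      | zero x =>
        have := Word.mul_assoc u v x
        simp only [Core.mul, Option.bind_map, Function.comp_def]
        rw [bind_map_eq, bind_map_eq]
        exact congrArg _ this
      | one x =>
        (simp only [Core.mul, Option.bind_map, Function.comp_def]; simp)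
      | mid m =>
        have key : (u.letters ++ v.letters).foldrM Mid.lmul m
            = (v.letters.foldrM Mid.lmul m).bind (fun y => u.letters.foldrM Mid.lmul y) := by
          rw [List.foldrM_append]; rfl
        simp only [Core.mul, Option.bind_map, Function.comp_def]
        rw [bind_map_eq, bind_map_eq, ← key]
        unfold Word.mul
        split_ifs with h
        · rfl
        · have : ∃ p q r, u.letters ++ v.letters = p :: q :: r := by
            match hl : u.letters ++ v.letters with
            | [] => rw [hl] at h; exact absurd List.IsChain.nil h
            | [p] => rw [hl] at h; exact absurd (List.IsChain.singleton p) h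
            | p :: q :: r => exact ⟨p, q, r, rfl⟩
          obtain ⟨p, q, r, hp⟩ := this
          rw [hp, Mid.foldr_two]
          rfl
    | one v => cases c <;> (simp only [Core.mul, Option.bind_map, Function.comp_def]; simp)
    | mid m =>
      cases c with
      | zero x => (simp only [Core.mul, Option.bind_map, Function.comp_def]; simp)
      | mid x => (simp only [Core.mul, Option.bind_map, Function.comp_def]; simp)
      | one x =>
        simp only [Core.mul, Option.bind_map, Function.comp_def]
        rw [bind_map_eq, bind_map_eq]
        congr 1
        match hu : u.letters, hx : x.letters with
        | [], l => simp
        | l, [] => simp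
        | [p], [q] =>
          simpa using (Mid.lmul_rmul p q m).trans (Mid.rmul_lmul p q m).symm
        | p :: p' :: l, q :: l' =>
          rw [Mid.foldr_two]
          cases h : List.foldlM Mid.rmul m (q :: l') with
          | none => rfl
          | some y => exact (Mid.foldr_two p p' l y).symm
        | [p], q :: q' :: l' =>
          rw [Mid.foldl_two]
          cases h : List.foldrM Mid.lmul m [p] with
          | none => rfl
          | some y => exact Mid.foldl_two q q' l' y
  | one u =>
    cases b with
    | zero v => cases c <;> (simp only [Core.mul, Option.bind_map, Function.comp_def]; simp)
    | mid m => cases c <;> (simp only [Core.mul, Option.bind_map, Function.comp_def]; simp)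
    | one v =>
      cases c with
      | zero x => (simp only [Core.mul, Option.bind_map, Function.comp_def]; simp)
      | mid x => (simp only [Core.mul, Option.bind_map, Function.comp_def]; simp)
      | one x =>
        have := Word.mul_assoc u v x
        simp only [Core.mul, Option.bind_map, Function.comp_def]
        rw [bind_map_eq, bind_map_eq]
        exact congrArg _ this
  | mid m =>
    cases b with
    | zero v => cases c <;> (simp only [Core.mul, Option.bind_map, Function.comp_def]; simp)
    | mid v => cases c <;> (simp only [Core.mul, Option.bind_map, Function.comp_def]; simp)
    | one v =>
      cases c with
      | zero x => (simp only [Core.mul, Option.bind_map, Function.comp_def]; simp)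
      | mid x => (simp only [Core.mul, Option.bind_map, Function.comp_def]; simp)
      | one x =>
        have key : (v.letters ++ x.letters).foldlM Mid.rmul m
            = (v.letters.foldlM Mid.rmul m).bind (fun y => x.letters.foldlM Mid.rmul y) := by
          rw [List.foldlM_append]; rfl
        simp only [Core.mul, Option.bind_map, Function.comp_def]
        rw [bind_map_eq, bind_map_eq, ← key]
        unfold Word.mul
        split_ifs with h
        · rfl
        · have : ∃ p q r, v.letters ++ x.letters = p :: q :: r := by
            match hl : v.letters ++ x.letters with
            | [] => rw [hl] at h; exact absurd List.IsChain.nil h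
            | [p] => rw [hl] at h; exact absurd (List.IsChain.singleton p) h
            | p :: q :: r => exact ⟨p, q, r, rfl⟩
          obtain ⟨p, q, r, hp⟩ := this
          rw [hp, Mid.foldl_two]
          rfl

theorem Mid.lmul_len {a : L0} {m x : Mid} (h : Mid.lmul a m = some x) : x.len = m.len + 1 := by
  cases a <;> cases m <;> simp [Mid.lmul] at h <;> subst h <;> rfl

theorem Mid.rmul_len {a : L1} {m x : Mid} (h : Mid.rmul m a = some x) : x.len = m.len + 1 := by
  cases a <;> cases m <;> simp [Mid.rmul] at h <;> subst h <;> rfl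

/-- The number of letters is additive on nonzero products. -/
theorem Core.mul_len {a b c : Core} (h : a.mul b = some c) : c.len = a.len + b.len := by
  cases a with
  | zero u =>
    cases b with
    | zero v =>
      simp only [Core.mul, Option.map_eq_some_iff, Word.mul_eq_some] at h
      obtain ⟨x, hx, rfl⟩ := h
      simp [Core.len, ← hx]
    | one v => simp [Core.mul] at h
    | mid m =>
      simp only [Core.mul, Option.map_eq_some_iff] at h
      obtain ⟨x, hx, rfl⟩ := h
      match hu : u.letters with
      | [] => rw [hu] at hx; simp at hx; simp [Core.len, hx, hu]
      | [p] =>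
        rw [hu] at hx; simp at hx
        simp [Core.len, hu, Mid.lmul_len hx, add_comm]
      | p :: q :: r => rw [hu, Mid.foldr_two] at hx; simp at hx
  | one u =>
    cases b with
    | zero v => simp [Core.mul] at h
    | mid m => simp [Core.mul] at h
    | one v =>
      simp only [Core.mul, Option.map_eq_some_iff, Word.mul_eq_some] at h
      obtain ⟨x, hx, rfl⟩ := h
      simp [Core.len, ← hx]
  | mid m =>
    cases b with
    | zero v => simp [Core.mul] at h
    | mid v => simp [Core.mul] at h
    | one v =>
      simp only [Core.mul, Option.map_eq_some_iff] at h
      obtain ⟨x, hx, rfl⟩ := h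
      match hu : v.letters with
      | [] => rw [hu] at hx; simp at hx; simp [Core.len, hx, hu]
      | [p] =>
        rw [hu] at hx; simp at hx
        simp [Core.len, hu, Mid.rmul_len hx]
      | p :: q :: r => rw [hu, Mid.foldl_two] at hx; simp at hx

theorem Core.finite_len_le (n : ℕ) : {c : Core | c.len ≤ n}.Finite := by
  have hW : ∀ (L : Type) [Finite L], {u : Word L | u.letters.length ≤ n}.Finite := by
    intro L _
    exact Set.Finite.preimage (fun a _ b _ h => Word.ext h) (List.finite_length_le L n)
  refine ((((hW L0).image Core.zero).union ((Set.finite_univ (α := Mid)).image Core.mid)).union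
    ((hW L1).image Core.one)).subset ?_
  intro c hc
  cases c with
  | zero u => exact Or.inl (Or.inl ⟨u, hc, rfl⟩)
  | mid m => exact Or.inl (Or.inr ⟨m, trivial, rfl⟩)
  | one v => exact Or.inr ⟨v, hc, rfl⟩

theorem Core.finite_factor (m : Core) : {p : Core × Core | p.1.mul p.2 = some m}.Finite := by
  refine ((Core.finite_len_le m.len).prod (Core.finite_len_le m.len)).subset ?_
  intro p hp
  have := Core.mul_len hp
  exact ⟨(by omega : p.1.len ≤ m.len), (by omega : p.2.len ≤ m.len)⟩

/-- The finite set of factorizations of a monomial into two monomials. -/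
noncomputable def Core.factors (m : Core) : Finset (Core × Core) := (Core.finite_factor m).toFinset

theorem Core.mem_factors {m a b : Core} : (a, b) ∈ m.factors ↔ a.mul b = some m := by
  simp [Core.factors]

/-- The idempotent monomials. -/
def Core.e : Fin 2 → Core
  | 0 => .zero Word.nil
  | 1 => .one Word.nil

theorem Core.left_unit (m : Core) :
    ∃ i, (Core.e i).mul m = some m ∧ ∀ j c, (Core.e j).mul c = some m → j = i ∧ c = m := by
  cases m with
  | zero u =>
    refine ⟨0, by simp [Core.e, Core.mul, Word.mul_eq_some, Word.nil], fun j c h => ?_⟩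
    fin_cases j <;> cases c <;>
      simp [Core.e, Core.mul, Word.mul_eq_some, Word.nil] at h ⊢
    exact Word.ext h
  | mid u =>
    refine ⟨0, by simp [Core.e, Core.mul, Word.nil], fun j c h => ?_⟩
    fin_cases j <;> cases c <;>
      simp [Core.e, Core.mul, Word.mul_eq_some, Word.nil] at h ⊢
    exact h
  | one u =>
    refine ⟨1, by simp [Core.e, Core.mul, Word.mul_eq_some, Word.nil], fun j c h => ?_⟩
    fin_cases j <;> cases c <;>
      simp [Core.e, Core.mul, Word.mul_eq_some, Word.nil] at h ⊢
    exact Word.ext h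

theorem Core.right_unit (m : Core) :
    ∃ i, m.mul (Core.e i) = some m ∧ ∀ j c, c.mul (Core.e j) = some m → j = i ∧ c = m := by
  cases m with
  | zero u =>
    refine ⟨0, by simp [Core.e, Core.mul, Word.mul_eq_some, Word.nil], fun j c h => ?_⟩
    fin_cases j <;> cases c <;>
      simp [Core.e, Core.mul, Word.mul_eq_some, Word.nil] at h ⊢
    exact Word.ext h
  | mid u =>
    refine ⟨1, by simp [Core.e, Core.mul, Word.nil], fun j c h => ?_⟩
    fin_cases j <;> cases c <;>
      simp [Core.e, Core.mul, Word.mul_eq_some, Word.nil] at h ⊢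
    exact h
  | one u =>
    refine ⟨1, by simp [Core.e, Core.mul, Word.mul_eq_some, Word.nil], fun j c h => ?_⟩
    fin_cases j <;> cases c <;>
      simp [Core.e, Core.mul, Word.mul_eq_some, Word.nil] at h ⊢
    exact Word.ext h

/-! ## The algebra of (possibly infinite) sums of `θ`-free monomials, and its subalgebras -/

/-- Arbitrary formal sums of `θ`-free monomials with coefficients in `F = ℤ/2`. -/
def Full : Type := Core → ZMod 2

namespace Full

noncomputable instance : AddCommGroup Full := inferInstanceAs (AddCommGroup (Core → ZMod 2))

noncomputable instance : Module (ZMod 2) Full := inferInstanceAs (Module (ZMod 2) (Core → ZMod 2))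

/-- A single monomial. -/
def mono (m : Core) : Full := fun x => if x = m then 1 else 0

noncomputable instance : Mul Full := ⟨fun f g m => ∑ p ∈ m.factors, f p.1 * g p.2⟩

noncomputable instance : One Full := ⟨mono (Core.e 0) + mono (Core.e 1)⟩

@[ext] theorem ext {f g : Full} (h : ∀ m, f m = g m) : f = g := funext h

@[simp] theorem add_apply (f g : Full) (m : Core) : (f + g) m = f m + g m := rfl

@[simp] theorem zero_apply (m : Core) : (0 : Full) m = 0 := rfl

@[simp] theorem smul_apply (r : ZMod 2) (f : Full) (m : Core) : (r • f) m = r * f m := rfl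

theorem mul_apply (f g : Full) (m : Core) : (f * g) m = ∑ p ∈ m.factors, f p.1 * g p.2 := rfl

theorem one_apply (m : Core) :
    (1 : Full) m = (if m = Core.e 0 then 1 else 0) + (if m = Core.e 1 then 1 else 0) := rfl

theorem e_zero_ne_one : Core.e 0 ≠ Core.e 1 := by simp [Core.e]

theorem one_e (i : Fin 2) : (1 : Full) (Core.e i) = 1 := by
  rw [one_apply]
  fin_cases i <;> simp [e_zero_ne_one, e_zero_ne_one.symm]

theorem one_eq_zero {m : Core} (h : ∀ i, m ≠ Core.e i) : (1 : Full) m = 0 := by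
  simp [one_apply, h]

theorem sum_assoc (m : Core) (F : Core → Core → Core → ZMod 2) :
    ∑ p ∈ m.factors, ∑ q ∈ p.1.factors, F q.1 q.2 p.2
      = ∑ p ∈ m.factors, ∑ q ∈ p.2.factors, F p.1 q.1 q.2 := by
  rw [Finset.sum_sigma', Finset.sum_sigma']
  refine Finset.sum_bij'
    (fun x _ => ⟨(x.2.1, (x.2.2.mul x.1.2).getD x.2.2), (x.2.2, x.1.2)⟩)
    (fun x _ => ⟨((x.1.1.mul x.2.1).getD x.2.1, x.2.2), (x.1.1, x.2.1)⟩) ?_ ?_ ?_ ?_ ?_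
  all_goals
    rintro ⟨⟨x, y⟩, ⟨a, b⟩⟩ h
    simp only [Finset.mem_sigma, Core.mem_factors] at h
  · have := Core.mul_assoc a b y
    rw [h.2] at this
    simp only [Option.bind_some, h.1] at this
    obtain ⟨z, hz, hz'⟩ := Option.bind_eq_some_iff.1 this.symm
    simp [Core.mem_factors, hz, hz']
  · have := Core.mul_assoc x a b
    rw [h.2] at this
    simp only [Option.bind_some, h.1] at this
    obtain ⟨z, hz, hz'⟩ := Option.bind_eq_some_iff.1 this
    simp [Core.mem_factors, hz, hz']
  · simp [h.2]
  · simp [h.2]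
  · rfl

noncomputable instance : Ring Full :=
  { (inferInstance : AddCommGroup Full) with
    mul := (· * ·)
    one := 1
    left_distrib := fun f g h => by
      ext m; simp [mul_apply, mul_add, Finset.sum_add_distrib]
    right_distrib := fun f g h => by
      ext m; simp [mul_apply, add_mul, Finset.sum_add_distrib]
    zero_mul := fun f => by ext m; simp [mul_apply]
    mul_zero := fun f => by ext m; simp [mul_apply]
    mul_assoc := fun f g h => by
      ext m
      simp only [mul_apply, Finset.sum_mul, Finset.mul_sum]
      rw [sum_assoc m (fun a b c => f a * g b * h c)]
      simp only [_root_.mul_assoc]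
    one_mul := fun f => by
      ext m
      obtain ⟨i, hi, hu⟩ := Core.left_unit m
      rw [mul_apply, Finset.sum_eq_single (Core.e i, m)]
      · rw [one_e, _root_.one_mul]
      · rintro ⟨a, b⟩ hab hne
        rw [Core.mem_factors] at hab
        rw [one_eq_zero, zero_mul]
        rintro j rfl
        obtain ⟨rfl, rfl⟩ := hu j b hab
        exact hne rfl
      · intro h
        exact absurd (Core.mem_factors.2 hi) h
    mul_one := fun f => by
      ext m
      obtain ⟨i, hi, hu⟩ := Core.right_unit m
      rw [mul_apply, Finset.sum_eq_single (m, Core.e i)]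
      · rw [one_e, _root_.mul_one]
      · rintro ⟨a, b⟩ hab hne
        rw [Core.mem_factors] at hab
        rw [one_eq_zero (m := b), mul_zero]
        rintro j rfl
        obtain ⟨rfl, rfl⟩ := hu j a hab
        exact hne rfl
      · intro h
        exact absurd (Core.mem_factors.2 hi) h }

noncomputable instance : Algebra (ZMod 2) Full :=
  Algebra.ofModule
    (fun r x y => by ext m; simp [mul_apply, Finset.mul_sum, _root_.mul_assoc])
    (fun r x y => by ext m; simp [mul_apply, Finset.mul_sum, mul_left_comm])

theorem add_self (f : Full) : f + f = 0 := by
  ext m; exact CharTwo.add_self_eq_zero (f m)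

/-- The product of two monomials. -/
theorem mono_mul_mono (a b : Core) :
    mono a * mono b = match a.mul b with
      | some c => mono c
      | none => 0 := by
  ext m
  rw [mul_apply]
  by_cases h : a.mul b = some m
  · rw [Finset.sum_eq_single (a, b)]
    · simp [h, mono]
    · rintro ⟨x, y⟩ _ hne
      simp only [mono, mul_ite, mul_one, mul_zero]
      split_ifs with h1 h2
      · exact absurd (by rw [h1, h2]) hne
      · rfl
      · rfl
    · intro hn
      exact absurd (Core.mem_factors.2 h) hn
  · have : ∑ p ∈ m.factors, mono a p.1 * mono b p.2 = 0 := by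
      refine Finset.sum_eq_zero ?_
      rintro ⟨x, y⟩ hxy
      rw [Core.mem_factors] at hxy
      simp only [mono, mul_ite, mul_one, mul_zero]
      split_ifs with h1 h2
      · subst h1 h2; exact absurd hxy h
      · rfl
      · rfl
    rw [this]
    cases hc : a.mul b with
    | none => rfl
    | some c =>
      rw [hc] at h
      have : m ≠ c := fun hm => h (by rw [hm])
      simp [mono, this]

end Full

/-- Finite sums of monomials. -/
noncomputable def finiteSums : Subalgebra (ZMod 2) Full where
  carrier := {f | {m | f m ≠ 0}.Finite}
  mul_mem' := by
    intro f g hf hg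
    refine ((hf.prod hg).image (fun p => (p.1.mul p.2).getD p.1)).subset ?_
    intro m hm
    obtain ⟨⟨a, b⟩, hab, hne⟩ := Finset.exists_ne_zero_of_sum_ne_zero hm
    rw [Core.mem_factors] at hab
    exact ⟨(a, b), ⟨left_ne_zero_of_mul hne, right_ne_zero_of_mul hne⟩, by simp [hab]⟩
  add_mem' := by
    intro f g hf hg
    refine (hf.union hg).subset ?_
    intro m hm
    by_contra h
    simp only [Set.mem_union, Set.mem_ofPred_eq, not_or, not_not] at h
    exact hm (by rw [Full.add_apply, h.1, h.2, add_zero])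
  algebraMap_mem' := by
    intro r
    refine (Set.finite_range Core.e).subset ?_
    intro m hm
    by_contra h
    refine hm ?_
    rw [Algebra.algebraMap_eq_smul_one, Full.smul_apply, Full.one_eq_zero, mul_zero]
    rintro i rfl
    exact h ⟨i, rfl⟩

/-- Sums of monomials which may be infinite in `I₀ K! I₀`, but are finite elsewhere. (`I₀ K! I₁`
has only four `θ`-free monomials, so finiteness has to be asked only in `I₁ K! I₁`.) -/
noncomputable def completedSums : Subalgebra (ZMod 2) Full where
  carrier := {f | {v : Word L1 | f (Core.one v) ≠ 0}.Finite}
  mul_mem' := by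
    intro f g hf hg
    refine ((hf.prod hg).image (fun p => (p.1.mul p.2).getD p.1)).subset ?_
    intro m hm
    obtain ⟨⟨a, b⟩, hab, hne⟩ := Finset.exists_ne_zero_of_sum_ne_zero hm
    rw [Core.mem_factors] at hab
    cases a <;> cases b <;> simp [Core.mul] at hab
    rename_i a b
    exact ⟨(a, b), ⟨left_ne_zero_of_mul hne, right_ne_zero_of_mul hne⟩, by simp [hab]⟩
  add_mem' := by
    intro f g hf hg
    refine (hf.union hg).subset ?_
    intro m hm
    by_contra h
    simp only [Set.mem_union, Set.mem_ofPred_eq, not_or, not_not] at h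
    exact hm (by rw [Full.add_apply, h.1, h.2, add_zero])
  algebraMap_mem' := by
    intro r
    refine (Set.finite_singleton (Word.nil : Word L1)).subset ?_
    intro m hm
    by_contra h
    refine hm ?_
    rw [Algebra.algebraMap_eq_smul_one, Full.smul_apply, Full.one_eq_zero, mul_zero]
    intro i hi
    fin_cases i <;> simp [Core.e] at hi
    exact h hi

theorem finiteSums_le_completedSums : finiteSums ≤ completedSums := by
  intro f hf
  exact Set.Finite.preimage (fun a _ b _ h => by simpa using h) hf

theorem mono_mem_finiteSums (m : Core) : Full.mono m ∈ finiteSums := by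
  refine (Set.finite_singleton m).subset ?_
  intro x hx
  by_contra h
  exact hx (if_neg h)

/-! ### The central elements `wz + zw` and `φ₋φ₊ + φ₊φ₋` -/

/-- The monomial `wz`. -/
def Core.wz : Core := .zero ⟨[.w, .z], by simp⟩
/-- The monomial `zw`. -/
def Core.zw : Core := .zero ⟨[.z, .w], by simp⟩
/-- The monomial `φ₋φ₊`. -/
def Core.mp : Core := .one ⟨[.minus, .plus], by simp⟩
/-- The monomial `φ₊φ₋`. -/
def Core.pm : Core := .one ⟨[.plus, .minus], by simp⟩

/-- Left and right multiplication of a nonempty alternating word in two letters by `ab + ba`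
agree. -/
theorem Word.two_letter {L : Type} [DecidableEq L] {a b : L} (hab : a ≠ b)
    (hL : ∀ x : L, x = a ∨ x = b) (A B u : Word L) (hA : A.letters = [a, b])
    (hB : B.letters = [b, a]) (hu : u.letters ≠ []) :
    ∃ y, ((A.mul u = some y ∧ B.mul u = none) ∨ (A.mul u = none ∧ B.mul u = some y)) ∧
      ((u.mul A = some y ∧ u.mul B = none) ∨ (u.mul A = none ∧ u.mul B = some y)) := by
  have key : ∀ (t : List L) (p : L), (p :: t).IsChain (· ≠ ·) →
      ∃ r r', r' ≠ r ∧ (p :: t).getLast? = some r ∧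
        ∀ q, q ≠ p → [p, q] ++ (p :: t) = (p :: t) ++ [r', r] := by
    intro t
    induction t with
    | nil =>
      intro p _
      have : ∃ q, q ≠ p := by
        rcases hL p with rfl | rfl
        · exact ⟨b, hab.symm⟩
        · exact ⟨a, hab⟩
      obtain ⟨q, hq⟩ := this
      refine ⟨p, q, hq, rfl, fun q' hq' => ?_⟩
      have : q' = q := by
        rcases hL p with rfl | rfl <;> rcases hL q with rfl | rfl <;>
          rcases hL q' with rfl | rfl <;> simp_all
      simp [this]
    | cons s t ih =>
      intro p hp
      rw [List.isChain_cons_cons] at hp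
      obtain ⟨r, r', hr, hlast, h⟩ := ih s hp.2
      refine ⟨r, r', hr, by simpa using hlast, fun q hq => ?_⟩
      have hqs : q = s := by
        have h1 := hp.1
        rcases hL p with h | h <;> rcases hL q with h' | h' <;> rcases hL s with h'' | h'' <;>
          simp_all
      subst hqs
      have := h p (Ne.symm hq)
      simp only [List.cons_append, List.nil_append] at this ⊢
      rw [this]
  have hnone : ∀ v x : Word L, ¬ (v.letters ++ x.letters).IsChain (· ≠ ·) → v.mul x = none :=
    fun v x h => dif_neg h
  obtain ⟨p, t, hpt⟩ := List.exists_cons_of_ne_nil hu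
  have hch := u.chain
  rw [hpt] at hch
  obtain ⟨r, r', hr, hlast, h⟩ := key t p hch
  have hlast' : ∀ x y : L, x = r → ¬ ((p :: t) ++ [x, y]).IsChain (· ≠ ·) := by
    rintro x y rfl hc
    have := (List.isChain_append.1 hc).2.2 x (by rw [hlast]; rfl) x (by simp)
    exact this rfl
  have main : ∀ q, q ≠ p → ([p, q] ++ (p :: t)).IsChain (· ≠ ·) := by
    intro q hq
    simp only [List.cons_append, List.nil_append]
    exact List.IsChain.cons_cons hq.symm (List.IsChain.cons_cons hq hch)
  have bad : ∀ q, ¬ ([q, p] ++ (p :: t)).IsChain (· ≠ ·) := by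
    intro q hc
    simp only [List.cons_append, List.nil_append, List.isChain_cons_cons] at hc
    exact hc.2.1 rfl
  have right : ∀ y : Word L, (y.letters = (p :: t) ++ [r', r]) →
      ((u.mul A = some y ∧ u.mul B = none) ∨ (u.mul A = none ∧ u.mul B = some y)) := by
    intro y hy
    rcases hL r with h1 | h1
    · have h2 : r' = b := (hL r').resolve_left (h1 ▸ hr)
      refine Or.inr ⟨hnone _ _ ?_, ?_⟩
      · rw [hpt, hA]; exact hlast' _ _ h1.symm
      · rw [Word.mul_eq_some, hpt, hB, hy, h1, h2]
    · have h2 : r' = a := (hL r').resolve_right (h1 ▸ hr)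
      refine Or.inl ⟨?_, hnone _ _ ?_⟩
      · rw [Word.mul_eq_some, hpt, hA, hy, h1, h2]
      · rw [hpt, hB]; exact hlast' _ _ h1.symm
  rcases hL p with rfl | rfl
  · refine ⟨⟨[p, b] ++ (p :: t), main b hab.symm⟩, Or.inl ⟨?_, hnone _ _ ?_⟩,
      right _ (h b hab.symm)⟩
    · rw [Word.mul_eq_some, hA, hpt]
    · rw [hB, hpt]; exact bad b
  · refine ⟨⟨[p, a] ++ (p :: t), main a hab⟩, Or.inr ⟨hnone _ _ ?_, ?_⟩, right _ (h a hab)⟩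
    · rw [hA, hpt]; exact bad a
    · rw [Word.mul_eq_some, hB, hpt]

namespace Full

/-- The element `wz + zw`. -/
noncomputable def wzzw : Full := mono Core.wz + mono Core.zw

/-- The element `φ₋φ₊ + φ₊φ₋`. -/
noncomputable def mppm : Full := mono Core.mp + mono Core.pm

theorem comm_of_mono (g : Full) (hg : ∀ x, g * mono x = mono x * g) (f : Full) :
    g * f = f * g := by
  ext m
  let f' : Full := ∑ b ∈ (Core.finite_len_le m.len).toFinset, f b • mono b
  have hf' : ∀ b : Core, b.len ≤ m.len → f' b = f b := by
    intro b hb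
    have hs : ∀ (s : Finset Core) (b : Core),
        (∑ c ∈ s, f c • mono c : Full) b = ∑ c ∈ s, f c * mono c b := by
      intro s b
      induction s using Finset.induction_on with
      | empty => rfl
      | insert c s hc ih => rw [Finset.sum_insert hc, Finset.sum_insert hc, add_apply, ih]; rfl
    refine (hs _ b).trans ?_
    rw [Finset.sum_eq_single b]
    · simp [mono]
    · intro c _ hc
      simp [mono, hc.symm]
    · intro hn
      exact absurd (by simpa using hb) hn
  have h1 : (g * f) m = (g * f') m := by
    rw [mul_apply, mul_apply]
    refine Finset.sum_congr rfl ?_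
    rintro ⟨a, b⟩ h
    have := Core.mul_len (Core.mem_factors.1 h)
    rw [hf' b (by omega)]
  have h2 : (f * g) m = (f' * g) m := by
    rw [mul_apply, mul_apply]
    refine Finset.sum_congr rfl ?_
    rintro ⟨a, b⟩ h
    have := Core.mul_len (Core.mem_factors.1 h)
    rw [hf' a (by omega)]
  rw [h1, h2, Finset.mul_sum, Finset.sum_mul]
  refine congrFun (Finset.sum_congr rfl fun b _ => ?_) m
  rw [mul_smul_comm, smul_mul_assoc, hg]

theorem wzzw_comm (f : Full) : wzzw * f = f * wzzw := by
  refine comm_of_mono _ (fun x => ?_) f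
  simp only [wzzw, add_mul, mul_add, mono_mul_mono]
  cases x with
  | zero u =>
    by_cases hu : u.letters = []
    · have : u = Word.nil := Word.ext hu
      subst this
      simp [Core.wz, Core.zw, Core.mul, Word.mul, Word.nil]
    · obtain ⟨y, h1, h2⟩ := Word.two_letter (a := L0.w) (b := L0.z) (by simp)
        (fun x => by cases x <;> simp) ⟨[.w, .z], by simp⟩ ⟨[.z, .w], by simp⟩ u rfl rfl hu
      rcases h1 with ⟨h1, h1'⟩ | ⟨h1, h1'⟩ <;> rcases h2 with ⟨h2, h2'⟩ | ⟨h2, h2'⟩ <;>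
        simp [Core.wz, Core.zw, Core.mul, h1, h1', h2, h2']
  | mid m => cases m <;> simp [Core.wz, Core.zw, Core.mul, Mid.lmul]
  | one v => simp [Core.wz, Core.zw, Core.mul]

theorem mppm_comm (f : Full) : mppm * f = f * mppm := by
  refine comm_of_mono _ (fun x => ?_) f
  simp only [mppm, add_mul, mul_add, mono_mul_mono]
  cases x with
  | one u =>
    by_cases hu : u.letters = []
    · have : u = Word.nil := Word.ext hu
      subst this
      simp [Core.mp, Core.pm, Core.mul, Word.mul, Word.nil]
    · obtain ⟨y, h1, h2⟩ := Word.two_letter (a := L1.minus) (b := L1.plus) (by simp)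
        (fun x => by cases x <;> simp) ⟨[.minus, .plus], by simp⟩ ⟨[.plus, .minus], by simp⟩ u
        rfl rfl hu
      rcases h1 with ⟨h1, h1'⟩ | ⟨h1, h1'⟩ <;> rcases h2 with ⟨h2, h2'⟩ | ⟨h2, h2'⟩ <;>
        simp [Core.mp, Core.pm, Core.mul, h1, h1', h2, h2']
  | mid m => cases m <;> simp [Core.mp, Core.pm, Core.mul, Mid.rmul]
  | zero v => simp [Core.mp, Core.pm, Core.mul]

theorem mono_e_mul (i j : Fin 2) :
    mono (Core.e i) * mono (Core.e j) = if i = j then mono (Core.e i) else 0 := by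
  rw [mono_mul_mono]
  fin_cases i <;> fin_cases j <;> simp [Core.e, Core.mul, Word.mul, Word.nil]

end Full

/-! ## Curved dg-algebras over the idempotent ring -/

/-- A curved dg-algebra in characteristic two over the idempotent ring `I = I₀ ⊕ I₁`, where
`I₀ ≅ I₁ ≅ ℤ/2`: an associative unital algebra of characteristic two with two orthogonal idempotents
`e 0`, `e 1` of sum one (equivalently, a ring map from `I`, which makes it an `I`-bimodule), an
`I`-bilinear differential `μ₁ = d` and a central curvature `μ₀ = curv`. -/
structure CurvedDGA where
  carrier : Type
  [ring : Ring carrier]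
  add_self : ∀ a : carrier, a + a = 0
  e : Fin 2 → carrier
  e_mul_e : ∀ i j, e i * e j = if i = j then e i else 0
  e_sum : e 0 + e 1 = 1
  d : carrier →+ carrier
  d_e_mul : ∀ i a, d (e i * a) = e i * d a
  d_mul_e : ∀ i a, d (a * e i) = d a * e i
  d_d : ∀ a, d (d a) = 0
  leibniz : ∀ a b, d (a * b) = d a * b + a * d b
  curv : carrier
  curv_comm : ∀ a, curv * a = a * curv
  d_curv : d curv = 0

instance : CoeSort CurvedDGA Type := ⟨CurvedDGA.carrier⟩

instance (A : CurvedDGA) : Ring A := A.ring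

/-- The curved dg-algebra attached to an algebra `S` of sums of `θ`-free monomials. Its underlying
algebra is `S[θ]/(θ²)` with `θ` central, whose elements are `x = x.fst + θ · x.snd`. The
differential is determined by `μ₁(θ) = wz + zw`, so that `μ₁(x) = (wz + zw) · x.snd`, and the
curvature is `φ₋φ₊ + φ₊φ₋`. -/
noncomputable def koszulAlgebra (S : Subalgebra (ZMod 2) Full) (hS : finiteSums ≤ S) :
    CurvedDGA where
  carrier := DualNumber S
  add_self := fun a => by
    ext1
    · exact Subtype.ext (Full.add_self _)
    · exact Subtype.ext (Full.add_self _)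
  e := fun i => TrivSqZeroExt.inl ⟨Full.mono (Core.e i), hS (mono_mem_finiteSums _)⟩
  e_mul_e := fun i j => by
    rw [← TrivSqZeroExt.inl_mul]
    by_cases h : i = j
    · subst h
      rw [if_pos rfl]
      congr 1
      exact Subtype.ext (by simpa using Full.mono_e_mul i i)
    · rw [if_neg h, ← TrivSqZeroExt.inl_zero]
      congr 1
      exact Subtype.ext (by simpa [h] using Full.mono_e_mul i j)
  e_sum := by
    rw [← TrivSqZeroExt.inl_add, ← TrivSqZeroExt.inl_one]
    rfl
  d :=
    { toFun := fun x => TrivSqZeroExt.inl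
        (⟨Full.wzzw, hS (add_mem (mono_mem_finiteSums _) (mono_mem_finiteSums _))⟩ * x.snd)
      map_zero' := by simp
      map_add' := fun x y => by simp [mul_add] }
  d_e_mul := fun i a => by
    ext1
    · refine Subtype.ext ?_
      simp [← mul_assoc, Full.wzzw_comm]
    · simp
  d_mul_e := fun i a => by
    ext1
    · refine Subtype.ext ?_
      simp [← mul_assoc]
    · simp
  d_d := fun a => by simp
  leibniz := fun a b => by
    have hc : ∀ f : S, (⟨Full.wzzw, hS (add_mem (mono_mem_finiteSums _)
        (mono_mem_finiteSums _))⟩ : S) * f = f * ⟨Full.wzzw, hS (add_mem (mono_mem_finiteSums _)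
        (mono_mem_finiteSums _))⟩ := fun f => Subtype.ext (Full.wzzw_comm f)
    have h2 : ∀ f : S, f + f = 0 := fun f => Subtype.ext (Full.add_self _)
    ext1
    · simp only [AddMonoidHom.coe_mk, ZeroHom.coe_mk, TrivSqZeroExt.fst_inl, TrivSqZeroExt.snd_mul,
        TrivSqZeroExt.fst_add, TrivSqZeroExt.fst_mul, smul_eq_mul, MulOpposite.smul_eq_mul_unop,
        MulOpposite.unop_op, mul_add, ← mul_assoc]
      rw [hc a.fst, add_comm]
    · simp only [AddMonoidHom.coe_mk, ZeroHom.coe_mk, TrivSqZeroExt.snd_inl, TrivSqZeroExt.snd_mul,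
        TrivSqZeroExt.snd_add, TrivSqZeroExt.fst_inl, smul_eq_mul, MulOpposite.smul_eq_mul_unop,
        MulOpposite.unop_op, mul_zero, smul_zero, zero_add, add_zero, ← mul_assoc]
      rw [hc a.snd, h2]
  curv := TrivSqZeroExt.inl
    ⟨Full.mppm, hS (add_mem (mono_mem_finiteSums _) (mono_mem_finiteSums _))⟩
  curv_comm := fun a => by
    ext1
    · exact Subtype.ext (by simpa using Full.mppm_comm _)
    · exact Subtype.ext (by simpa using Full.mppm_comm _)
  d_curv := by simp

/-- The Koszul dual algebra `K!`. -/
noncomputable def koszulDual : CurvedDGA := koszulAlgebra finiteSums le_rfl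

/-- The algebra obtained from `K!` by completing `I₀ K! I₀` along the weight filtration. -/
noncomputable def completedKoszulDual : CurvedDGA :=
  koszulAlgebra completedSums finiteSums_le_completedSums

/-! ## `A∞`-morphisms of curved dg-algebras -/

section Lists

variable {α : Type}

/-- All ways to write a list as a concatenation of two (possibly empty) lists. -/
def splits : List α → List (List α × List α)
  | [] => [([], [])]
  | a :: l => ([], a :: l) :: (splits l).map (fun p => (a :: p.1, p.2))

/-- All ways to insert the entry `c` into a list. -/
def insertTerms (c : α) : List α → List (List α)
  | [] => [[c]]
  | a :: l => (c :: a :: l) :: (insertTerms c l).map (a :: ·)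

/-- All ways to apply `d` to one entry of a list. -/
def diffTerms (d : α → α) : List α → List (List α)
  | [] => []
  | a :: l => (d a :: l) :: (diffTerms d l).map (a :: ·)

/-- All ways to multiply two consecutive entries of a list. -/
def mulTerms [Mul α] : List α → List (List α)
  | [] => []
  | [_] => []
  | a :: b :: l => (a * b :: l) :: (mulTerms (b :: l)).map (a :: ·)

end Lists

/-- All ways to apply one of the operations `μ₀`, `μ₁`, `μ₂` to consecutive entries of a sequence of
elements of a curved dg-algebra. -/
def barTerms (A : CurvedDGA) (l : List A) : List (List A) :=
  insertTerms A.curv l ++ diffTerms A.d l ++ mulTerms l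

/-- A bounded `A∞`-morphism `φ : A → B` of curved dg-algebras over `I`. The operation
`φₙ : A ⊗_I ⋯ ⊗_I A → B` is the restriction of `op` to sequences of length `n`; it is additive in
each entry (which over `ℤ/2` is linearity), `I`-bilinear and balanced over `I`. There is no term
`φ₀`, and `φₙ = 0` for all large `n`. -/
structure AInfHom (A B : CurvedDGA) where
  op : List A → B
  op_nil : op [] = 0
  op_add : ∀ l a b l', op (l ++ (a + b) :: l') = op (l ++ a :: l') + op (l ++ b :: l')
  op_e_cons : ∀ i a l, op (A.e i * a :: l) = B.e i * op (a :: l)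
  op_concat_e : ∀ l a i, op (l ++ [a * A.e i]) = op (l ++ [a]) * B.e i
  op_balanced : ∀ l a i b l', op (l ++ a * A.e i :: b :: l') = op (l ++ a :: A.e i * b :: l')
  rel : ∀ l, ((barTerms A l).map op).sum
    = B.d (op l) + ((splits l).map fun p => op p.1 * op p.2).sum + (if l = [] then B.curv else 0)
  bounded : ∃ n, ∀ l : List A, n < l.length → op l = 0

/-! ## Type-`DA` bimodules -/

section Matrices

variable {A : CurvedDGA} {X Y Z : Type*}

/-- Composition `X → A ⊗ Y → A ⊗ A ⊗ Z → A ⊗ Z` of maps between free left `A`-modules, in terms of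
their (row-finite) matrices: the `(x, z)` entry is the sum over `y` of `M x y * N y z`. -/
noncomputable def mcomp (M : X → Y →₀ A) (N : Y → Z →₀ A) : X → Z →₀ A :=
  fun x => Finsupp.linearCombination A N (M x)

/-- The map `(μ₁ ⊗ id) ∘ M`: the differential applied to each entry. -/
noncomputable def mdiff (M : X → Y →₀ A) : X → Y →₀ A :=
  fun x => (M x).mapRange A.d A.d.map_zero

end Matrices

/-- The underlying data of a type-`DA` bimodule `ᴮP_A`. The underlying `I`-bimodule is the
`ℤ/2`-vector space with basis `gen`, where `x = e (left x) · x · e (right x)` for each basis element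
(every `I`-bimodule has such a basis). An element of `B ⊗_I P` is a finite sum of `b ⊗ x` with
`b = b * e (left x)`, and it is recorded as the finitely supported function of its coefficients. The
value `op [a₁, …, aₙ] x` is the structure map `δ¹ₙ₊₁(x, a₁, …, aₙ)`. -/
structure DAData (A B : CurvedDGA) where
  gen : Type
  left : gen → Fin 2
  right : gen → Fin 2
  op : List A → gen → gen →₀ B

namespace DAData

variable {A B C : CurvedDGA}

/-- Sequences of maps `P ⊗ A ⊗ ⋯ ⊗ A → B ⊗ Q`, on basis elements. -/
abbrev Ops (P Q : DAData A B) : Type := List A → P.gen → Q.gen →₀ B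

/-- The sequence of maps consists of well-defined maps of `I`-bimodules
`P ⊗_I A ⊗_I ⋯ ⊗_I A → B ⊗_I Q`. -/
structure IsBilinear {P Q : DAData A B} (f : Ops P Q) : Prop where
  add : ∀ l a b l' x, f (l ++ (a + b) :: l') x = f (l ++ a :: l') x + f (l ++ b :: l') x
  left_e : ∀ l x y, B.e (P.left x) * f l x y = f l x y
  e_left : ∀ l x y, f l x y * B.e (Q.left y) = f l x y
  nil_right : ∀ x y, P.right x ≠ Q.right y → f [] x y = 0
  e_cons : ∀ i a l x, f (A.e i * a :: l) x = if P.right x = i then f (a :: l) x else 0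
  balanced : ∀ l a i b l' x,
    f (l ++ a * A.e i :: b :: l') x = f (l ++ a :: A.e i * b :: l') x
  concat_e : ∀ l a i x y,
    f (l ++ [a * A.e i]) x y = if Q.right y = i then f (l ++ [a]) x y else 0

/-- The sequence of maps has only finitely many nonzero terms. -/
def IsBounded {P Q : DAData A B} (f : Ops P Q) : Prop :=
  ∃ n, ∀ l : List A, n < l.length → f l = 0

/-- The data form a (bounded) type-`DA` bimodule. -/
structure IsBimodule (P : DAData A B) : Prop where
  bilinear : IsBilinear (P := P) (Q := P) P.op
  bounded : IsBounded (P := P) (Q := P) P.op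
  rel : ∀ l x, ((splits l).map fun p => mcomp (P.op p.1) (P.op p.2) x).sum + mdiff (P.op l) x
    + ((barTerms A l).map fun l' => P.op l' x).sum
    + (if l = [] then Finsupp.single x (B.curv * B.e (P.left x)) else 0) = 0

/-- The composition of sequences of maps: first `f`, then `g`. -/
noncomputable def Ops.comp {P Q R : DAData A B} (f : Ops P Q) (g : Ops Q R) : Ops P R :=
  fun l x => ((splits l).map fun p => mcomp (f p.1) (g p.2) x).sum

/-- The identity morphism: `1 ⊗ x` without further inputs, zero otherwise. -/
noncomputable def Ops.id (P : DAData A B) : Ops P P :=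
  fun l x => if l = [] then Finsupp.single x (B.e (P.left x)) else 0

/-- The morphism differential. -/
noncomputable def Ops.diff {P Q : DAData A B} (f : Ops P Q) : Ops P Q :=
  fun l x => mdiff (f l) x + Ops.comp (P := P) (Q := P) (R := Q) P.op f l x
    + Ops.comp (P := P) (Q := Q) (R := Q) f Q.op l x
    + ((barTerms A l).map fun l' => f l' x).sum

/-- A bounded closed morphism of type-`DA` bimodules. -/
structure IsHom {P Q : DAData A B} (f : Ops P Q) : Prop where
  bilinear : IsBilinear f
  bounded : IsBounded f
  closed : f.diff = 0

/-- Two type-`DA` bimodules are isomorphic. -/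
def Isomorphic (P Q : DAData A B) : Prop :=
  ∃ (f : Ops P Q) (g : Ops Q P), IsHom f ∧ IsHom g ∧ f.comp g = Ops.id P ∧ g.comp f = Ops.id Q

/-- One step of the box tensor product. `boxAux n bs l x y` is the sum of all
`δ^P(x, bs, b₁, …, bₙ) ⊗ y'`, where `b₁ ⊗ ⋯ ⊗ bₙ ⊗ y'` is obtained by applying the structure maps of
`Q` to `y` a total of `n` times, which consume the inputs `l` in order. -/
noncomputable def boxAux (P : DAData B C) (Q : DAData A B) :
    ℕ → List B → List A → P.gen → Q.gen → P.gen × Q.gen →₀ C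
  | 0, bs, [], x, y => (P.op bs x).embDomain (Function.Embedding.sectL P.gen y)
  | 0, _, _ :: _, _, _ => 0
  | n + 1, bs, l, x, y => ((splits l).map fun p =>
      (Q.op p.1 y).sum fun y' b => boxAux P Q n (bs ++ [b]) p.2 x y').sum

/-- The box tensor product `ᶜP_B ⊠ ᴮQ_A`, defined if `P` is bounded. Its underlying bimodule is
`P ⊗_I Q`. -/
noncomputable def box (P : DAData B C) (Q : DAData A B) : DAData A C where
  gen := {p : P.gen × Q.gen // P.right p.1 = Q.left p.2}
  left := fun p => P.left p.1.1
  right := fun p => Q.right p.1.2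
  op := fun l p => (∑ᶠ n, boxAux P Q n [] l p.1.1 p.1.2).subtypeDomain
    (fun p => P.right p.1 = Q.left p.2)

end DAData

/-- The rank-one bimodule `ᴮ[φ]_A` induced by an `A∞`-morphism `φ : A → B`: its underlying bimodule
is `I`, and `δ¹ₙ₊₁(1, a₁, …, aₙ) = φₙ(a₁, …, aₙ) ⊗ 1`. -/
noncomputable def AInfHom.bimodule {A B : CurvedDGA} (φ : AInfHom A B) : DAData A B where
  gen := Fin 2
  left := fun i => i
  right := fun i => i
  op := fun l i => Finsupp.equivFunOnFinite.symm fun j => B.e i * φ.op l * B.e j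

/-- The identity bimodule `ᴬI_A`: the underlying bimodule is `I`, with `δ¹₂(1, a) = a ⊗ 1` and all
other structure maps zero. -/
noncomputable def idBimodule (A : CurvedDGA) : DAData A A where
  gen := Fin 2
  left := fun i => i
  right := fun i => i
  op := fun l i => match l with
    | [a] => Finsupp.equivFunOnFinite.symm fun j => A.e i * a * A.e j
    | _ => 0

/-! ## dg-categories and `A∞`-functors in characteristic two -/

open CategoryTheory

section DG

universe v v' w w' t t'

/-- A dg-category of characteristic two: the morphism groups carry differentials which satisfy the
Leibniz rule. -/
class DGCategory (C : Type w) [Category.{v} C] [Preadditive C] where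
  d : ∀ {X Y : C}, (X ⟶ Y) →+ (X ⟶ Y)
  add_self : ∀ {X Y : C} (f : X ⟶ Y), f + f = 0
  d_d : ∀ {X Y : C} (f : X ⟶ Y), d (d f) = 0
  leibniz : ∀ {X Y Z : C} (f : X ⟶ Y) (g : Y ⟶ Z), d (f ≫ g) = d f ≫ g + f ≫ d g

/-! Sequences of composable morphisms are elements of `Quiver.Path X Y`. -/

section Paths

variable {C : Type w} [Category.{v} C]

/-- All ways to write a sequence of composable morphisms as a concatenation of two (possibly empty)
sequences. -/
def pathSplits {X : C} : ∀ {Y : C}, Quiver.Path X Y →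
    List (Σ Z : C, Quiver.Path X Z × Quiver.Path Z Y)
  | _, .nil => [⟨X, .nil, .nil⟩]
  | Y, .cons p f => ⟨Y, .cons p f, .nil⟩ ::
      (pathSplits p).map (fun s => ⟨s.1, s.2.1, s.2.2.cons f⟩)

/-- All ways to apply the differential to one morphism of a sequence. -/
def pathDiffs [Preadditive C] [DGCategory C] {X : C} : ∀ {Y : C}, Quiver.Path X Y →
    List (Quiver.Path X Y)
  | _, .nil => []
  | _, .cons p f => p.cons (DGCategory.d f) :: (pathDiffs p).map (fun q => q.cons f)

/-- All ways to compose two consecutive morphisms of a sequence. -/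
def pathComps {X : C} : ∀ {Y : C}, Quiver.Path X Y → List (Quiver.Path X Y)
  | _, .nil => []
  | _, .cons .nil _ => []
  | _, .cons (.cons p f) g =>
      p.cons (f ≫ g) :: (pathComps (.cons p f)).map (fun q => q.cons g)

end Paths

/-- The data of an `A∞`-functor: an object map, and for each sequence of `n` composable morphisms a
morphism `F_n(f₁, …, fₙ)` between the images of the endpoints. -/
structure AInfFunctorData (C : Type w) (D : Type w') [Category.{v} C] [Category.{v'} D] where
  obj : C → D
  map : ∀ {X Y : C}, Quiver.Path X Y → (obj X ⟶ obj Y)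

namespace AInfFunctorData

variable {C : Type w} {D : Type w'} {E : Type t} [Category.{v} C] [Category.{v'} D]
  [Category.{t'} E]

/-- The identity functor. -/
def id (C : Type w) [Category.{v} C] [Preadditive C] : AInfFunctorData C C where
  obj := fun X => X
  map := fun p => match p with
    | .cons .nil f => f
    | _ => 0

/-- `images F p r` lists the sequences `F(p₁), …, F(p_k), F(p_{k+1} r)`, where `p = p₁ ⋯ p_k p_{k+1}`
is cut into consecutive pieces of which `p₁, …, p_k` are nonempty. -/
def images (F : AInfFunctorData C D) {X : C} : ∀ {Y Z : C}, Quiver.Path X Y → Quiver.Path Y Z →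
    List (Quiver.Path (F.obj X) (F.obj Z))
  | _, _, .nil, r => [(F.map r).toPath]
  | _, _, .cons p f, r =>
      (images F p f.toPath).map (fun q => q.cons (F.map r)) ++ images F p (f.toPath.comp r)

/-- The composition of `A∞`-functors: on a sequence of morphisms, first apply `F` to the pieces of
all its partitions into nonempty consecutive pieces, then `G`. -/
def comp [Preadditive E] (F : AInfFunctorData C D) (G : AInfFunctorData D E) :
    AInfFunctorData C E where
  obj := fun X => G.obj (F.obj X)
  map := fun p => match p with
    | .nil => 0
    | .cons p f => ((images F p f.toPath).map G.map).sum

variable [Preadditive C] [Preadditive D] [DGCategory C] [DGCategory D]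

/-- The data form an `A∞`-functor between dg-categories (unital on single morphisms). -/
structure IsAInfFunctor (F : AInfFunctorData C D) : Prop where
  map_nil : ∀ X : C, F.map (.nil : Quiver.Path X X) = 0
  map_add : ∀ {W X Y Z : C} (p : Quiver.Path W X) (f g : X ⟶ Y) (q : Quiver.Path Y Z),
    F.map ((p.cons (f + g)).comp q) = F.map ((p.cons f).comp q) + F.map ((p.cons g).comp q)
  map_id : ∀ X : C, F.map (𝟙 X : X ⟶ X).toPath = 𝟙 (F.obj X)
  rel : ∀ {X Y : C} (p : Quiver.Path X Y),
    ((pathDiffs p).map F.map).sum + ((pathComps p).map F.map).sum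
      = DGCategory.d (F.map p) + ((pathSplits p).map fun s => F.map s.2.1 ≫ F.map s.2.2).sum

/-- The data of an `A∞`-natural transformation. -/
abbrev PreTrans (F G : AInfFunctorData C D) : Type _ :=
  ∀ {X Y : C}, Quiver.Path X Y → (F.obj X ⟶ G.obj Y)

/-- An `A∞`-natural transformation: additive in each entry, and closed for the differential of the
dg-category of `A∞`-functors. -/
structure IsNatTrans {F G : AInfFunctorData C D} (T : PreTrans F G) : Prop where
  map_add : ∀ {W X Y Z : C} (p : Quiver.Path W X) (f g : X ⟶ Y) (q : Quiver.Path Y Z),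
    T ((p.cons (f + g)).comp q) = T ((p.cons f).comp q) + T ((p.cons g).comp q)
  closed : ∀ {X Y : C} (p : Quiver.Path X Y),
    DGCategory.d (T p) + ((pathSplits p).map fun s => T s.2.1 ≫ G.map s.2.2).sum
      + ((pathSplits p).map fun s => F.map s.2.1 ≫ T s.2.2).sum
      + ((pathDiffs p).map fun q => T q).sum + ((pathComps p).map fun q => T q).sum = 0

/-- The composition of `A∞`-natural transformations: first `S`, then `T`. -/
def PreTrans.comp {F G H : AInfFunctorData C D} (S : PreTrans F G) (T : PreTrans G H) :
    PreTrans F H :=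
  fun p => ((pathSplits p).map fun s => S s.2.1 ≫ T s.2.2).sum

/-- The identity natural transformation. -/
def PreTrans.id (F : AInfFunctorData C D) : PreTrans F F :=
  fun p => match p with
    | .nil => 𝟙 _
    | .cons _ _ => 0

/-- Two `A∞`-functors are isomorphic. -/
def Isomorphic (F G : AInfFunctorData C D) : Prop :=
  ∃ (S : PreTrans F G) (T : PreTrans G F), IsNatTrans S ∧ IsNatTrans T ∧
    (∀ {X Y : C} (p : Quiver.Path X Y), PreTrans.comp S T p = PreTrans.id F p) ∧
    (∀ {X Y : C} (p : Quiver.Path X Y), PreTrans.comp T S p = PreTrans.id G p)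

/-- Two `A∞`-functors are mutually inverse `A∞`-equivalences of dg-categories. -/
structure AreInverseEquivalences (F : AInfFunctorData C D) (G : AInfFunctorData D C) : Prop where
  left_functor : F.IsAInfFunctor
  right_functor : G.IsAInfFunctor
  left_inv : Isomorphic (F.comp G) (id C)
  right_inv : Isomorphic (G.comp F) (id D)

end AInfFunctorData

end DG

/-! ## The dg-category of type-`D` modules -/


/-- A left type-`D` module `ᴬX` over a curved dg-algebra. The underlying `I`-module is the
`ℤ/2`-vector space with basis `gen`, where `x = e (idem x) · x` for each basis element (every
`I`-module has such a basis). An element of `A ⊗_I X` is a finite sum of `a ⊗ x` with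
`a = a * e (idem x)`, and it is recorded as the finitely supported function of its coefficients. The
structure map is `δ¹ = δ : X → A ⊗_I X`. -/
structure TypeD (A : CurvedDGA) where
  gen : Type u
  idem : gen → Fin 2
  δ : gen → gen →₀ A
  e_mul : ∀ x y, A.e (idem x) * δ x y = δ x y
  mul_e : ∀ x y, δ x y * A.e (idem y) = δ x y
  rel : ∀ x, mcomp δ δ x + mdiff δ x + Finsupp.single x (A.curv * A.e (idem x)) = 0

section MatrixLemmas

variable {A : CurvedDGA} {W X Y Z : Type*}

theorem mcomp_assoc (M : W → X →₀ A) (N : X → Y →₀ A) (P : Y → Z →₀ A) :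
    mcomp (mcomp M N) P = mcomp M (mcomp N P) := by
  funext w
  unfold mcomp
  induction M w using Finsupp.induction_linear with
  | zero => simp
  | add f g hf hg => simp [map_add, hf, hg]
  | single x a => simp [Finsupp.linearCombination_single, map_smul]

theorem mcomp_apply (M : X → Y →₀ A) (N : Y → Z →₀ A) (x : X) (z : Z) :
    mcomp M N x z = (M x).sum fun y a => a * N y z := by
  simp [mcomp, Finsupp.linearCombination_apply, Finsupp.sum, Finsupp.finsetSum_apply]

theorem mcomp_add_left (M M' : X → Y →₀ A) (N : Y → Z →₀ A) :
    mcomp (M + M') N = mcomp M N + mcomp M' N := by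
  funext x; simp [mcomp]

theorem mcomp_add_right (M : X → Y →₀ A) (N N' : Y → Z →₀ A) :
    mcomp M (N + N') = mcomp M N + mcomp M N' := by
  funext x; ext z
  simp [mcomp_apply, mul_add]

theorem mdiff_add (M M' : X → Y →₀ A) : mdiff (M + M') = mdiff M + mdiff M' := by
  funext x; ext y; simp [mdiff]

theorem mdiff_mdiff (M : X → Y →₀ A) : mdiff (mdiff M) = 0 := by
  funext x; ext y; simp [mdiff, A.d_d]

theorem mdiff_mcomp (M : X → Y →₀ A) (N : Y → Z →₀ A) :
    mdiff (mcomp M N) = mcomp (mdiff M) N + mcomp M (mdiff N) := by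
  funext x; ext z
  change A.d (mcomp M N x z) = mcomp (mdiff M) N x z + mcomp M (mdiff N) x z
  rw [mcomp_apply, mcomp_apply, mcomp_apply]
  unfold mdiff
  rw [Finsupp.sum_mapRange_index (by simp)]
  simp only [Finsupp.sum, map_sum, A.leibniz, Finset.sum_add_distrib, Finsupp.mapRange_apply]

theorem madd_self (M : X → Y →₀ A) : M + M = 0 := by
  funext x; ext y; exact A.add_self _

end MatrixLemmas

namespace TypeD

variable {A B : CurvedDGA}

/-- The finitely supported functions which represent elements of `I_i A ⊗_I Y`. -/
def rows (i : Fin 2) (Y : TypeD.{u} A) : AddSubgroup (Y.gen →₀ A) where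
  carrier := {r | ∀ y, A.e i * r y = r y ∧ r y * A.e (Y.idem y) = r y}
  zero_mem' := fun y => by simp
  add_mem' := fun {r s} hr hs y => by
    simp [mul_add, add_mul, (hr y).1, (hr y).2, (hs y).1, (hs y).2]
  neg_mem' := fun {r} hr y => by simp [(hr y).1, (hr y).2]

/-- The group of `I`-linear maps `X → A ⊗_I Y`. -/
def homs (X Y : TypeD.{u} A) : AddSubgroup (X.gen → Y.gen →₀ A) where
  carrier := {M | ∀ x, M x ∈ rows (X.idem x) Y}
  zero_mem' := fun _ => zero_mem _
  add_mem' := fun hr hs x => add_mem (hr x) (hs x)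
  neg_mem' := fun hr x => neg_mem (hr x)

/-- Morphisms of type-`D` modules, not necessarily closed: `I`-linear maps `X → A ⊗_I Y`. -/
def Hom (X Y : TypeD.{u} A) : Type u := homs X Y

theorem mcomp_mem {X Y Z : TypeD.{u} A} {M : X.gen → Y.gen →₀ A} {N : Y.gen → Z.gen →₀ A}
    (hM : M ∈ homs X Y) (hN : N ∈ homs Y Z) : mcomp M N ∈ homs X Z := by
  intro x z
  rw [mcomp_apply, Finsupp.sum, Finset.mul_sum, Finset.sum_mul]
  exact ⟨Finset.sum_congr rfl fun y _ => by rw [← mul_assoc, (hM x y).1],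
    Finset.sum_congr rfl fun y _ => by rw [mul_assoc, (hN y z).2]⟩

/-- The identity matrix. -/
noncomputable def idMatrix (X : TypeD.{u} A) : X.gen → X.gen →₀ A :=
  fun x => Finsupp.single x (A.e (X.idem x))

theorem idMatrix_mem (X : TypeD.{u} A) : idMatrix X ∈ homs X X := by
  intro x y
  by_cases h : x = y
  · subst h
    simp [idMatrix, A.e_mul_e]
  · simp [idMatrix, Finsupp.single_eq_of_ne' h]

theorem δ_mem (X : TypeD.{u} A) : X.δ ∈ homs X X := fun x y => ⟨X.e_mul x y, X.mul_e x y⟩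

theorem mdiff_mem {X Y : TypeD.{u} A} {M : X.gen → Y.gen →₀ A} (hM : M ∈ homs X Y) :
    mdiff M ∈ homs X Y := by
  intro x y
  have h := hM x y
  simp only [mdiff, Finsupp.mapRange_apply]
  exact ⟨by rw [← A.d_e_mul, h.1], by rw [← A.d_mul_e, h.2]⟩

theorem id_mcomp {X Y : TypeD.{u} A} {M : X.gen → Y.gen →₀ A} (hM : M ∈ homs X Y) :
    mcomp (idMatrix X) M = M := by
  funext x; ext y
  simp [mcomp, idMatrix, (hM x y).1]

theorem mcomp_id {X Y : TypeD.{u} A} {M : X.gen → Y.gen →₀ A} (hM : M ∈ homs X Y) :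
    mcomp M (idMatrix Y) = M := by
  funext x; ext y
  rw [mcomp_apply, Finsupp.sum, Finset.sum_eq_single y]
  · simp [idMatrix, (hM x y).2]
  · intro z _ hz
    simp [idMatrix, hz]
  · intro h
    simp [Finsupp.notMem_support_iff.1 h]

noncomputable instance (X Y : TypeD.{u} A) : AddCommGroup (Hom X Y) :=
  inferInstanceAs (AddCommGroup (homs X Y))

noncomputable instance : Category.{u} (TypeD.{u} A) where
  Hom := Hom
  id X := ⟨idMatrix X, idMatrix_mem X⟩
  comp f g := ⟨mcomp f.1 g.1, mcomp_mem f.2 g.2⟩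
  id_comp f := Subtype.ext (id_mcomp f.2)
  comp_id f := Subtype.ext (mcomp_id f.2)
  assoc f g h := Subtype.ext (mcomp_assoc f.1 g.1 h.1)

/-- The matrix of a morphism. -/
def matrix {X Y : TypeD.{u} A} (f : X ⟶ Y) : X.gen → Y.gen →₀ A :=
  Subtype.val (p := (· ∈ homs X Y)) f

noncomputable instance : Preadditive (TypeD.{u} A) where
  homGroup X Y := inferInstanceAs (AddCommGroup (Hom X Y))
  add_comp _ _ _ f f' g := Subtype.ext (mcomp_add_left (matrix f) (matrix f') (matrix g))
  comp_add _ _ _ f g g' := Subtype.ext (mcomp_add_right (matrix f) (matrix g) (matrix g'))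

/-- The structure map, as an endomorphism. -/
def δHom (X : TypeD.{u} A) : X ⟶ X := (⟨X.δ, δ_mem X⟩ : homs X X)

/-- The endomorphism `μ₀ ⊗ id`. -/
noncomputable def curvHom (X : TypeD.{u} A) : X ⟶ X :=
  (⟨fun x => Finsupp.single x (A.curv * A.e (X.idem x)), by
    intro x y
    by_cases h : x = y
    · subst h
      simp only [Finsupp.single_eq_same]
      rw [← mul_assoc, ← A.curv_comm, mul_assoc, A.e_mul_e]
      simp
    · simp [Finsupp.single_eq_of_ne' h]⟩ : homs X X)

/-- The map `f ↦ (μ₁ ⊗ id) ∘ f`. -/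
noncomputable def diffHom {X Y : TypeD.{u} A} : (X ⟶ Y) →+ (X ⟶ Y) :=
  AddMonoidHom.mk' (fun f => (⟨mdiff (matrix f), mdiff_mem f.2⟩ : homs X Y))
    (fun f g => Subtype.ext (mdiff_add (matrix f) (matrix g)))

theorem hom_add_self {X Y : TypeD.{u} A} (f : X ⟶ Y) : f + f = 0 :=
  Subtype.ext (madd_self (matrix f))

theorem δHom_rel (X : TypeD.{u} A) : δHom X ≫ δHom X + diffHom (δHom X) + curvHom X = 0 :=
  Subtype.ext (funext X.rel)

theorem diffHom_diffHom {X Y : TypeD.{u} A} (f : X ⟶ Y) : diffHom (diffHom f) = 0 :=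
  Subtype.ext (mdiff_mdiff (matrix f))

theorem diffHom_comp {X Y Z : TypeD.{u} A} (f : X ⟶ Y) (g : Y ⟶ Z) :
    diffHom (f ≫ g) = diffHom f ≫ g + f ≫ diffHom g :=
  Subtype.ext (mdiff_mcomp (matrix f) (matrix g))

theorem curvHom_comm {X Y : TypeD.{u} A} (f : X ⟶ Y) : curvHom X ≫ f = f ≫ curvHom Y := by
  refine Subtype.ext (funext fun x => Finsupp.ext fun y => ?_)
  have h := f.2 x y
  change mcomp (fun x => Finsupp.single x (A.curv * A.e (X.idem x))) (matrix f) x y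
    = mcomp (matrix f) (fun x => Finsupp.single x (A.curv * A.e (Y.idem x))) x y
  change A.e (X.idem x) * matrix f x y = matrix f x y ∧
    matrix f x y * A.e (Y.idem y) = matrix f x y at h
  rw [mcomp_apply, mcomp_apply, Finsupp.sum_single_index (by simp), Finsupp.sum,
    Finset.sum_eq_single y]
  · rw [Finsupp.single_eq_same, mul_assoc, h.1, A.curv_comm (A.e _), ← mul_assoc, h.2, A.curv_comm]
  · intro z _ hz
    simp [hz]
  · intro hn
    simp [Finsupp.notMem_support_iff.1 hn]

/-- Type-`D` modules form a dg-category, with `∂f = (μ₁ ⊗ id) ∘ f + δ_Y ∘ f + f ∘ δ_X`. -/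
noncomputable instance : DGCategory (TypeD.{u} A) where
  d {X Y} := AddMonoidHom.mk' (fun f => diffHom f + f ≫ δHom Y + δHom X ≫ f) (fun f g => by
    rw [map_add, Preadditive.add_comp, Preadditive.comp_add]; abel)
  add_self := hom_add_self
  d_d {X Y} f := by
    have hX : δHom X ≫ δHom X + diffHom (δHom X) = curvHom X := by
      rw [← sub_eq_zero, ← δHom_rel X, sub_eq_add_neg]
      congr 1
      rw [neg_eq_iff_add_eq_zero, hom_add_self]
    have hY : δHom Y ≫ δHom Y + diffHom (δHom Y) = curvHom Y := by
      rw [← sub_eq_zero, ← δHom_rel Y, sub_eq_add_neg]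
      congr 1
      rw [neg_eq_iff_add_eq_zero, hom_add_self]
    simp only [AddMonoidHom.mk'_apply, map_add, diffHom_diffHom, diffHom_comp,
      Category.assoc, zero_add]
    have e1 := curvHom_comm f
    rw [← hX, ← hY, Preadditive.add_comp, Preadditive.comp_add, Category.assoc] at e1
    have e2 := hom_add_self (diffHom f ≫ δHom Y)
    have e3 := hom_add_self (δHom X ≫ diffHom f)
    have e4 := hom_add_self (δHom X ≫ f ≫ δHom Y)
    have e5 := hom_add_self (f ≫ δHom Y ≫ δHom Y + f ≫ diffHom (δHom Y))
    calc _ = (diffHom f ≫ δHom Y + diffHom f ≫ δHom Y) + (δHom X ≫ diffHom f + δHom X ≫ diffHom f)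
          + (δHom X ≫ f ≫ δHom Y + δHom X ≫ f ≫ δHom Y)
          + ((δHom X ≫ δHom X ≫ f + diffHom (δHom X) ≫ f)
            + (f ≫ δHom Y ≫ δHom Y + f ≫ diffHom (δHom Y))) := by abel
      _ = 0 := by rw [e1, e2, e3, e4, e5]; simp
  leibniz {X Y Z} f g := by
    simp only [AddMonoidHom.mk'_apply, diffHom_comp, Preadditive.add_comp, Preadditive.comp_add,
      Category.assoc]
    have e := hom_add_self (f ≫ δHom Y ≫ g)
    calc _ = (diffHom f ≫ g + f ≫ diffHom g) + f ≫ g ≫ δHom Z + δHom X ≫ f ≫ g + 0 := by abel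
      _ = _ := by rw [← e]; abel

end TypeD

/-! ## The functor induced by an `A∞`-morphism -/

namespace TypeD

variable {A B : CurvedDGA}

/-- All ways to insert exactly `k` structure maps `δ` into a sequence of composable morphisms of
type-`D` modules (before, between and after the given morphisms). -/
def insertions {X : TypeD.{u} A} : ℕ → ∀ {Y : TypeD.{u} A}, Quiver.Path X Y →
    List (Quiver.Path X Y)
  | 0, _, p => [p]
  | k + 1, _, .nil => (insertions k .nil).map (fun q => q.cons (δHom X))
  | k + 1, Y, .cons p f => (insertions k (.cons p f)).map (fun q => q.cons (δHom Y)) ++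
      (insertions (k + 1) p).map (fun q => q.cons f)
  termination_by k _ p => (k, p.length)

/-- A sequence of morphisms `X → A ⊗ X₁`, `X₁ → A ⊗ X₂`, …, `→ A ⊗ Y` sends `x` to an element of
`A ⊗ ⋯ ⊗ A ⊗ Y`. This is the sum of the values of `K` on the terms `a₁ ⊗ ⋯ ⊗ aₙ ⊗ y` of that
element. -/
noncomputable def sumWords {M : Type*} [AddCommMonoid M] {X : TypeD.{u} A} :
    ∀ {Y : TypeD.{u} A}, Quiver.Path X Y → (List A → Y.gen → M) → X.gen → M
  | _, .nil, K, x => K [] x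
  | _, .cons p f, K, x => sumWords p (fun l y => (matrix f y).sum fun z a => K (l ++ [a]) z) x

theorem sumWords_mem {M : Type*} [AddCommGroup M] (S : AddSubgroup M) {X : TypeD.{u} A} (x : X.gen)
    {Y : TypeD.{u} A} (p : Quiver.Path X Y) (K : List A → Y.gen → M)
    (hK : ∀ l y, (l = [] → X.idem x = Y.idem y) → (∀ a l', l = a :: l' → A.e (X.idem x) * a = a) →
      (∀ a l', l = l' ++ [a] → a * A.e (Y.idem y) = a) → K l y ∈ S) :
    sumWords p K x ∈ S := by
  induction p with
  | nil => exact hK [] x (fun _ => rfl) (by simp) (by simp)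
  | cons p f ih =>
    refine ih _ fun l y h1 h2 h3 => ?_
    refine sum_mem fun z _ => hK _ _ (by simp) ?_ ?_
    · intro a l' hl
      cases l with
      | nil =>
        simp only [List.nil_append, List.cons.injEq] at hl
        rw [h1 rfl, ← hl.1]
        exact (f.2 y z).1
      | cons b l =>
        simp only [List.cons_append, List.cons.injEq] at hl
        exact h2 a l (by rw [hl.1])
    · intro a l' hl
      obtain ⟨_, ha⟩ := List.append_inj' hl rfl
      simp only [List.cons.injEq, and_true] at ha
      rw [← ha]
      exact (f.2 y z).2

end TypeD

namespace AInfHom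

open TypeD

variable {A B : CurvedDGA} (φ : AInfHom A B)

/-- The map `X → B ⊗ Y` obtained from a sequence of morphisms `f₁, …, fₙ` of type-`D` modules by
inserting structure maps in all possible ways and applying `φ` to the algebra outputs:
`∑ (φ ⊗ id)(δ, …, δ, f₁, δ, …, δ, f₂, …, fₙ, δ, …, δ)`. The sum is finite since `φ` is bounded. -/
noncomputable def push {X Y : TypeD.{u} A} (p : Quiver.Path X Y) : X.gen → Y.gen →₀ B :=
  fun x => ∑ᶠ k : ℕ, ((insertions k p).map fun q =>
    sumWords q (fun l y => Finsupp.single y (φ.op l)) x).sum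

/-- The structure map `∑ₙ (φₙ ⊗ id) ∘ δⁿ` of the induced module `ᴮ[φ]_A ⊠ ᴬX`. -/
noncomputable def pushδ (X : TypeD.{u} A) : X.gen → X.gen →₀ B :=
  φ.push (.nil : Quiver.Path X X)

theorem push_mem {X Y : TypeD.{u} A} (p : Quiver.Path X Y) (x : X.gen) (y : Y.gen) :
    B.e (X.idem x) * φ.push p x y = φ.push p x y ∧ φ.push p x y * B.e (Y.idem y) = φ.push p x y := by
  let S : AddSubgroup (Y.gen →₀ B) :=
    { carrier := {r | ∀ y, B.e (X.idem x) * r y = r y ∧ r y * B.e (Y.idem y) = r y}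
      zero_mem' := fun y => by simp
      add_mem' := fun {r s} hr hs y => by
        simp [mul_add, add_mul, (hr y).1, (hr y).2, (hs y).1, (hs y).2]
      neg_mem' := fun {r} hr y => by simp [(hr y).1, (hr y).2] }
  have : φ.push p x ∈ S := by
    refine finsum_induction (· ∈ S) S.zero_mem (fun _ _ => S.add_mem) fun k => ?_
    refine S.list_sum_mem fun r hr => ?_
    obtain ⟨q, _, rfl⟩ := List.mem_map.1 hr
    refine sumWords_mem S x q _ fun l z h1 h2 h3 => ?_
    intro w
    by_cases hw : z = w
    · subst hw
      simp only [Finsupp.single_eq_same]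
      constructor
      · cases l with
        | nil => simp [φ.op_nil]
        | cons a l => rw [← φ.op_e_cons, h2 a l rfl]
      · rcases List.eq_nil_or_concat l with rfl | ⟨l', a, rfl⟩
        · simp [φ.op_nil]
        · rw [List.concat_eq_append] at h3 ⊢
          rw [← φ.op_concat_e, h3 a l' rfl]
    · simp [Finsupp.single_eq_of_ne' hw]
  exact this y

/-- The induced structure maps satisfy the structure equation of a type-`D` module. -/
def PreservesTypeD : Prop :=
  ∀ (X : TypeD.{u} A) (x : X.gen), mcomp (φ.pushδ X) (φ.pushδ X) x + mdiff (φ.pushδ X) x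
    + Finsupp.single x (B.curv * B.e (X.idem x)) = 0

/-- The functor `ᴮ[φ]_A ⊠ -` on type-`D` modules. It keeps the underlying `I`-modules. -/
noncomputable def functor (h : PreservesTypeD.{u} φ) :
    AInfFunctorData (TypeD.{u} A) (TypeD.{u} B) where
  obj := fun X =>
    { gen := X.gen
      idem := X.idem
      δ := φ.pushδ X
      e_mul := fun x y => (φ.push_mem _ x y).1
      mul_e := fun x y => (φ.push_mem _ x y).2
      rel := h X }
  map := fun p => match p with
    | .nil => 0
    | .cons p f => ⟨φ.push (.cons p f), fun x y => φ.push_mem (.cons p f) x y⟩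

end AInfHom

/-! ## The inclusion `ι` and the morphism `φ` -/

/-- The inclusion of `K!` into its completion. -/
noncomputable def inclusion (x : DualNumber finiteSums) : DualNumber completedSums :=
  TrivSqZeroExt.inl (Subalgebra.inclusion finiteSums_le_completedSums x.fst) +
    TrivSqZeroExt.inr (Subalgebra.inclusion finiteSums_le_completedSums x.snd)

/-- The operations of `ι`: `ι₁` is the inclusion and all other operations vanish. -/
noncomputable def inclusionOp : List koszulDual → completedKoszulDual
  | [x] => inclusion x
  | _ => 0

/-- A monomial of `I₀ K! I₀` is a word in `w` and `z`, possibly multiplied by `θ` (if the first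
component is `true`). -/
abbrev Mono00 : Type := Bool × Word L0

namespace Mono00

/-- `wt_θ`: the number of letters `θ`. -/
def wtTheta (a : Mono00) : ℕ := if a.1 then 1 else 0

/-- `wt`: the number of letters. -/
def wt (a : Mono00) : ℕ := a.2.letters.length + a.wtTheta

/-- `wt₊ = wt + wt_θ`. -/
def wtPlus (a : Mono00) : ℕ := a.wt + a.wtTheta

/-- The product of two monomials; `none` stands for zero. -/
def mul (a b : Mono00) : Option Mono00 :=
  if a.1 && b.1 then none else (a.2.mul b.2).map fun u => (a.1 || b.1, u)

/-- The monomial `a'` obtained from `a` by removing the last two letters different from `θ`. -/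
def shorten (a : Mono00) : Mono00 := (a.1, a.2.shorten)

/-- A monomial as an element of `K!`. -/
noncomputable def toDual (a : Mono00) : DualNumber finiteSums :=
  if a.1 then TrivSqZeroExt.inr ⟨Full.mono (.zero a.2), mono_mem_finiteSums _⟩
  else TrivSqZeroExt.inl ⟨Full.mono (.zero a.2), mono_mem_finiteSums _⟩

/-- The coefficient of a monomial in an element of the completion. -/
def coeff (a : Mono00) (x : DualNumber completedSums) : ZMod 2 :=
  if a.1 then x.snd.1 (.zero a.2) else x.fst.1 (.zero a.2)

theorem finite_wtPlus_le (N : ℕ) : {a : Mono00 | a.wtPlus ≤ N}.Finite := by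
  refine ((Set.finite_univ (α := Bool)).prod
    ((Core.finite_len_le N).preimage (f := Core.zero) (fun a _ b _ h => by simpa using h))).subset ?_
  intro a ha
  refine ⟨trivial, ?_⟩
  have : a.2.letters.length + wtTheta a + wtTheta a ≤ N := ha
  exact (by omega : a.2.letters.length ≤ N)

end Mono00

/-- Truncation of the sums of monomials `m` (for `θ = false`) or `θ · m` (for `θ = true`): the
monomials in `I₀ K! I₀` with `wt₊ > N` are removed. -/
noncomputable def truncate (N : ℕ) (θ : Bool) (f : completedSums) : finiteSums :=
  ⟨fun m => match m with
    | .zero u => if Mono00.wtPlus (θ, u) ≤ N then f.1 (.zero u) else 0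
    | m => f.1 m, by
    have h1 := ((Mono00.finite_wtPlus_le N).image Prod.snd).image Core.zero
    have h2 := (Set.finite_univ (α := Mid)).image Core.mid
    have h3 := Set.Finite.image Core.one f.2
    refine ((h1.union h2).union h3).subset ?_
    intro m hm
    cases m with
    | zero u =>
      refine Or.inl (Or.inl ⟨u, ⟨(θ, u), ?_, rfl⟩, rfl⟩)
      by_contra h
      exact hm (if_neg h)
    | mid m => exact Or.inl (Or.inr ⟨m, trivial, rfl⟩)
    | one v => exact Or.inr ⟨v, hm, rfl⟩⟩

/-- The map `φ₁`: the identity on the monomials outside `I₀ K! I₀` and on those monomials `a` of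
`I₀ K! I₀` with `wt₊(a) ≤ N`, zero on all other monomials. -/
noncomputable def phiOne (N : ℕ) (x : DualNumber completedSums) : DualNumber finiteSums :=
  TrivSqZeroExt.inl (truncate N false x.fst) + TrivSqZeroExt.inr (truncate N true x.snd)

/-- The element `θ` of `K!` (the sum of the elements `θ` of both idempotents). -/
noncomputable def theta : DualNumber finiteSums := TrivSqZeroExt.inr 1

/-- The map `φ₂` on monomials of `I₀ K! I₀`: the value is `(ab)' θ` if `wt₊(ab) > N` while
`wt₊(a) ≤ N` and `wt₊(b) ≤ N`, and zero otherwise (in particular if `ab = 0`). -/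
noncomputable def phiTwoMono (N : ℕ) (a b : Mono00) : DualNumber finiteSums :=
  match a.mul b with
  | some c =>
    if N < c.wtPlus ∧ a.wtPlus ≤ N ∧ b.wtPlus ≤ N then c.shorten.toDual * theta else 0
  | none => 0

/-- The bilinear map `φ₂`. Only the finitely many monomials of `I₀ K! I₀` with `wt₊ ≤ N`
contribute. -/
noncomputable def phiTwo (N : ℕ) (x y : DualNumber completedSums) : DualNumber finiteSums :=
  ∑ a ∈ (Mono00.finite_wtPlus_le N).toFinset, ∑ b ∈ (Mono00.finite_wtPlus_le N).toFinset,
    (a.coeff x * b.coeff y) • phiTwoMono N a b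

/-- The operations of `φ`: truncation `φ₁`, the correction term `φ₂`, and `φₙ = 0` for `n ≥ 3`. -/
noncomputable def phiOp (N : ℕ) : List completedKoszulDual → koszulDual
  | [x] => phiOne N x
  | [x, y] => phiTwo N x y
  | _ => 0

end SurgeryKoszul

/-! Put `c = wz + zw`, a central element, and write an element as `x = lo x + θ · hi x`, so that `μ₁
x = c · hi x`. A word in `w` and `z` without repeated letters alternates, and multiplying a nonempty
one by `c` puts two more alternating letters in front of it. Hence, with `N = n + 2`, multiplication
by `c` is a bijection from sums of words with more than `n` letters to sums of words with more than
`n + 2` letters, whether the sums are finite or infinite; its inverse is `Full.divide n`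
(`Full.wzzw_mul_divide`, `Full.divide_wzzw_mul`).

Since `θ` counts twice in `wt₊`, the map `φ₁` removes exactly the long words of `lo x` (more than `n
+ 2` letters) and of `hi x` (more than `n` letters). On the removed part `μ₁` is the bijection
above, so this part is contractible: `h(x) = θ · divide n (lo x)` satisfies `μ₁ h + h μ₁ = id + φ₁`.
This is why completing the algebra changes nothing up to homotopy.

The map `φ₁` is not multiplicative, because a product of short words can be long. The long part of
such a product is `μ₁` of `θ` times its quotient by `c`, and division of a long word by `c` removes
two letters; this is `φ₂`. Its relations follow from the rules for dividing a product with a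
truncated factor (`Full.divide_head_mul`, `Full.divide_mul_head`), and nothing higher is needed
because values of `φ₂` are multiples of `θ` and `θ² = 0`. The structure `BinaryHom` isolates the
finitely many identities which this requires.

Both composites of `ι` and `φ` have the operations `φ₁`, `φ₂`, on `K!` or on its completion, and `h`
exists on both. The structure `BinaryHom.Contraction` lists what makes the sequence `1 + h` a closed
morphism between such a composite and the identity, in either direction; as `h(a) h(b) = 0` and the
characteristic is two, `1 + h` is its own inverse. Read on rank-one bimodules this is
`Contraction.isomorphic`. Applied to matrix entries over type-`D` modules, with `id + h(δ)` on
objects and `h(f)` on morphisms, it is `Contraction.functor_isomorphic`. -/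

namespace SurgeryKoszul

/-! ## Long words in `w` and `z`, and division by `wz + zw` -/

/-- The word with its first two letters repeated in front (if the result has no repeated letters). -/
def Word.prolong {L : Type} [DecidableEq L] (v : Word L) : Word L :=
  if h : (v.letters.take 2 ++ v.letters).IsChain (· ≠ ·) then ⟨_, h⟩ else v

/-- The word without its first two letters. -/
def Word.dropTwo {L : Type} (v : Word L) : Word L := ⟨v.letters.drop 2, v.chain.drop _⟩

theorem Word.prolong_letters {L : Type} [DecidableEq L] (v : Word L) (hv : 2 ≤ v.letters.length) :
    v.prolong.letters = v.letters.take 2 ++ v.letters := by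
  rcases v with ⟨_ | ⟨a, _ | ⟨b, l⟩⟩, h⟩
  · simp at hv
  · simp at hv
  · have : ([a, b] ++ a :: b :: l).IsChain (· ≠ ·) := by
      have hab : a ≠ b := (List.isChain_cons_cons.1 h).1
      exact List.IsChain.cons_cons hab (List.IsChain.cons_cons hab.symm h)
    simp only [Word.prolong]
    rw [dif_pos (by simpa using this)]

theorem Word.dropTwo_prolong {L : Type} [DecidableEq L] (v : Word L) (hv : 2 ≤ v.letters.length) :
    v.prolong.dropTwo = v := by
  apply Word.ext
  simp only [Word.dropTwo, Word.prolong_letters v hv]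
  rw [List.drop_append_of_le_length (by simp [hv]), List.drop_of_length_le (by simp)]
  simp

/-- There are only two letters, so words without repetitions have period two. All comparisons
between removing letters at the front and at the end rest on this. -/
theorem L0.eq_of_ne_of_ne {a b c : L0} (h : a ≠ b) (h' : b ≠ c) : a = c := by
  cases a <;> cases b <;> cases c <;> simp_all

/-- By periodicity the two removed letters equal the next two. Four letters are required because
`prolong` reads the letters to be restored from the remaining word. -/
theorem Word.prolong_dropTwo (u : Word L0) (hu : 4 ≤ u.letters.length) : u.dropTwo.prolong = u := by
  apply Word.ext
  have h2 : 2 ≤ u.dropTwo.letters.length := by simp [Word.dropTwo]; omega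
  rw [Word.prolong_letters _ h2]
  rcases u with ⟨_ | ⟨a, _ | ⟨b, _ | ⟨c, _ | ⟨d, l⟩⟩⟩⟩, h⟩ <;> simp at hu
  simp only [List.isChain_cons_cons] at h
  simp [Word.dropTwo, L0.eq_of_ne_of_ne h.1 h.2.1, L0.eq_of_ne_of_ne h.2.1 h.2.2.1]

/-- An alternating word loses the same information at either end. This lets the operation `a'` in
the definition of `φ₂` be treated as a left division by `wz + zw`. -/
theorem Word.shorten_eq_dropTwo (u : Word L0) : u.shorten = u.dropTwo := by
  apply Word.ext
  obtain ⟨l, h⟩ := u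
  simp only [Word.shorten, Word.dropTwo]
  induction l with
  | nil => rfl
  | cons a l ih =>
    rcases l with _ | ⟨b, _ | ⟨c, l⟩⟩
    · rfl
    · rfl
    · have h' := ih (List.isChain_cons_cons.1 h).2
      simp only [List.isChain_cons_cons] at h
      have hac := L0.eq_of_ne_of_ne h.1 h.2.1
      subst hac
      cases l with
      | nil => rfl
      | cons d l => exact congrArg (a :: ·) h'

/-- The monomial is a word in `w` and `z` with more than `k` letters. -/
def Core.IsLong (k : ℕ) : Core → Prop
  | .zero u => k < u.letters.length
  | _ => False

instance (k : ℕ) : DecidablePred (Core.IsLong k) := fun m => by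
  cases m <;> unfold Core.IsLong <;> infer_instance

/-- Words in `w` and `z` are prolonged by their first two letters. -/
def Core.prolong : Core → Core
  | .zero u => .zero u.prolong
  | m => m

/-- The bound `1 ≤ k` excludes the products `z · s` and `w · t`, where a single letter acts
nontrivially on `I₀ K! I₁`. Two or more letters annihilate that summand. -/
theorem Core.IsLong.mul_right {k : ℕ} (hk : 1 ≤ k) {a b m : Core} (ha : a.IsLong k)
    (h : a.mul b = some m) : m.IsLong k := by
  have hl := Core.mul_len h
  cases a with
  | zero u =>
    simp only [Core.IsLong] at ha
    cases b with
    | zero v =>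
      simp only [Core.mul, Option.map_eq_some_iff] at h
      obtain ⟨x, -, rfl⟩ := h
      simp only [Core.IsLong, Core.len] at *
      omega
    | one v => simp [Core.mul] at h
    | mid m =>
      simp only [Core.mul, Option.map_eq_some_iff] at h
      obtain ⟨x, hx, rfl⟩ := h
      match hu : u.letters with
      | [] => simp [hu] at ha
      | [p] => simp [hu] at ha; omega
      | p :: q :: r => rw [hu, Mid.foldr_two] at hx; simp at hx
  | one u => exact ha.elim
  | mid m => exact ha.elim

/-- No bound on `k` is needed on this side: only words in `w` and `z` can stand to the left of such
a word in a nonzero product. -/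
theorem Core.IsLong.mul_left {k : ℕ} {a b m : Core} (hb : b.IsLong k)
    (h : a.mul b = some m) : m.IsLong k := by
  have hl := Core.mul_len h
  cases b with
  | zero u =>
    cases a <;> simp [Core.mul] at h
    obtain ⟨x, -, rfl⟩ := h
    simp only [Core.IsLong, Core.len] at *
    omega
  | one u => exact hb.elim
  | mid m => exact hb.elim

theorem Core.IsLong.mono {k l : ℕ} (h : k ≤ l) {m : Core} (hm : m.IsLong l) : m.IsLong k := by
  cases m with
  | zero u => exact lt_of_le_of_lt h hm
  | _ => exact hm.elim

theorem Core.IsLong.prolong {k : ℕ} (hk : 1 ≤ k) {m : Core} (hm : m.IsLong k) :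
    m.prolong.IsLong (k + 2) := by
  cases m with
  | zero u =>
    simp only [Core.IsLong, Core.prolong] at *
    rw [Word.prolong_letters u (by omega)]
    simp
    omega
  | _ => exact hm.elim

namespace Full

/-- The part of a sum which consists of words in `w` and `z` with more than `k` letters. -/
def tail (k : ℕ) : Full →+ Full where
  toFun f := fun m => if m.IsLong k then f m else 0
  map_zero' := by ext m; exact ite_self _
  map_add' f g := by
    ext m
    change (if m.IsLong k then f m + g m else 0)
      = (if m.IsLong k then f m else 0) + (if m.IsLong k then g m else 0)
    split_ifs <;> simp

theorem tail_apply (k : ℕ) (f : Full) (m : Core) : tail k f m = if m.IsLong k then f m else 0 := rfl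

/-- The quotient by `wz + zw` of the part of a sum which consists of words in `w` and `z` with
more than `n + 2` letters. -/
def divide (n : ℕ) : Full →+ Full where
  toFun f := fun m => if m.IsLong n then f m.prolong else 0
  map_zero' := by ext m; exact ite_self _
  map_add' f g := by
    ext m
    change (if m.IsLong n then f m.prolong + g m.prolong else 0)
      = (if m.IsLong n then f m.prolong else 0) + (if m.IsLong n then g m.prolong else 0)
    split_ifs <;> simp

theorem divide_apply (n : ℕ) (f : Full) (m : Core) :
    divide n f m = if m.IsLong n then f m.prolong else 0 := rfl

/-- With `tail_mul_apply_eq_zero` this says that the sums of long words form a two-sided ideal for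
`k ≥ 1`. -/
theorem mul_tail_apply_eq_zero {k : ℕ} (f g : Full) {m : Core} (hm : ¬ m.IsLong k) :
    (f * tail k g) m = 0 := by
  rw [mul_apply]
  refine Finset.sum_eq_zero ?_
  rintro ⟨a, b⟩ h
  rw [Core.mem_factors] at h
  rw [tail_apply, if_neg (fun hb => hm (hb.mul_left h)), mul_zero]

theorem tail_mul_apply_eq_zero {k : ℕ} (hk : 1 ≤ k) (f g : Full) {m : Core} (hm : ¬ m.IsLong k) :
    (tail k f * g) m = 0 := by
  rw [mul_apply]
  refine Finset.sum_eq_zero ?_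
  rintro ⟨a, b⟩ h
  rw [Core.mem_factors] at h
  rw [tail_apply, if_neg (fun ha => hm (ha.mul_right hk h)), zero_mul]

theorem tail_mul_tail (k : ℕ) (f g : Full) : tail k (f * tail k g) = f * tail k g := by
  ext m
  rw [tail_apply]
  split_ifs with h
  · rfl
  · exact (mul_tail_apply_eq_zero f g h).symm

theorem tail_tail_mul {k : ℕ} (hk : 1 ≤ k) (f g : Full) :
    tail k (tail k f * g) = tail k f * g := by
  ext m
  rw [tail_apply]
  split_ifs with h
  · rfl
  · exact (tail_mul_apply_eq_zero hk f g h).symm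

theorem tail_tail {k l : ℕ} (h : k ≤ l) (f : Full) : tail k (tail l f) = tail l f := by
  ext m
  simp only [tail_apply]
  split_ifs with h1 h2 h2
  · rfl
  · rfl
  · exact absurd (h2.mono h) h1
  · rfl

theorem tail_divide (n : ℕ) (f : Full) : tail n (divide n f) = divide n f := by
  ext m
  simp only [tail_apply, divide_apply]
  split_ifs <;> rfl

theorem divide_tail {n : ℕ} (hn : 1 ≤ n) (f : Full) : divide n (tail (n + 2) f) = divide n f := by
  ext m
  simp only [tail_apply, divide_apply]
  split_ifs with h1 h2
  · rfl
  · exact absurd (h1.prolong hn) h2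
  · rfl

/-- The first two letters of the word are different, so they form exactly one of `wz` and `zw`, and
only one factorization of the word contributes to the coefficient. -/
theorem wzzw_mul_zero (f : Full) (u : Word L0) (hu : 2 ≤ u.letters.length) :
    (wzzw * f) (.zero u) = f (.zero u.dropTwo) := by
  rcases u with ⟨_ | ⟨a, _ | ⟨b, l⟩⟩, h⟩ <;> simp at hu
  have hab : a ≠ b := (List.isChain_cons_cons.1 h).1
  have h2 : [a, b].IsChain (· ≠ ·) := by simpa using hab
  rw [mul_apply, Finset.sum_eq_single (.zero ⟨[a, b], h2⟩, .zero ⟨l, h.drop 2⟩)]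
  · simp only [Word.dropTwo, List.drop_succ_cons, List.drop_zero]
    cases a <;> cases b <;> simp [wzzw, mono, Core.wz, Core.zw] at hab ⊢
  · rintro ⟨x, y⟩ hxy hne
    rw [Core.mem_factors] at hxy
    cases x <;> cases y <;> simp [Core.mul, Word.mul_eq_some] at hxy
    rename_i x y
    by_cases hx : x.letters = [L0.w, L0.z] ∨ x.letters = [L0.z, L0.w]
    · refine absurd ?_ hne
      rcases hx with hx | hx <;> rw [hx] at hxy <;> simp at hxy <;>
        obtain ⟨rfl, rfl, rfl⟩ := hxy <;> simp [Word.ext_iff, hx]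
    · rw [not_or] at hx
      simp [wzzw, mono, Core.wz, Core.zw, Word.ext_iff, hx.1, hx.2]
  · intro hn
    refine absurd ?_ hn
    rw [Core.mem_factors]
    simp [Core.mul, Word.mul_eq_some]

theorem wzzw_mul_eq_zero (f : Full) {m : Core} (hm : ¬ m.IsLong 1) : (wzzw * f) m = 0 := by
  rw [mul_apply]
  refine Finset.sum_eq_zero ?_
  rintro ⟨a, b⟩ h
  rw [Core.mem_factors] at h
  have : ¬ a.IsLong 1 := fun ha => hm (ha.mul_right le_rfl h)
  have h0 : wzzw a = 0 := by
    simp only [wzzw, add_apply, mono]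
    split_ifs with h1 h2 h2
    · exact absurd (h1 ▸ h2) (by simp [Core.wz, Core.zw])
    · exact absurd (h1 ▸ (by simp [Core.IsLong, Core.wz] : Core.wz.IsLong 1)) this
    · exact absurd (h2 ▸ (by simp [Core.IsLong, Core.zw] : Core.zw.IsLong 1)) this
    · simp
  rw [h0, zero_mul]

/-- Prolonging a word and dropping its first two letters are inverse bijections between the words
with more than `n` and those with more than `n + 2` letters. With `divide_wzzw_mul`, this makes
`divide n` a two-sided inverse of multiplication by `wz + zw` between the two ideals of long words.
-/
theorem wzzw_mul_divide {n : ℕ} (hn : 2 ≤ n) (f : Full) :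
    wzzw * divide n f = tail (n + 2) f := by
  ext m
  by_cases hm : m.IsLong 1
  · cases m with
    | zero u =>
      simp only [Core.IsLong] at hm
      rw [wzzw_mul_zero _ u hm, divide_apply, tail_apply]
      have hl : u.dropTwo.letters.length = u.letters.length - 2 := by simp [Word.dropTwo]
      by_cases h : n + 2 < u.letters.length
      · rw [if_pos (by simp only [Core.IsLong]; omega), if_pos (by exact h), Core.prolong,
          Word.prolong_dropTwo u (by omega)]
      · rw [if_neg (by simp only [Core.IsLong]; omega), if_neg (by exact h)]
    | _ => exact hm.elim
  · rw [wzzw_mul_eq_zero _ hm, tail_apply, if_neg (fun h => hm (h.mono (by omega)))]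

theorem divide_wzzw_mul {n : ℕ} (hn : 1 ≤ n) (f : Full) : divide n (wzzw * f) = tail n f := by
  ext m
  rw [divide_apply, tail_apply]
  split_ifs with h
  · cases m with
    | zero u =>
      simp only [Core.IsLong] at h
      rw [Core.prolong, wzzw_mul_zero, Word.dropTwo_prolong u (by omega)]
      rw [Word.prolong_letters u (by omega)]
      simp
      omega
    | _ => exact h.elim
  · rfl

/-- Two sums of long words in `w` and `z` agree if their products with `wz + zw` agree. -/
theorem eq_of_wzzw_mul {n : ℕ} (hn : 1 ≤ n) {f g : Full} (hf : tail n f = f) (hg : tail n g = g)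
    (h : wzzw * f = wzzw * g) : f = g := by
  rw [← hf, ← hg, ← divide_wzzw_mul hn, ← divide_wzzw_mul hn, h]

theorem wzzw_mul_tail {n : ℕ} (hn : 2 ≤ n) (f : Full) :
    wzzw * tail n f = tail (n + 2) (wzzw * f) := by
  rw [← divide_wzzw_mul (by omega), wzzw_mul_divide hn]

/-- Both sides consist of long words, so they may be compared after multiplication by `wz + zw`,
where the division disappears. The version for the other side, `divide_mul_tail`, uses in addition
that `wz + zw` is central. -/
theorem divide_tail_mul {n : ℕ} (hn : 2 ≤ n) (f g : Full) :
    divide n (tail (n + 2) f * g) = divide n f * g := by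
  refine eq_of_wzzw_mul (n := n) (by omega) (tail_divide n _) ?_ ?_
  · rw [← tail_divide, tail_tail_mul (by omega)]
  · rw [wzzw_mul_divide hn, tail_tail_mul (by omega), ← wzzw_mul_divide hn, mul_assoc]

theorem divide_mul_tail {n : ℕ} (hn : 2 ≤ n) (f g : Full) :
    divide n (f * tail (n + 2) g) = f * divide n g := by
  refine eq_of_wzzw_mul (n := n) (by omega) (tail_divide n _) ?_ ?_
  · rw [← tail_divide, tail_mul_tail]
  · rw [wzzw_mul_divide hn, tail_mul_tail, ← wzzw_mul_divide hn, ← mul_assoc, ← mul_assoc,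
      wzzw_comm]

/-- The part of a sum without the words in `w` and `z` with more than `k` letters. -/
noncomputable def head (k : ℕ) : Full →+ Full := AddMonoidHom.id Full - tail k

theorem head_eq (k : ℕ) (f : Full) : head k f = f - tail k f := rfl

theorem head_add_tail (k : ℕ) (f : Full) : head k f + tail k f = f := by simp [head_eq]

theorem head_apply (k : ℕ) (f : Full) (m : Core) : head k f m = if m.IsLong k then 0 else f m := by
  change f m - tail k f m = _
  rw [tail_apply]
  split_ifs <;> simp

theorem tail_head (k : ℕ) (f : Full) : tail k (head k f) = 0 := by
  rw [head_eq, map_sub, tail_tail le_rfl, sub_self]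

theorem divide_head {n : ℕ} (hn : 1 ≤ n) (f : Full) : divide n (head (n + 2) f) = 0 := by
  rw [← divide_tail hn, tail_head, map_zero]

theorem tail_mono (k : ℕ) (m : Core) (hm : ¬ m.IsLong k) : tail k (mono m) = 0 := by
  ext x
  rw [tail_apply]
  split_ifs with h
  · refine if_neg ?_
    rintro rfl
    exact hm h
  · rfl

end Full

/-! ## `A∞`-morphisms with at most binary operations -/

/-- A strictly unital `A∞`-morphism of curved dg-algebras whose only operations are unary and
binary, such that products of values of the binary operation vanish and the binary operation
vanishes on the curvature. -/
structure BinaryHom (A B : CurvedDGA) where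
  unary : A →+ B
  binary : A →+ A →+ B
  unary_one : unary 1 = 1
  unary_e_mul : ∀ i a, unary (A.e i * a) = B.e i * unary a
  unary_mul_e : ∀ i a, unary (a * A.e i) = unary a * B.e i
  unary_curv : unary A.curv = B.curv
  unary_d : ∀ a, unary (A.d a) = B.d (unary a)
  binary_one_left : ∀ a, binary 1 a = 0
  binary_one_right : ∀ a, binary a 1 = 0
  binary_e_mul : ∀ i a b, binary (A.e i * a) b = B.e i * binary a b
  binary_mul_e : ∀ i a b, binary a (b * A.e i) = binary a b * B.e i
  binary_balanced : ∀ i a b, binary (a * A.e i) b = binary a (A.e i * b)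
  binary_curv_left : ∀ a, binary A.curv a = 0
  binary_curv_right : ∀ a, binary a A.curv = 0
  unary_mul : ∀ a b, binary (A.d a) b + binary a (A.d b) + unary (a * b)
    = B.d (binary a b) + unary a * unary b
  binary_mul : ∀ a b c, binary (a * b) c + binary a (b * c)
    = unary a * binary b c + binary a b * unary c
  binary_mul_binary : ∀ a b a' b', binary a b * binary a' b' = 0

namespace BinaryHom

variable {A B C : CurvedDGA}

/-- The sequence of operations. -/
def op (F : BinaryHom A B) : List A → B
  | [a] => F.unary a
  | [a, b] => F.binary a b
  | _ => 0

section

variable (F : BinaryHom A B)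

@[simp] theorem op_nil : F.op [] = 0 := rfl
@[simp] theorem op_one (a : A) : F.op [a] = F.unary a := rfl
@[simp] theorem op_two (a b : A) : F.op [a, b] = F.binary a b := rfl
@[simp] theorem op_more (a b c : A) (l : List A) : F.op (a :: b :: c :: l) = 0 := rfl

theorem op_eq_zero {l : List A} (h : 2 < l.length) : F.op l = 0 := by
  rcases l with _ | ⟨a, _ | ⟨b, _ | ⟨c, l⟩⟩⟩ <;> simp at h ⊢

/-- The underlying `A∞`-morphism. -/
def toAInfHom : AInfHom A B where
  op := F.op
  op_nil := rfl
  op_add l a b l' := by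
    rcases l with _ | ⟨x, _ | ⟨y, _ | ⟨z, l⟩⟩⟩ <;> rcases l' with _ | ⟨x', _ | ⟨y', l'⟩⟩ <;> simp
  op_e_cons i a l := by
    rcases l with _ | ⟨x, _ | ⟨y, l⟩⟩ <;> simp [F.unary_e_mul, F.binary_e_mul]
  op_concat_e l a i := by
    rcases l with _ | ⟨x, _ | ⟨y, _ | ⟨z, l⟩⟩⟩ <;> simp [F.unary_mul_e, F.binary_mul_e]
  op_balanced l a i b l' := by
    by_cases h : l = [] ∧ l' = []
    · obtain ⟨rfl, rfl⟩ := h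
      exact F.binary_balanced i a b
    · have : 0 < l.length + l'.length := by
        by_contra h0
        exact h ⟨List.length_eq_zero_iff.1 (by omega), List.length_eq_zero_iff.1 (by omega)⟩
      rw [F.op_eq_zero, F.op_eq_zero] <;> simp <;> omega
  rel l := by
    -- With no, one, two and three inputs the relations are the fields on curvature, differential,
    -- `unary_mul` and `binary_mul`. With four inputs only the product of two binary values
    -- survives, and from five on every term has an operation of arity at least three.
    rcases l with _ | ⟨a, _ | ⟨b, _ | ⟨c, _ | ⟨d, l⟩⟩⟩⟩
    · simp [barTerms, insertTerms, diffTerms, mulTerms, splits, F.unary_curv]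
    · simp [barTerms, insertTerms, diffTerms, mulTerms, splits, F.binary_curv_left,
        F.binary_curv_right, F.unary_d]
    · have := F.unary_mul a b
      simp [barTerms, insertTerms, diffTerms, mulTerms, splits, ← this, add_assoc]
    · have := F.binary_mul a b c
      simp [barTerms, insertTerms, diffTerms, mulTerms, splits, this]
    · rcases l with _ | ⟨e, l⟩ <;>
        simp [barTerms, insertTerms, diffTerms, mulTerms, splits, F.binary_mul_binary,
          Function.comp_def]
  bounded := ⟨2, fun _ h => F.op_eq_zero h⟩

@[simp] theorem toAInfHom_op : F.toAInfHom.op = F.op := rfl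

end

/-- The identity. -/
def id (A : CurvedDGA) : BinaryHom A A where
  unary := AddMonoidHom.id A
  binary := 0
  unary_one := rfl
  unary_e_mul _ _ := rfl
  unary_mul_e _ _ := rfl
  unary_curv := rfl
  unary_d _ := rfl
  binary_one_left _ := rfl
  binary_one_right _ := rfl
  binary_e_mul _ _ _ := by simp
  binary_mul_e _ _ _ := by simp
  binary_balanced _ _ _ := by simp
  binary_curv_left _ := rfl
  binary_curv_right _ := rfl
  unary_mul _ _ := by simp
  binary_mul _ _ _ := by simp
  binary_mul_binary _ _ _ _ := by simp

/-- The composition of two morphisms one of which has no binary operation. -/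
def comp (F : BinaryHom A B) (G : BinaryHom B C) (h : F.binary = 0 ∨ G.binary = 0) :
    BinaryHom A C where
  unary := G.unary.comp F.unary
  -- The remaining terms of a composite would be `G.binary` applied to a value of `F.binary`. They
  -- vanish because one of the two binary operations is zero, so the composite has no operation of
  -- arity three or four.
  binary := AddMonoidHom.mk' (fun a => AddMonoidHom.mk'
      (fun b => G.unary (F.binary a b) + G.binary (F.unary a) (F.unary b))
      (fun b b' => by simp only [map_add]; abel))
    (fun a a' => by ext b; simp only [map_add, AddMonoidHom.add_apply, AddMonoidHom.mk'_apply]; abel)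
  unary_one := by simp [F.unary_one, G.unary_one]
  unary_e_mul _ _ := by simp [F.unary_e_mul, G.unary_e_mul]
  unary_mul_e _ _ := by simp [F.unary_mul_e, G.unary_mul_e]
  unary_curv := by simp [F.unary_curv, G.unary_curv]
  unary_d _ := by simp [F.unary_d, G.unary_d]
  binary_one_left _ := by simp [F.binary_one_left, F.unary_one, G.binary_one_left]
  binary_one_right _ := by simp [F.binary_one_right, F.unary_one, G.binary_one_right]
  binary_e_mul _ _ _ := by
    simp [F.binary_e_mul, F.unary_e_mul, G.binary_e_mul, G.unary_e_mul, mul_add]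
  binary_mul_e _ _ _ := by
    simp [F.binary_mul_e, F.unary_mul_e, G.binary_mul_e, G.unary_mul_e, add_mul]
  binary_balanced _ _ _ := by
    simp [F.binary_balanced, F.unary_mul_e, F.unary_e_mul, G.binary_balanced]
  binary_curv_left _ := by simp [F.binary_curv_left, F.unary_curv, G.binary_curv_left]
  binary_curv_right _ := by simp [F.binary_curv_right, F.unary_curv, G.binary_curv_right]
  unary_mul a b := by
    rcases h with h | h
    · have hF := F.unary_mul a b
      have hG := G.unary_mul (F.unary a) (F.unary b)
      simp only [h, AddMonoidHom.zero_apply, map_zero, zero_add] at hF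
      simp [h, hF, F.unary_d, hG]
    · have hF := congrArg G.unary (F.unary_mul a b)
      have hG := G.unary_mul (F.unary a) (F.unary b)
      simp only [h, AddMonoidHom.zero_apply, map_zero, zero_add] at hG
      simpa [h, hG, G.unary_d] using hF
  binary_mul a b c := by
    rcases h with h | h
    · have hF := fun a b => F.unary_mul a b
      have hG := G.binary_mul (F.unary a) (F.unary b) (F.unary c)
      simp only [h, AddMonoidHom.zero_apply, map_zero, zero_add] at hF
      simp [h, hF, hG]
    · have hF := congrArg G.unary (F.binary_mul a b c)
      have hG := fun a b => G.unary_mul a b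
      simp only [h, AddMonoidHom.zero_apply, map_zero, zero_add] at hG
      simpa [h, hG] using hF
  binary_mul_binary a b a' b' := by
    rcases h with h | h
    · simp [h, G.binary_mul_binary]
    -- Without a binary operation `G.unary` is multiplicative, so it carries the vanishing products
    -- in `B` to `C`.
    · have hG := fun a b => G.unary_mul a b
      simp only [h, AddMonoidHom.zero_apply, map_zero, zero_add] at hG
      simp [h, ← hG, F.binary_mul_binary]

theorem comp_unary (F : BinaryHom A B) (G : BinaryHom B C) (h) (a : A) :
    (F.comp G h).unary a = G.unary (F.unary a) := rfl

theorem comp_binary (F : BinaryHom A B) (G : BinaryHom B C) (h) (a b : A) :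
    (F.comp G h).binary a b = G.unary (F.binary a b) + G.binary (F.unary a) (F.unary b) := rfl

/-- A homotopy from a self-morphism to the identity, with only a unary operation. -/
structure Contraction (F : BinaryHom A A) where
  h : A →+ A
  h_e_mul : ∀ i a, h (A.e i * a) = A.e i * h a
  h_mul_e : ∀ i a, h (a * A.e i) = h a * A.e i
  h_curv : h A.curv = 0
  h_d : ∀ a, A.d (h a) + h (A.d a) = a + F.unary a
  -- The two product rules express, on two inputs, that `1 + h` is closed as a morphism from `F` to
  -- the identity (`h_mul`) and from the identity to `F` (`h_mul'`). The field `h_mul_h` makes `1 +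
  -- h` an involution, and the last two fields settle closedness on three inputs.
  h_mul : ∀ a b, F.binary a b + F.unary a * h b + h a * b + h (a * b) = 0
  h_mul' : ∀ a b, F.binary a b + a * h b + h a * F.unary b + h (a * b) = 0
  h_mul_h : ∀ a b, h a * h b = 0
  h_mul_binary : ∀ a b c, h a * F.binary b c = 0
  binary_mul_h : ∀ a b c, F.binary a b * h c = 0

end BinaryHom

/-! ## The idempotents, truncation and division -/

/-- The left idempotent of a monomial. -/
def Core.leftIdem : Core → Fin 2
  | .one _ => 1
  | _ => 0

/-- The right idempotent of a monomial. -/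
def Core.rightIdem : Core → Fin 2
  | .zero _ => 0
  | _ => 1

theorem Core.e_mul_leftIdem (m : Core) : (Core.e m.leftIdem).mul m = some m := by
  obtain ⟨i, hi, hu⟩ := Core.left_unit m
  cases m <;> simp [Core.e, Core.mul, Word.mul_eq_some, Word.nil, Core.leftIdem]

theorem Core.mul_e_rightIdem (m : Core) : m.mul (Core.e m.rightIdem) = some m := by
  cases m <;> simp [Core.e, Core.mul, Word.mul_eq_some, Word.nil, Core.rightIdem]

namespace Full

theorem e_mul_apply (i : Fin 2) (f : Full) (m : Core) :
    (mono (Core.e i) * f) m = if m.leftIdem = i then f m else 0 := by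
  obtain ⟨j, hj, hu⟩ := Core.left_unit m
  have hl := (hu _ _ m.e_mul_leftIdem).1
  rw [hl, mul_apply]
  split_ifs with h
  · subst h
    rw [Finset.sum_eq_single (Core.e j, m)]
    · simp [mono]
    · rintro ⟨a, b⟩ hab hne
      rw [Core.mem_factors] at hab
      by_cases ha : a = Core.e j
      · subst ha
        exact absurd (by rw [(hu _ _ hab).2]) hne
      · simp [mono, ha]
    · intro h
      exact absurd (Core.mem_factors.2 hj) h
  · refine Finset.sum_eq_zero ?_
    rintro ⟨a, b⟩ hab
    rw [Core.mem_factors] at hab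
    by_cases ha : a = Core.e i
    · subst ha
      exact absurd (hu _ _ hab).1.symm h
    · simp [mono, ha]

theorem mul_e_apply (i : Fin 2) (f : Full) (m : Core) :
    (f * mono (Core.e i)) m = if m.rightIdem = i then f m else 0 := by
  obtain ⟨j, hj, hu⟩ := Core.right_unit m
  have hl := (hu _ _ m.mul_e_rightIdem).1
  rw [hl, mul_apply]
  split_ifs with h
  · subst h
    rw [Finset.sum_eq_single (m, Core.e j)]
    · simp [mono]
    · rintro ⟨a, b⟩ hab hne
      rw [Core.mem_factors] at hab
      by_cases ha : b = Core.e j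
      · subst ha
        exact absurd (by rw [(hu _ _ hab).2]) hne
      · simp [mono, ha]
    · intro h
      exact absurd (Core.mem_factors.2 hj) h
  · refine Finset.sum_eq_zero ?_
    rintro ⟨a, b⟩ hab
    rw [Core.mem_factors] at hab
    by_cases ha : b = Core.e i
    · subst ha
      exact absurd (hu _ _ hab).1.symm h
    · simp [mono, ha]

theorem head_e_mul (k : ℕ) (i : Fin 2) (f : Full) :
    head k (mono (Core.e i) * f) = mono (Core.e i) * head k f := by
  ext m
  simp only [head_apply, e_mul_apply]
  split_ifs <;> rfl

theorem head_mul_e (k : ℕ) (i : Fin 2) (f : Full) :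
    head k (f * mono (Core.e i)) = head k f * mono (Core.e i) := by
  ext m
  simp only [head_apply, mul_e_apply]
  split_ifs <;> rfl

theorem divide_e_mul (n : ℕ) (i : Fin 2) (f : Full) :
    divide n (mono (Core.e i) * f) = mono (Core.e i) * divide n f := by
  ext m
  have : m.prolong.leftIdem = m.leftIdem := by cases m <;> rfl
  simp only [divide_apply, e_mul_apply, this]
  split_ifs <;> rfl

theorem divide_mul_e (n : ℕ) (i : Fin 2) (f : Full) :
    divide n (f * mono (Core.e i)) = divide n f * mono (Core.e i) := by
  ext m
  have : m.prolong.rightIdem = m.rightIdem := by cases m <;> rfl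
  simp only [divide_apply, mul_e_apply, this]
  split_ifs <;> rfl

theorem head_mono (k : ℕ) (m : Core) (hm : ¬ m.IsLong k) : head k (mono m) = mono m := by
  rw [head_eq, tail_mono k m hm, sub_zero]

theorem head_one (k : ℕ) : head k 1 = 1 := by
  change head k (mono (Core.e 0) + mono (Core.e 1)) = mono (Core.e 0) + mono (Core.e 1)
  rw [map_add, head_mono, head_mono] <;> simp [Core.e, Core.IsLong, Word.nil]

theorem head_mppm (k : ℕ) : head k mppm = mppm := by
  rw [mppm, map_add, head_mono, head_mono] <;> simp [Core.mp, Core.pm, Core.IsLong]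

/-- What is cut off from a factor at level `l ≥ k` lies in the ideal of words with more than `k`
letters, so it is invisible after the product is cut at level `k`. -/
theorem head_mul {k l l' : ℕ} (hk : 1 ≤ k) (h : k ≤ l) (h' : k ≤ l') (f g : Full) :
    head k (head l f * head l' g) = head k (f * g) := by
  have h1 : head k (tail l f * g) = 0 := by
    rw [head_eq, ← tail_tail h f, tail_tail_mul hk, sub_self]
  have h2 : head k (head l f * tail l' g) = 0 := by
    rw [head_eq, ← tail_tail h' g, tail_mul_tail, sub_self]
  conv_rhs => rw [← head_add_tail l f, add_mul, map_add, h1, add_zero, ← head_add_tail l' g,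
    mul_add, map_add, h2, add_zero]

/-- This is the reason for counting `θ` twice in `wt₊`: the differential replaces `θ` by two
letters, so cutting the coefficient of `θ` at `n` and the rest at `n + 2` commutes with it. -/
theorem head_wzzw_mul {n : ℕ} (hn : 2 ≤ n) (f : Full) :
    head (n + 2) (wzzw * f) = wzzw * head n f := by
  rw [head_eq, head_eq, mul_sub, wzzw_mul_tail hn]

/-- The quotient of a product depends only on the coefficients of words in `w` and `z`. -/
theorem divide_mul_congr (n : ℕ) {f f' g g' : Full} (hf : ∀ u, f (.zero u) = f' (.zero u))
    (hg : ∀ u, g (.zero u) = g' (.zero u)) : divide n (f * g) = divide n (f' * g') := by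
  ext m
  simp only [divide_apply]
  split_ifs with h
  · cases m with
    | zero u =>
      rw [Core.prolong, mul_apply, mul_apply]
      refine Finset.sum_congr rfl ?_
      rintro ⟨a, b⟩ hab
      rw [Core.mem_factors] at hab
      cases a <;> cases b <;> simp [Core.mul] at hab
      rw [hf, hg]
    | _ => exact h.elim
  · rfl

/-- The curvature has no component in `I₀ K! I₀`, and the division sees only that summand. -/
theorem divide_mppm_mul (n : ℕ) (f : Full) : divide n (mppm * f) = 0 := by
  have : divide n (mppm * f) = divide n (0 * f) :=
    divide_mul_congr n (fun u => by simp [mppm, mono, Core.mp, Core.pm]) fun _ => rfl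
  rw [this, zero_mul, map_zero]

theorem divide_mul_mppm (n : ℕ) (f : Full) : divide n (f * mppm) = 0 := by
  rw [← mppm_comm, divide_mppm_mul]

/-- This links division with the stated formula for `φ₂`: a word above the threshold is shortened,
every other word goes to zero. -/
theorem divide_mono {n : ℕ} (hn : 2 ≤ n) (u : Word L0) :
    divide n (mono (.zero u)) = if n + 2 < u.letters.length then mono (.zero u.shorten) else 0 := by
  rw [Word.shorten_eq_dropTwo]
  have hl : u.dropTwo.letters.length = u.letters.length - 2 := by simp [Word.dropTwo]
  ext m
  rw [divide_apply]
  split_ifs with h1 h2 h2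
  · cases m with
    | zero v =>
      simp only [Core.IsLong] at h1
      simp only [mono, Core.prolong, Core.zero.injEq]
      refine if_congr ⟨?_, ?_⟩ rfl rfl
      · rintro rfl
        rw [Word.dropTwo_prolong _ (by omega)]
      · rintro rfl
        rw [Word.prolong_dropTwo _ (by omega)]
    | _ => exact h1.elim
  · refine if_neg ?_
    intro h
    have := h1.prolong (by omega)
    rw [h] at this
    exact h2 this
  · refine (if_neg ?_).symm
    rintro rfl
    exact h1 (by simp only [Core.IsLong]; omega)
  · rfl

theorem two_eq_zero : (2 : Full) = 0 := by
  rw [← one_add_one_eq_two, add_self]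

theorem head_add_self_tail (k : ℕ) (f : Full) : tail k f = f + head k f := by
  nth_rw 2 [← head_add_tail k f]
  rw [add_right_comm, add_self, zero_add]

/-- Division commutes with multiplication on the long part of `f`, so the short part carries the
whole defect of linearity. This formula and its mirror image `divide_mul_head` give all correction
terms in the relations for `φ₂` and for the homotopy. -/
theorem divide_head_mul {n : ℕ} (hn : 2 ≤ n) (f g : Full) :
    divide n (head (n + 2) f * g) = divide n (f * g) + divide n f * g := by
  nth_rw 2 [← head_add_tail (n + 2) f]
  rw [add_mul, map_add, divide_tail_mul hn, add_assoc, add_self, add_zero]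

theorem divide_mul_head {n : ℕ} (hn : 2 ≤ n) (f g : Full) :
    divide n (f * head (n + 2) g) = divide n (f * g) + f * divide n g := by
  nth_rw 2 [← head_add_tail (n + 2) g]
  rw [mul_add, map_add, divide_mul_tail hn, add_assoc, add_self, add_zero]

/-- Each monomial of the quotient comes from one monomial of `f` by dropping two letters, so the
support is contained in the image of a finite set. -/
theorem divide_mem_finiteSums {n : ℕ} (hn : 1 ≤ n) {f : Full} (hf : f ∈ finiteSums) :
    divide n f ∈ finiteSums := by
  refine (Set.Finite.image (fun m => match m with
    | .zero u => .zero u.dropTwo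
    | m => m) hf).subset ?_
  intro m hm
  have hm' : (if m.IsLong n then f m.prolong else 0) ≠ 0 := hm
  rw [ite_ne_right_iff] at hm'
  refine ⟨m.prolong, hm'.2, ?_⟩
  cases m with
  | zero u =>
    simp only [Core.IsLong] at hm'
    simp only [Core.prolong]
    rw [Word.dropTwo_prolong u (by omega)]
  | _ => exact hm'.1.elim

/-- Quotients are supported in `I₀ K! I₀`, where the completion imposes no finiteness. -/
theorem divide_mem_completedSums (n : ℕ) (f : Full) : divide n f ∈ completedSums := by
  refine Set.finite_empty.subset ?_
  intro v hv
  exact hv rfl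

/-- The coefficient of a monomial. -/
def coeff (m : Core) : Full →+ ZMod 2 where
  toFun f := f m
  map_zero' := rfl
  map_add' _ _ := rfl

theorem sum_apply {ι : Type*} (s : Finset ι) (F : ι → Full) (m : Core) :
    (∑ i ∈ s, F i) m = ∑ i ∈ s, F i m := map_sum (coeff m) F s

end Full

/-! ## Components of elements of `S[θ]/(θ²)` -/

section Components

variable {S : Subalgebra (ZMod 2) Full} {hS : finiteSums ≤ S}

/-- The component without `θ`. -/
def lo (x : koszulAlgebra S hS) : Full := (TrivSqZeroExt.fst (x : DualNumber S)).1

/-- The coefficient of `θ`. -/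
def hi (x : koszulAlgebra S hS) : Full := (TrivSqZeroExt.snd (x : DualNumber S)).1

theorem ext_lo_hi {x y : koszulAlgebra S hS} (h : lo x = lo y) (h' : hi x = hi y) : x = y :=
  TrivSqZeroExt.ext (Subtype.ext h) (Subtype.ext h')

@[simp] theorem lo_zero : lo (0 : koszulAlgebra S hS) = 0 := rfl
@[simp] theorem hi_zero : hi (0 : koszulAlgebra S hS) = 0 := rfl
@[simp] theorem lo_one : lo (1 : koszulAlgebra S hS) = 1 := rfl
@[simp] theorem hi_one : hi (1 : koszulAlgebra S hS) = 0 := rfl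
@[simp] theorem lo_add (x y : koszulAlgebra S hS) : lo (x + y) = lo x + lo y := rfl
@[simp] theorem hi_add (x y : koszulAlgebra S hS) : hi (x + y) = hi x + hi y := rfl
@[simp] theorem lo_mul (x y : koszulAlgebra S hS) : lo (x * y) = lo x * lo y := rfl
@[simp] theorem hi_mul (x y : koszulAlgebra S hS) :
    hi (x * y) = lo x * hi y + hi x * lo y := rfl
@[simp] theorem lo_d (x : koszulAlgebra S hS) :
    lo ((koszulAlgebra S hS).d x) = Full.wzzw * hi x := rfl
@[simp] theorem hi_d (x : koszulAlgebra S hS) : hi ((koszulAlgebra S hS).d x) = 0 := rfl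
@[simp] theorem lo_e (i : Fin 2) : lo ((koszulAlgebra S hS).e i) = Full.mono (Core.e i) := rfl
@[simp] theorem hi_e (i : Fin 2) : hi ((koszulAlgebra S hS).e i) = 0 := rfl
@[simp] theorem lo_curv : lo (koszulAlgebra S hS).curv = Full.mppm := rfl
@[simp] theorem hi_curv : hi (koszulAlgebra S hS).curv = 0 := rfl

variable (hS) in
/-- The element `θ · f`. -/
noncomputable def ofHi (f : Full) (hf : f ∈ S) : koszulAlgebra S hS :=
  (TrivSqZeroExt.inr ⟨f, hf⟩ : DualNumber S)

@[simp] theorem lo_ofHi (f : Full) (hf : f ∈ S) : lo (ofHi hS f hf) = 0 := rfl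
@[simp] theorem hi_ofHi (f : Full) (hf : f ∈ S) : hi (ofHi hS f hf) = f := rfl

end Components

/-! ## The inclusion and the truncation -/

/-- The completion, in the form in which its components can be computed. -/
noncomputable abbrev completedAlgebra : CurvedDGA :=
  koszulAlgebra completedSums finiteSums_le_completedSums

/-- The algebra of finite sums, in the form in which its components can be computed. -/
noncomputable abbrev finiteAlgebra : CurvedDGA := koszulAlgebra finiteSums le_rfl

/-- The inclusion, as an additive map. -/
noncomputable def inclusionAddHom : finiteAlgebra →+ completedAlgebra :=
  AddMonoidHom.mk' inclusion fun x y => ext_lo_hi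
    (by change lo x + lo y + 0 = lo x + 0 + (lo y + 0); simp)
    (by change 0 + (hi x + hi y) = 0 + hi x + (0 + hi y); simp)

@[simp] theorem lo_inclusionAddHom (x : finiteAlgebra) : lo (inclusionAddHom x) = lo x :=
  add_zero (lo x)

@[simp] theorem hi_inclusionAddHom (x : finiteAlgebra) : hi (inclusionAddHom x) = hi x :=
  zero_add (hi x)

/-- The inclusion of `K!` into its completion. -/
noncomputable def inclusionHom : BinaryHom finiteAlgebra completedAlgebra where
  unary := inclusionAddHom
  binary := 0
  unary_one := ext_lo_hi (by simp) (by simp)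
  unary_e_mul _ _ := ext_lo_hi (by simp) (by simp)
  unary_mul_e _ _ := ext_lo_hi (by simp) (by simp)
  unary_curv := ext_lo_hi (by simp) (by simp)
  unary_d _ := ext_lo_hi (by simp) (by simp)
  binary_one_left _ := rfl
  binary_one_right _ := rfl
  binary_e_mul _ _ _ := by simp
  binary_mul_e _ _ _ := by simp
  binary_balanced _ _ _ := by simp
  binary_curv_left _ := rfl
  binary_curv_right _ := rfl
  unary_mul _ _ := ext_lo_hi (by simp) (by simp)
  binary_mul _ _ _ := by simp
  binary_mul_binary _ _ _ _ := by simp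

theorem inclusionHom_op : inclusionHom.op = inclusionOp := by
  funext l
  rcases l with _ | ⟨a, _ | ⟨b, _ | ⟨c, l⟩⟩⟩ <;> rfl

open Full

theorem truncate_false (N : ℕ) (f : completedSums) : (truncate N false f).1 = head N f.1 := by
  ext m
  rw [head_apply]
  cases m with
  | zero u =>
    have h : Mono00.wtPlus (false, u) ≤ N ↔ ¬ (Core.zero u).IsLong N := by
      simp [Mono00.wtPlus, Mono00.wt, Mono00.wtTheta, Core.IsLong]
    change (if Mono00.wtPlus (false, u) ≤ N then f.1 (.zero u) else 0) = _
    rw [if_congr h rfl rfl, ite_not]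
  | _ => rfl

/-- The letter `θ` has weight two in `wt₊`, so the threshold `n + 2` leaves at most `n` letters for
its coefficient. -/
theorem truncate_true (n : ℕ) (f : completedSums) :
    (truncate (n + 2) true f).1 = head n f.1 := by
  ext m
  rw [head_apply]
  cases m with
  | zero u =>
    have h : Mono00.wtPlus (true, u) ≤ n + 2 ↔ ¬ (Core.zero u).IsLong n := by
      simp [Mono00.wtPlus, Mono00.wt, Mono00.wtTheta, Core.IsLong]
    change (if Mono00.wtPlus (true, u) ≤ n + 2 then f.1 (.zero u) else 0) = _
    rw [if_congr h rfl rfl, ite_not]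
  | _ => rfl

theorem lo_phiOne (N : ℕ) (x : completedAlgebra) :
    lo (hS := le_rfl) (phiOne N x) = head N (lo x) := (add_zero _).trans (truncate_false N _)

theorem hi_phiOne (n : ℕ) (x : completedAlgebra) :
    hi (hS := le_rfl) (phiOne (n + 2) x) = head n (hi x) := (zero_add _).trans (truncate_true n _)

/-- The map `φ₁`, as an additive map. -/
noncomputable def phiOneAddHom (n : ℕ) : completedAlgebra →+ finiteAlgebra :=
  AddMonoidHom.mk' (phiOne (n + 2)) fun x y => ext_lo_hi
    ((lo_phiOne _ (x + y)).trans ((map_add (head (n + 2)) (lo x) (lo y)).trans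
      (congrArg₂ (· + ·) (lo_phiOne _ x) (lo_phiOne _ y)).symm))
    ((hi_phiOne _ (x + y)).trans ((map_add (head n) (hi x) (hi y)).trans
      (congrArg₂ (· + ·) (hi_phiOne _ x) (hi_phiOne _ y)).symm))

@[simp] theorem lo_phiOneAddHom (n : ℕ) (x : completedAlgebra) :
    lo (phiOneAddHom n x) = head (n + 2) (lo x) := lo_phiOne _ x

@[simp] theorem hi_phiOneAddHom (n : ℕ) (x : completedAlgebra) :
    hi (phiOneAddHom n x) = head n (hi x) := hi_phiOne _ x

theorem head_lo_mem_finiteSums (n : ℕ) (x : completedAlgebra) :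
    head (n + 2) (lo x) ∈ finiteSums :=
  lo_phiOneAddHom n x ▸ (TrivSqZeroExt.fst (phiOneAddHom n x : DualNumber finiteSums)).2

/-- The map `φ₂`, as a biadditive map. -/
noncomputable def phiTwoAddHom (n : ℕ) (hn : 2 ≤ n) :
    completedAlgebra →+ completedAlgebra →+ finiteAlgebra :=
  AddMonoidHom.mk' (fun x => AddMonoidHom.mk'
    (fun y => ofHi le_rfl (divide n (head (n + 2) (lo x) * head (n + 2) (lo y)))
      (divide_mem_finiteSums (by omega)
        (mul_mem (head_lo_mem_finiteSums n x) (head_lo_mem_finiteSums n y))))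
    (fun y y' => ext_lo_hi (by simp) (by simp [mul_add])))
    (fun x x' => by ext y; exact ext_lo_hi (by simp) (by simp [add_mul]))

@[simp] theorem lo_phiTwoAddHom (n : ℕ) (hn : 2 ≤ n) (x y : completedAlgebra) :
    lo (phiTwoAddHom n hn x y) = 0 := rfl

@[simp] theorem hi_phiTwoAddHom (n : ℕ) (hn : 2 ≤ n) (x y : completedAlgebra) :
    hi (phiTwoAddHom n hn x y) = divide n (head (n + 2) (lo x) * head (n + 2) (lo y)) := rfl

/-- The truncation from the completion to `K!`. -/
noncomputable def truncationHom (n : ℕ) (hn : 2 ≤ n) :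
    BinaryHom completedAlgebra finiteAlgebra where
  unary := phiOneAddHom n
  binary := phiTwoAddHom n hn
  unary_one := ext_lo_hi (by simp [head_one]) (by simp)
  unary_e_mul _ _ := ext_lo_hi (by simp [head_e_mul]) (by simp [head_e_mul])
  unary_mul_e _ _ := ext_lo_hi (by simp [head_mul_e]) (by simp [head_mul_e])
  unary_curv := ext_lo_hi (by simp [head_mppm]) (by simp)
  unary_d _ := ext_lo_hi (by simp [head_wzzw_mul hn]) (by simp)
  binary_one_left _ := ext_lo_hi (by simp)
    (by simp [head_one, divide_head (show 1 ≤ n by omega)])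
  binary_one_right _ := ext_lo_hi (by simp)
    (by simp [head_one, divide_head (show 1 ≤ n by omega)])
  binary_e_mul _ _ _ := ext_lo_hi (by simp)
    (by simp [head_e_mul, mul_assoc, divide_e_mul])
  binary_mul_e _ _ _ := ext_lo_hi (by simp)
    (by simp [head_mul_e, ← mul_assoc, divide_mul_e])
  binary_balanced _ _ _ := ext_lo_hi (by simp)
    (by simp [head_mul_e, head_e_mul, mul_assoc])
  binary_curv_left _ := ext_lo_hi (by simp) (by simp [head_mppm, divide_mppm_mul])
  binary_curv_right _ := ext_lo_hi (by simp) (by simp [head_mppm, divide_mul_mppm])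
  unary_mul x y := by
    refine ext_lo_hi ?_ ?_
    -- Without `θ`: the boundary of `φ₂(x, y)` is the long part of the product of the truncations,
    -- which is exactly what `φ₁(xy)` omits.
    · have h := head_mul (k := n + 2) (l := n + 2) (l' := n + 2) (by omega) le_rfl le_rfl
        (lo x) (lo y)
      simp [wzzw_mul_divide hn, ← h, head_add_self_tail, add_right_comm, add_self]
    -- Coefficient of `θ`: dividing after `μ₁` has been applied to one input recovers the part with
    -- more than `n` letters of each mixed product, and `φ₁(xy)` supplies the part with at most `n`
    -- letters.
    · have h1 := head_mul (k := n) (l := n + 2) (l' := n) (by omega) (by omega) le_rfl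
        (lo x) (hi y)
      have h2 := head_mul (k := n) (l := n) (l' := n + 2) (by omega) le_rfl (by omega)
        (hi x) (lo y)
      have h3 : head (n + 2) (lo x) * (wzzw * head n (hi y))
          = wzzw * (head (n + 2) (lo x) * head n (hi y)) := by
        rw [← mul_assoc, ← wzzw_comm, mul_assoc]
      simp only [hi_add, hi_phiTwoAddHom, lo_d, head_wzzw_mul hn, mul_assoc, h3,
        divide_wzzw_mul (show 1 ≤ n by omega), hi_phiOneAddHom, hi_mul, lo_phiOneAddHom, map_add,
        ← h1, ← h2, hi_d, zero_add]
      conv_rhs => rw [← head_add_tail n (head (n + 2) (lo x) * head n (hi y)),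
        ← head_add_tail n (head n (hi x) * head (n + 2) (lo y))]
      abel
  binary_mul x y z := by
    refine ext_lo_hi (by simp) ?_
    have h : ∀ f g : Full, head (n + 2) (head (n + 2) f * head (n + 2) g) = head (n + 2) (f * g) :=
      head_mul (by omega) le_rfl le_rfl
    simp only [hi_add, hi_phiTwoAddHom, hi_mul, lo_mul, lo_phiOneAddHom, hi_phiOneAddHom,
      lo_phiTwoAddHom, mul_zero, zero_mul, add_zero, zero_add]
    -- For either bracketing the division rules produce the quotient of the triple product of
    -- truncations. It occurs twice and cancels, leaving the two terms of the right-hand side.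
    rw [← h (lo x) (lo y), ← h (lo y) (lo z),
      divide_head_mul hn (head (n + 2) (lo x) * head (n + 2) (lo y)),
      divide_mul_head hn _ (head (n + 2) (lo y) * head (n + 2) (lo z)), mul_assoc,
      add_add_add_comm, add_self, zero_add, add_comm]
  binary_mul_binary _ _ _ _ := ext_lo_hi (by simp) (by simp)

/-- The homotopy from a self-morphism with the operations of the truncation to the identity. -/
noncomputable def divisionContraction {S : Subalgebra (ZMod 2) Full} {hS : finiteSums ≤ S} {n : ℕ}
    (hn : 2 ≤ n) (hdiv : ∀ f ∈ S, divide n f ∈ S)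
    (F : BinaryHom (koszulAlgebra S hS) (koszulAlgebra S hS))
    (h1 : ∀ x, lo (F.unary x) = head (n + 2) (lo x)) (h2 : ∀ x, hi (F.unary x) = head n (hi x))
    (h3 : ∀ x y, lo (F.binary x y) = 0)
    (h4 : ∀ x y, hi (F.binary x y) = divide n (head (n + 2) (lo x) * head (n + 2) (lo y))) :
    F.Contraction where
  h := AddMonoidHom.mk' (fun x => ofHi hS (divide n (lo x)) (hdiv _ (TrivSqZeroExt.fst
      (x : DualNumber S)).2)) (fun x y => ext_lo_hi (by simp) (by simp))
  h_e_mul _ _ := ext_lo_hi (by simp) (by simp [divide_e_mul])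
  h_mul_e _ _ := ext_lo_hi (by simp) (by simp [divide_mul_e])
  h_curv := ext_lo_hi (by simp) (by simpa using divide_mppm_mul n 1)
  -- Here `μ₁ h` is the long part of `lo` and `h μ₁` is `θ` times the long part of `hi`; these are
  -- the two pieces on which `φ₁` differs from the identity.
  h_d _ := ext_lo_hi (by simp [wzzw_mul_divide hn, h1, head_add_self_tail])
    (by simp [divide_wzzw_mul (show 1 ≤ n by omega), h2, head_add_self_tail])
  h_mul x y := by
    refine ext_lo_hi (by simp [h3]) ?_
    simp only [AddMonoidHom.mk'_apply, hi_add, hi_mul, h4, h1, lo_ofHi, hi_ofHi, lo_mul,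
      zero_mul, zero_add, mul_zero, add_zero]
    -- Removing the truncation from the second factor and from the first expands the binary
    -- operation into the other three terms, so everything occurs twice. For `h_mul'` the
    -- truncations are removed in the opposite order.
    rw [divide_mul_head hn (head (n + 2) (lo x)) (lo y), divide_head_mul hn (lo x) (lo y)]
    abel_nf
    simp [two_eq_zero]
  h_mul' x y := by
    refine ext_lo_hi (by simp [h3]) ?_
    simp only [AddMonoidHom.mk'_apply, hi_add, hi_mul, h4, h1, lo_ofHi, hi_ofHi, lo_mul,
      zero_mul, zero_add, mul_zero, add_zero]
    rw [divide_head_mul hn (lo x) (head (n + 2) (lo y)), divide_mul_head hn (lo x) (lo y)]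
    abel_nf
    simp [two_eq_zero]
  h_mul_h _ _ := ext_lo_hi (by simp) (by simp)
  h_mul_binary _ _ _ := ext_lo_hi (by simp) (by simp [h3])
  binary_mul_h _ _ _ := ext_lo_hi (by simp [h3]) (by simp [h3])

/-! ### Comparison with the monomial formula for `φ₂` -/

open Full

/-- The part of a sum which consists of words in `w` and `z` with at most `N` letters, as a sum over
monomials with `wt₊ ≤ N`. -/
noncomputable def shortPart (N : ℕ) (f : Full) : Full :=
  ∑ a ∈ (Mono00.finite_wtPlus_le N).toFinset,
    -- Monomials with `θ` are kept as zero summands so that the index set is the one in `phiTwo`.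
    if a.1 then 0 else f (.zero a.2) • mono (.zero a.2)

theorem shortPart_apply (N : ℕ) (f : Full) (u : Word L0) :
    shortPart N f (.zero u) = head N f (.zero u) := by
  rw [shortPart, sum_apply, head_apply]
  by_cases hu : u.letters.length ≤ N
  · rw [if_neg (by simpa [Core.IsLong] using hu), Finset.sum_eq_single (false, u)]
    · simp [mono]
    · rintro ⟨θ, v⟩ - hne
      cases θ
      · have : u ≠ v := fun h => hne (by rw [h])
        simp [mono, this]
      · rfl
    · intro h
      exact absurd (by simpa [Mono00.wtPlus, Mono00.wt, Mono00.wtTheta] using hu) h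
  · rw [if_pos (by simpa [Core.IsLong] using hu)]
    refine Finset.sum_eq_zero ?_
    rintro ⟨θ, v⟩ hv
    cases θ
    · have : u ≠ v := by
        rintro rfl
        exact hu (by simpa [Mono00.wtPlus, Mono00.wt, Mono00.wtTheta] using hv)
      simp [mono, this]
    · rfl

/-- The components, as additive maps. -/
noncomputable def loAddHom : finiteAlgebra →+ Full := AddMonoidHom.mk' lo lo_add

/-- The components, as additive maps. -/
noncomputable def hiAddHom : finiteAlgebra →+ Full := AddMonoidHom.mk' hi hi_add

theorem lo_phiTwoMono (N : ℕ) (a b : Mono00) : lo (hS := le_rfl) (phiTwoMono N a b) = 0 := by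
  unfold phiTwoMono
  split
  · split_ifs
    · change lo (hS := le_rfl) _ * 0 = 0
      rw [mul_zero]
    · rfl
  · rfl

/-- If one of the monomials contains `θ`, the value is a multiple of `θ²`. Otherwise the threshold
in the definition is the one in `divide_mono`. -/
theorem hi_phiTwoMono {n : ℕ} (hn : 2 ≤ n) {a b : Mono00} (ha : a.wtPlus ≤ n + 2)
    (hb : b.wtPlus ≤ n + 2) :
    hi (hS := le_rfl) (phiTwoMono (n + 2) a b) = if a.1 || b.1 then 0 else
      divide n (mono (.zero a.2) * mono (.zero b.2)) := by
  obtain ⟨θ, u⟩ := a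
  obtain ⟨η, v⟩ := b
  have hθ : ∀ c : Mono00, c.1 = true → hi (hS := le_rfl) (c.toDual * theta) = 0 := by
    intro c hc
    rw [Mono00.toDual, if_pos hc]
    change 0 * 1 + _ * 0 = (0 : Full)
    simp
  have hθ' : ∀ c : Mono00, c.1 = false →
      hi (hS := le_rfl) (c.toDual * theta) = mono (.zero c.2) := by
    intro c hc
    rw [Mono00.toDual, if_neg (by simp [hc])]
    change mono (.zero c.2) * 1 + 0 * 0 = (mono (.zero c.2) : Full)
    simp
  unfold phiTwoMono
  cases h : u.mul v with
  | none =>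
    have h0 : Mono00.mul (θ, u) (η, v) = none := by simp [Mono00.mul, h]
    rw [h0, mono_mul_mono]
    simp only [Core.mul, h, Option.map_none, map_zero, ite_self]
    rfl
  | some c =>
    cases θ <;> cases η
    · have h0 : Mono00.mul (false, u) (false, v) = some (false, c) := by simp [Mono00.mul, h]
      rw [h0, mono_mul_mono]
      simp only [Core.mul, h, Option.map_some, ha, hb, and_true, Bool.or_false,
        divide_mono hn, Bool.false_eq_true, if_false]
      have hc : Mono00.wtPlus (false, c) = c.letters.length := by
        simp [Mono00.wtPlus, Mono00.wt, Mono00.wtTheta]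
      rw [hc]
      split_ifs
      · exact hθ' _ rfl
      · rfl
    · have h0 : Mono00.mul (false, u) (true, v) = some (true, c) := by simp [Mono00.mul, h]
      rw [h0]
      refine Eq.trans ?_ (if_pos rfl).symm
      dsimp only
      split_ifs
      · exact hθ _ rfl
      · rfl
    · have h0 : Mono00.mul (true, u) (false, v) = some (true, c) := by simp [Mono00.mul, h]
      rw [h0]
      refine Eq.trans ?_ (if_pos rfl).symm
      dsimp only
      split_ifs
      · exact hθ _ rfl
      · rfl
    · rfl

/-- Division of a product depends only on the coefficients of words in `w` and `z`, so the truncated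
factors may be replaced by their finite expansions `shortPart`. Expanding bilinearly gives the
double sum which defines `phiTwo`, with the summands identified by `hi_phiTwoMono`. -/
theorem phiTwo_eq {n : ℕ} (hn : 2 ≤ n) (x y : completedAlgebra) :
    phiTwo (n + 2) x y = phiTwoAddHom n hn x y := by
  have key : ∀ L : finiteAlgebra →+ Full, (∀ (r : ZMod 2) (z : DualNumber finiteSums),
      L (r • z : DualNumber finiteSums) = r • L z) →
      L (phiTwo (n + 2) x y) = ∑ a ∈ (Mono00.finite_wtPlus_le (n + 2)).toFinset,
        ∑ b ∈ (Mono00.finite_wtPlus_le (n + 2)).toFinset,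
          (a.coeff x * b.coeff y) • L (phiTwoMono (n + 2) a b) := by
    intro L hL
    refine (map_sum L _ _).trans (Finset.sum_congr rfl fun a _ => ?_)
    refine (map_sum L _ _).trans (Finset.sum_congr rfl fun b _ => ?_)
    exact hL _ _
  refine ext_lo_hi ?_ ?_
  · refine (key loAddHom fun _ _ => rfl).trans ?_
    refine Finset.sum_eq_zero fun a _ => Finset.sum_eq_zero fun b _ => ?_
    rw [show loAddHom (phiTwoMono (n + 2) a b) = 0 from lo_phiTwoMono _ a b, smul_zero]
  · refine (key hiAddHom fun _ _ => rfl).trans ?_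
    rw [hi_phiTwoAddHom, divide_mul_congr n (fun u => (shortPart_apply (n + 2) (lo x) u).symm)
      (fun u => (shortPart_apply (n + 2) (lo y) u).symm), shortPart, shortPart, Finset.sum_mul_sum,
      map_sum]
    refine Finset.sum_congr rfl fun a ha => ?_
    rw [map_sum]
    refine Finset.sum_congr rfl fun b hb => ?_
    rw [Set.Finite.mem_toFinset] at ha hb
    rw [show hiAddHom (phiTwoMono (n + 2) a b) = _ from hi_phiTwoMono hn ha hb]
    obtain ⟨θ, u⟩ := a
    obtain ⟨η, v⟩ := b
    cases θ <;> cases η <;> simp [Mono00.coeff]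
    rw [smul_smul]
    have : ∀ (r : ZMod 2) (f : Full), divide n (r • f) = r • divide n f := by
      intro r f
      ext m
      rw [smul_apply, divide_apply, divide_apply]
      split_ifs
      · rfl
      · exact (mul_zero r).symm
    rw [this, mul_comm]
    rfl

theorem truncationHom_op {n : ℕ} (hn : 2 ≤ n) : (truncationHom n hn).op = phiOp (n + 2) := by
  funext l
  rcases l with _ | ⟨a, _ | ⟨b, _ | ⟨c, l⟩⟩⟩
  · rfl
  · rfl
  · exact (phiTwo_eq hn a b).symm
  · rfl

/-- The composition of the inclusion and the truncation. -/
noncomputable def finiteTruncation (n : ℕ) (hn : 2 ≤ n) : BinaryHom finiteAlgebra finiteAlgebra :=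
  inclusionHom.comp (truncationHom n hn) (Or.inl rfl)

/-- The composition of the truncation and the inclusion. -/
noncomputable def completedTruncation (n : ℕ) (hn : 2 ≤ n) :
    BinaryHom completedAlgebra completedAlgebra :=
  (truncationHom n hn).comp inclusionHom (Or.inr rfl)

/-- The composition of the inclusion and the truncation is homotopic to the identity. -/
noncomputable def finiteContraction (n : ℕ) (hn : 2 ≤ n) : (finiteTruncation n hn).Contraction :=
  divisionContraction hn (fun _ hf => divide_mem_finiteSums (by omega) hf) _
    (fun x => by simp [finiteTruncation, BinaryHom.comp_unary, inclusionHom, truncationHom])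
    (fun x => by simp [finiteTruncation, BinaryHom.comp_unary, inclusionHom, truncationHom])
    (fun x y => by simp [finiteTruncation, BinaryHom.comp_binary, inclusionHom, truncationHom])
    (fun x y => by simp [finiteTruncation, BinaryHom.comp_binary, inclusionHom, truncationHom])

/-- The composition of the truncation and the inclusion is homotopic to the identity. -/
noncomputable def completedContraction (n : ℕ) (hn : 2 ≤ n) :
    (completedTruncation n hn).Contraction :=
  divisionContraction hn (fun f _ => divide_mem_completedSums n f) _
    (fun x => by simp [completedTruncation, BinaryHom.comp_unary, inclusionHom, truncationHom])
    (fun x => by simp [completedTruncation, BinaryHom.comp_unary, inclusionHom, truncationHom])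
    (fun x y => by simp [completedTruncation, BinaryHom.comp_binary, inclusionHom, truncationHom])
    (fun x y => by simp [completedTruncation, BinaryHom.comp_binary, inclusionHom, truncationHom])


/-! ## Rank-one bimodules -/

/-- The properties of a sequence of maps `A ⊗_I ⋯ ⊗_I A → B` to be well-defined, together with the
boundedness condition. -/
structure IsMultilinear {A B : CurvedDGA} (f : List A → B) : Prop where
  add : ∀ l a b l', f (l ++ (a + b) :: l') = f (l ++ a :: l') + f (l ++ b :: l')
  nil_comm : ∀ i, B.e i * f [] = f [] * B.e i
  e_cons : ∀ i a l, f (A.e i * a :: l) = B.e i * f (a :: l)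
  concat_e : ∀ l a i, f (l ++ [a * A.e i]) = f (l ++ [a]) * B.e i
  balanced : ∀ l a i b l', f (l ++ a * A.e i :: b :: l') = f (l ++ a :: A.e i * b :: l')
  bounded : ∃ n, ∀ l : List A, n < l.length → f l = 0

theorem AInfHom.isMultilinear {A B : CurvedDGA} (φ : AInfHom A B) : IsMultilinear φ.op where
  add := φ.op_add
  nil_comm i := by simp [φ.op_nil]
  e_cons := φ.op_e_cons
  concat_e := φ.op_concat_e
  balanced := φ.op_balanced
  bounded := φ.bounded

theorem CurvedDGA.two_eq_zero (A : CurvedDGA) : (2 : A) = 0 := by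
  rw [← one_add_one_eq_two, A.add_self]

theorem CurvedDGA.sum_e (A : CurvedDGA) : ∑ i, A.e i = 1 := by
  rw [Fin.sum_univ_two, A.e_sum]

namespace DAData

variable {A B : CurvedDGA}

/-- The underlying bimodule is `I`. -/
structure IsRankOne (P : DAData A B) (ε : P.gen ≃ Fin 2) : Prop where
  left : ∀ x, P.left x = ε x
  right : ∀ x, P.right x = ε x

/-- The maps between rank-one bimodules which are determined by a sequence of maps
`A ⊗ ⋯ ⊗ A → B`. -/
noncomputable def rankOneOps (P Q : DAData A B) [Finite Q.gen] (f : List A → B) : Ops P Q :=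
  fun l x => Finsupp.equivFunOnFinite.symm fun y => B.e (P.left x) * f l * B.e (Q.left y)

section

variable {P Q R : DAData A B} [Finite Q.gen] [Finite R.gen]
  {ε : P.gen ≃ Fin 2} {η : Q.gen ≃ Fin 2} {ζ : R.gen ≃ Fin 2}

theorem rankOneOps_apply (f : List A → B) (l : List A) (x : P.gen) (y : Q.gen) :
    rankOneOps P Q f l x y = B.e (P.left x) * f l * B.e (Q.left y) := rfl

theorem isBilinear_rankOneOps (hP : P.IsRankOne ε) (hQ : Q.IsRankOne η) {f : List A → B}
    (hf : IsMultilinear f) : IsBilinear (rankOneOps P Q f) where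
  add l a b l' x := by
    ext y
    simp [rankOneOps_apply, hf.add, mul_add, add_mul]
  left_e l x y := by
    simp [rankOneOps_apply, ← mul_assoc, B.e_mul_e]
  e_left l x y := by
    simp [rankOneOps_apply, mul_assoc, B.e_mul_e]
  nil_right x y h := by
    -- The value on the empty sequence commutes with the idempotents, so its off-diagonal entries
    -- contain a product of two different idempotents.
    rw [rankOneOps_apply, hf.nil_comm, mul_assoc, B.e_mul_e, if_neg, mul_zero]
    rwa [hP.left, hQ.left, ← hP.right, ← hQ.right]
  e_cons i a l x := by
    ext y
    rw [rankOneOps_apply, hf.e_cons, ← mul_assoc, B.e_mul_e, hP.left, hP.right]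
    split_ifs
    · rw [rankOneOps_apply, hP.left]
    · simp
  balanced l a i b l' x := by
    ext y
    simp [rankOneOps_apply, hf.balanced]
  concat_e l a i x y := by
    rw [rankOneOps_apply, hf.concat_e, mul_assoc, mul_assoc, B.e_mul_e, hQ.left, hQ.right]
    by_cases h : i = η y
    · rw [if_pos h, if_pos h.symm, rankOneOps_apply, mul_assoc, hQ.left, h]
    · rw [if_neg h, if_neg (Ne.symm h), mul_zero, mul_zero]

theorem isBounded_rankOneOps {f : List A → B} (hf : IsMultilinear f) :
    IsBounded (rankOneOps P Q f) := by
  obtain ⟨n, hn⟩ := hf.bounded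
  refine ⟨n, fun l hl => ?_⟩
  funext x
  ext y
  simp [rankOneOps_apply, hn l hl]

/-- The sum over the intermediate generator inserts `e 0 + e 1 = 1` between the two factors.
Compositions of rank-one data are thereby reduced to products in `B`. -/
theorem mcomp_rankOneOps (hQ : Q.IsRankOne η) (f g : List A → B) (l l' : List A) (x : P.gen)
    (z : R.gen) : mcomp (rankOneOps P Q f l) (rankOneOps Q R g l') x z
      = B.e (P.left x) * (f l * g l') * B.e (R.left z) := by
  have := Fintype.ofFinite Q.gen
  rw [mcomp_apply, Finsupp.sum_fintype _ _ (by simp)]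
  simp only [rankOneOps_apply]
  have : ∀ y : Q.gen, B.e (P.left x) * f l * B.e (Q.left y) * (B.e (Q.left y) * g l' * B.e (R.left z))
      = B.e (P.left x) * f l * B.e (η y) * (g l' * B.e (R.left z)) := by
    intro y
    simp only [hQ.left, mul_assoc]
    rw [← mul_assoc (B.e (η y)) (B.e (η y)), B.e_mul_e, if_pos rfl]
  simp only [this]
  rw [← Finset.sum_mul, ← Finset.mul_sum, Equiv.sum_comp η, B.sum_e, mul_one]
  simp only [mul_assoc]

theorem mdiff_rankOneOps (f : List A → B) (l : List A) (x : P.gen) (y : Q.gen) :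
    mdiff (rankOneOps P Q f l) x y = B.e (P.left x) * B.d (f l) * B.e (Q.left y) := by
  change B.d (B.e (P.left x) * f l * B.e (Q.left y)) = _
  rw [B.d_mul_e, B.d_e_mul]

theorem sum_map_apply {α M G : Type*} [AddCommMonoid M] (l : List α) (F : α → G →₀ M) (y : G) :
    (l.map F).sum y = (l.map fun a => F a y).sum := by
  induction l with
  | nil => rfl
  | cons a l ih => simp [ih]

theorem sum_map_mul_mul {α R : Type*} [Ring R] (l : List α) (F : α → R) (a b : R) :
    (l.map fun i => a * F i * b).sum = a * (l.map F).sum * b := by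
  rw [← List.sum_map_mul_left, ← List.sum_map_mul_right]

theorem single_rankOne (hP : P.IsRankOne ε) (c : B) (hc : ∀ i, B.e i * c = c * B.e i)
    (x y : P.gen) : Finsupp.single x (c * B.e (P.left x)) y
      = B.e (P.left x) * c * B.e (P.left y) := by
  rw [hc, mul_assoc, B.e_mul_e, hP.left, hP.left]
  by_cases h : x = y
  · subst h
    simp
  · rw [Finsupp.single_eq_of_ne' h, if_neg (fun h' => h (ε.injective h')), mul_zero]

/-- The bimodule with the operations of an `A∞`-morphism. -/
theorem isBimodule_of_rankOne [Finite P.gen] (hP : P.IsRankOne ε) (φ : AInfHom A B)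
    (h : P.op = rankOneOps P P φ.op) : P.IsBimodule where
  bilinear := by
    rw [h]
    exact isBilinear_rankOneOps hP hP φ.isMultilinear
  bounded := by
    rw [h]
    exact isBounded_rankOneOps φ.isMultilinear
  rel l x := by
    ext y
    -- Each entry of the structure equation is the `A∞`-relation multiplied by an idempotent on
    -- either side, with all terms on one side; they cancel in pairs.
    have hrel := φ.rel l
    rw [h]
    simp only [Finsupp.add_apply, sum_map_apply, mcomp_rankOneOps hP, mdiff_rankOneOps,
      rankOneOps_apply, sum_map_mul_mul, hrel]
    have : (if l = [] then Finsupp.single x (B.curv * B.e (P.left x)) else 0) y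
        = B.e (P.left x) * (if l = [] then B.curv else 0) * B.e (P.left y) := by
      split_ifs
      · exact single_rankOne hP _ (fun i => (B.curv_comm _).symm) x y
      · simp
    rw [this]
    simp only [mul_add, add_mul, Finsupp.zero_apply]
    abel_nf
    simp [B.two_eq_zero]

theorem comp_rankOneOps (hQ : Q.IsRankOne η) (f g : List A → B) :
    Ops.comp (rankOneOps P Q f) (rankOneOps Q R g)
      = rankOneOps P R fun l => ((splits l).map fun p => f p.1 * g p.2).sum := by
  funext l x
  ext z
  rw [Ops.comp, rankOneOps_apply, sum_map_apply]
  simp only [mcomp_rankOneOps hQ, sum_map_mul_mul]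

theorem id_rankOne [Finite P.gen] (hP : P.IsRankOne ε) :
    Ops.id P = rankOneOps P P fun l => if l = [] then 1 else 0 := by
  funext l x
  ext y
  rw [Ops.id, rankOneOps_apply]
  split_ifs
  · simpa using single_rankOne hP (1 : B) (by simp) x y
  · simp

theorem isHom_rankOneOps [Finite P.gen] (hP : P.IsRankOne ε) (hQ : Q.IsRankOne η) {f p q : List A → B}
    (hp : P.op = rankOneOps P P p) (hq : Q.op = rankOneOps Q Q q) (hf : IsMultilinear f)
    (h : ∀ l, B.d (f l) + ((splits l).map fun s => p s.1 * f s.2).sum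
      + ((splits l).map fun s => f s.1 * q s.2).sum + ((barTerms A l).map f).sum = 0) :
    IsHom (rankOneOps P Q f) where
  bilinear := isBilinear_rankOneOps hP hQ hf
  bounded := isBounded_rankOneOps hf
  closed := by
    funext l x
    ext y
    rw [Ops.diff, hp, hq, comp_rankOneOps hP, comp_rankOneOps hQ]
    simp only [Finsupp.add_apply, sum_map_apply, mdiff_rankOneOps, rankOneOps_apply,
      sum_map_mul_mul, ← mul_add, ← add_mul, h]
    simp

end

end DAData


/-! ## Box tensor products of rank-one bimodules -/

namespace AInfHom

variable {A B C : CurvedDGA} (φ : AInfHom B C) (ψ : AInfHom A B)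

theorem isRankOne_bimodule : ψ.bimodule.IsRankOne (Equiv.refl (Fin 2)) where
  left _ := rfl
  right _ := rfl

instance : Finite ψ.bimodule.gen := inferInstanceAs (Finite (Fin 2))

theorem bimodule_op : ψ.bimodule.op = DAData.rankOneOps ψ.bimodule ψ.bimodule ψ.op := rfl

theorem isBimodule_bimodule : ψ.bimodule.IsBimodule :=
  DAData.isBimodule_of_rankOne ψ.isRankOne_bimodule ψ ψ.bimodule_op

/-- The sum of `φ(bs, ψ(l₁), …, ψ(lₙ))` over all decompositions of `l` into `n` pieces. -/
def compAux : ℕ → List B → List A → C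
  | 0, bs, [] => φ.op bs
  | 0, _, _ :: _ => 0
  | n + 1, bs, l => ((splits l).map fun p => compAux n (bs ++ [ψ.op p.1]) p.2).sum

theorem compAux_add (n : ℕ) (bs : List B) (a b : B) (bs' : List B) (l : List A) :
    compAux φ ψ n (bs ++ (a + b) :: bs') l
      = compAux φ ψ n (bs ++ a :: bs') l + compAux φ ψ n (bs ++ b :: bs') l := by
  induction n generalizing bs' l with
  | zero =>
    cases l with
    | nil => exact φ.op_add bs a b bs'
    | cons c l => simp [compAux]
  | succ n ih => simp [compAux, ih, List.sum_map_add]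

theorem compAux_zero (n : ℕ) (bs : List B) (bs' : List B) (l : List A) :
    compAux φ ψ n (bs ++ 0 :: bs') l = 0 := by
  have := compAux_add φ ψ n bs 0 0 bs' l
  rw [add_zero] at this
  exact left_eq_add.1 this

theorem compAux_e_cons (n : ℕ) (i : Fin 2) (a : B) (bs : List B) (l : List A) :
    compAux φ ψ n (B.e i * a :: bs) l = C.e i * compAux φ ψ n (a :: bs) l := by
  induction n generalizing bs l with
  | zero =>
    cases l with
    | nil => exact φ.op_e_cons i a bs
    | cons c l => simp [compAux]
  | succ n ih => simp [compAux, ih, List.sum_map_mul_left]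

theorem compAux_balanced (n : ℕ) (bs : List B) (a : B) (i : Fin 2) (b : B) (bs' : List B)
    (l : List A) : compAux φ ψ n (bs ++ a * B.e i :: b :: bs') l
      = compAux φ ψ n (bs ++ a :: B.e i * b :: bs') l := by
  induction n generalizing bs' l with
  | zero =>
    cases l with
    | nil => exact φ.op_balanced bs a i b bs'
    | cons c l => simp [compAux]
  | succ n ih => simp [compAux, ih]

theorem sum_compAux_mul_e (n : ℕ) (bs : List B) (a : B) (l : List A) :
    ∑ i, compAux φ ψ n (bs ++ [a * B.e i]) l = compAux φ ψ n (bs ++ [a]) l := by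
  rw [Fin.sum_univ_two, ← compAux_add, ← mul_add, B.e_sum, mul_one]

/-- The box product records idempotents between consecutive outputs, whereas `compAux` does not. The
hypotheses say that the outputs collected so far end in the idempotent of the current generator `y`;
under them the extra idempotents can be absorbed and the sum over intermediate generators collapses.
-/
theorem boxAux_apply (n : ℕ) (bs : List B) (l : List A) (x y j : Fin 2) (hx : bs = [] → x = y)
    (hbs : ∀ bs' b, bs = bs' ++ [b] → b * B.e y = b) :
    DAData.boxAux φ.bimodule ψ.bimodule n bs l x y ((j, j) : Fin 2 × Fin 2)
      = C.e x * compAux φ ψ n bs l * C.e j := by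
  induction n generalizing bs l y with
  | zero =>
    cases l with
    | nil =>
      rw [compAux]
      change (φ.bimodule.op bs x).embDomain (Function.Embedding.sectL (Fin 2) y)
        ((j, j) : Fin 2 × Fin 2) = _
      by_cases h : y = j
      · subst h
        exact Finsupp.embDomain_apply_self _ _ _
      · refine (Finsupp.embDomain_of_notMem_range _ _ _ ?_).trans ?_
        · rintro ⟨i, hi⟩
          exact h (congrArg Prod.snd hi)
        -- Off the diagonal the right-hand side vanishes too: either there is no input for `φ`, or
        -- the last input ends in `e y` and `e y * e j = 0`.
        · rcases List.eq_nil_or_concat bs with rfl | ⟨bs', b, rfl⟩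
          · simp [φ.op_nil]
          · rw [List.concat_eq_append] at hbs ⊢
            rw [← hbs bs' b rfl, φ.op_concat_e, mul_assoc, mul_assoc, C.e_mul_e, if_neg h,
              mul_zero, mul_zero]
    | cons c l =>
      rw [compAux, mul_zero, zero_mul]
      rfl
  | succ n ih =>
    refine (DAData.sum_map_apply (splits l) _ ((j, j) : Fin 2 × Fin 2)).trans ?_
    rw [compAux, ← DAData.sum_map_mul_mul]
    refine congrArg List.sum (List.map_congr_left fun p _ => ?_)
    have hb : ∀ y' : Fin 2, ψ.bimodule.op p.1 y y' = B.e y * ψ.op p.1 * B.e y' := fun _ => rfl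
    have hstep : ∀ y' : Fin 2, DAData.boxAux φ.bimodule ψ.bimodule n
        (bs ++ [ψ.bimodule.op p.1 y y']) p.2 x y' ((j, j) : Fin 2 × Fin 2)
        = C.e x * compAux φ ψ n (bs ++ [B.e y * ψ.op p.1 * B.e y']) p.2 * C.e j := by
      intro y'
      rw [hb, ih]
      · simp
      · intro bs' b h
        obtain ⟨_, h⟩ := List.append_inj' h rfl
        simp only [List.cons.injEq, and_true] at h
        rw [← h, mul_assoc, B.e_mul_e, if_pos rfl]
    have hsum : (((ψ.bimodule.op p.1 y).sum fun y' b =>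
        DAData.boxAux φ.bimodule ψ.bimodule n (bs ++ [b]) p.2 x y')
          ((j, j) : Fin 2 × Fin 2) : C)
        = ∑ y' : Fin 2, C.e x * compAux φ ψ n (bs ++ [B.e y * ψ.op p.1 * B.e y']) p.2 * C.e j := by
      refine (Finsupp.finsetSum_apply _ _ _).trans ?_
      refine (Finset.sum_congr rfl fun y' _ => hstep y').trans ?_
      -- Generators outside the support contribute zero, since `compAux` is additive in each
      -- collected output.
      refine Finset.sum_subset (Finset.subset_univ (α := Fin 2) _) fun y' _ hy' => ?_
      have h0 : B.e y * ψ.op p.1 * B.e y' = 0 := Finsupp.notMem_support_iff.1 hy'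
      rw [h0, compAux_zero, mul_zero, zero_mul]
    refine hsum.trans ?_
    rw [← Finset.sum_mul, ← Finset.mul_sum, sum_compAux_mul_e]
    congr 1
    -- The left idempotent of the new output is absorbed by the outer `C.e x` if it is the first
    -- output, and otherwise moves into the preceding output by balancedness.
    rcases List.eq_nil_or_concat bs with rfl | ⟨bs', b, rfl⟩
    · rw [hx rfl, List.nil_append, List.nil_append, compAux_e_cons, ← mul_assoc, C.e_mul_e,
        if_pos rfl]
    · rw [List.concat_eq_append] at hbs ⊢
      rw [List.append_assoc, List.append_assoc, List.singleton_append, List.singleton_append,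
        ← compAux_balanced, hbs bs' b rfl]

/-- Each step appends one output, so `φ` is finally evaluated on `bs.length + n` inputs. This makes
the sum in the box product finite. -/
theorem boxAux_eq_zero {M : ℕ} (hM : ∀ bs, M < bs.length → φ.op bs = 0) (n : ℕ) (bs : List B)
    (l : List A) (x y : Fin 2) (h : M < bs.length + n) :
    DAData.boxAux φ.bimodule ψ.bimodule n bs l x y = 0 := by
  induction n generalizing bs l y with
  | zero =>
    cases l with
    | nil =>
      have : φ.bimodule.op bs x = 0 := by
        ext j
        change C.e x * φ.op bs * C.e j = 0
        rw [hM bs h, mul_zero, zero_mul]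
      exact (congrArg (Finsupp.embDomain _) this).trans (Finsupp.embDomain_zero _)
    | cons c l => rfl
  | succ n ih =>
    refine List.sum_eq_zero fun r hr => ?_
    obtain ⟨p, _, rfl⟩ := List.mem_map.1 hr
    refine Finset.sum_eq_zero fun y' _ => ?_
    exact ih _ _ _ (by simp; omega)

/-- The diagonal. -/
def boxEquiv : (DAData.box φ.bimodule ψ.bimodule).gen ≃ Fin 2 where
  toFun p := p.1.1
  invFun i := ⟨(i, i), rfl⟩
  left_inv p := Subtype.ext (Prod.ext rfl p.2)
  right_inv _ := rfl

theorem isRankOne_box : (DAData.box φ.bimodule ψ.bimodule).IsRankOne (boxEquiv φ ψ) where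
  left _ := rfl
  right p := p.2.symm

instance : Finite (DAData.box φ.bimodule ψ.bimodule).gen := Finite.of_equiv _ (boxEquiv φ ψ).symm

theorem box_op {M : ℕ} (hM : ∀ bs, M < bs.length → φ.op bs = 0) (θ : List A → C)
    (hθ : ∀ l, ∑ n ∈ Finset.range (M + 1), compAux φ ψ n [] l = θ l) :
    (DAData.box φ.bimodule ψ.bimodule).op = DAData.rankOneOps
      (DAData.box φ.bimodule ψ.bimodule) (DAData.box φ.bimodule ψ.bimodule) θ := by
  funext l p
  ext q
  obtain ⟨⟨x, y⟩, hxy⟩ := p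
  obtain ⟨⟨i, j⟩, hij⟩ := q
  obtain rfl : x = y := hxy
  obtain rfl : i = j := hij
  change (∑ᶠ n, DAData.boxAux φ.bimodule ψ.bimodule n [] l x x) ((i, i) : Fin 2 × Fin 2)
    = C.e x * θ l * C.e i
  rw [finsum_eq_sum_of_support_subset (s := Finset.range (M + 1))]
  · rw [← hθ, Finset.mul_sum, Finset.sum_mul]
    refine (Finsupp.finsetSum_apply _ _ _).trans ?_
    refine Finset.sum_congr rfl fun n _ => ?_
    exact boxAux_apply φ ψ n [] l x x i (fun _ => rfl) (by simp)
  · intro n hn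
    by_contra h
    refine hn (boxAux_eq_zero φ ψ hM n [] l x x ?_)
    simp at h ⊢
    omega

end AInfHom

namespace BinaryHom

variable {A B C : CurvedDGA}

/-- The box product of the two rank-one bimodules is the rank-one bimodule of the composite
morphism. The terms of arity three and four contain `G.binary` applied to a value of `F.binary`, so
they vanish. -/
theorem box_op (F : BinaryHom A B) (G : BinaryHom B C) (h : F.binary = 0 ∨ G.binary = 0) :
    (DAData.box G.toAInfHom.bimodule F.toAInfHom.bimodule).op = DAData.rankOneOps
      (DAData.box G.toAInfHom.bimodule F.toAInfHom.bimodule)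
      (DAData.box G.toAInfHom.bimodule F.toAInfHom.bimodule) (F.comp G h).op := by
  refine AInfHom.box_op _ _ (M := 2) (fun _ h => G.op_eq_zero h) _ fun l => ?_
  have h' : ∀ a b c d, G.binary (F.binary a b) (F.binary c d) = 0 := by
    rcases h with h | h <;> simp [h]
  -- Decompositions may have pieces that are empty or have more than two entries; these contribute
  -- the entry zero, which annihilates the term.
  have h0 : ∀ n bs l, AInfHom.compAux G.toAInfHom F.toAInfHom n (0 :: bs) l = 0 :=
    fun n bs l => AInfHom.compAux_zero _ _ n [] bs l
  have h1 : ∀ n b l, AInfHom.compAux G.toAInfHom F.toAInfHom n [b, 0] l = 0 :=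
    fun n b l => AInfHom.compAux_zero _ _ n [b] [] l
  rcases l with _ | ⟨a, _ | ⟨b, _ | ⟨c, _ | ⟨d, l⟩⟩⟩⟩
  · simp [Finset.sum_range_succ, AInfHom.compAux, splits]
  · simp [Finset.sum_range_succ, AInfHom.compAux, splits, comp_unary]
  · simp [Finset.sum_range_succ, AInfHom.compAux, splits, comp_binary]
  · rcases h with h | h <;> simp [Finset.sum_range_succ, AInfHom.compAux, splits, h]
  · rcases l with _ | ⟨e, l⟩ <;>
      simp [Finset.sum_range_succ, AInfHom.compAux, splits, h', h0, h1, Function.comp_def]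

theorem isBimodule_box (F : BinaryHom A B) (G : BinaryHom B C)
    (h : F.binary = 0 ∨ G.binary = 0) :
    (DAData.box G.toAInfHom.bimodule F.toAInfHom.bimodule).IsBimodule :=
  DAData.isBimodule_of_rankOne (AInfHom.isRankOne_box _ _) (F.comp G h).toAInfHom (F.box_op G h)

instance (A : CurvedDGA) : Finite (idBimodule A).gen := inferInstanceAs (Finite (Fin 2))

theorem isRankOne_idBimodule (A : CurvedDGA) :
    (idBimodule A).IsRankOne (Equiv.refl (Fin 2)) where
  left _ := rfl
  right _ := rfl

theorem idBimodule_op (A : CurvedDGA) : (idBimodule A).op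
    = DAData.rankOneOps (idBimodule A) (idBimodule A) (BinaryHom.id A).op := by
  funext l x
  ext y
  rw [DAData.rankOneOps_apply]
  rcases l with _ | ⟨a, _ | ⟨b, _ | ⟨c, l⟩⟩⟩
  · simp only [op_nil, mul_zero, zero_mul]
    rfl
  · rfl
  · simp only [op_two, BinaryHom.id, AddMonoidHom.zero_apply, mul_zero, zero_mul]
    rfl
  · simp only [op_more, mul_zero, zero_mul]
    rfl

/-! ### Contractions and isomorphisms with the identity bimodule -/

namespace Contraction

variable {F : BinaryHom A A} (H : F.Contraction)

/-- The isomorphism `1 + h` of bimodules. -/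
def op : List A → A
  | [] => 1
  | [a] => H.h a
  | _ => 0

@[simp] theorem op_nil : H.op [] = 1 := rfl
@[simp] theorem op_one (a : A) : H.op [a] = H.h a := rfl
@[simp] theorem op_more (a b : A) (l : List A) : H.op (a :: b :: l) = 0 := rfl

theorem op_eq_zero {l : List A} (h : 1 < l.length) : H.op l = 0 := by
  rcases l with _ | ⟨a, _ | ⟨b, l⟩⟩ <;> simp at h ⊢

theorem isMultilinear_op : IsMultilinear H.op where
  add l a b l' := by
    rcases l with _ | ⟨x, _ | ⟨y, l⟩⟩ <;> rcases l' with _ | ⟨x', l'⟩ <;> simp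
  nil_comm i := by simp
  e_cons i a l := by
    rcases l with _ | ⟨x, l⟩ <;> simp [H.h_e_mul]
  concat_e l a i := by
    rcases l with _ | ⟨x, _ | ⟨y, l⟩⟩ <;> simp [H.h_mul_e]
  balanced l a i b l' := by
    rw [H.op_eq_zero, H.op_eq_zero] <;> simp <;> omega
  bounded := ⟨1, fun _ h => H.op_eq_zero h⟩

theorem d_one (A : CurvedDGA) : A.d 1 = 0 := by
  have := A.leibniz 1 1
  rw [mul_one, mul_one, one_mul] at this
  exact left_eq_add.1 this

/-- On no, one, two and three inputs closedness is `h_curv`, `h_d`, `h_mul` and `binary_mul_h`; on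
more inputs every term is zero. The reverse direction `closed_op'` uses `h_mul'` and `h_mul_binary`
instead. -/
theorem closed_op (l : List A) : A.d (H.op l) + ((splits l).map fun s => F.op s.1 * H.op s.2).sum
    + ((splits l).map fun s => H.op s.1 * (BinaryHom.id A).op s.2).sum
    + ((barTerms A l).map H.op).sum = 0 := by
  rcases l with _ | ⟨a, _ | ⟨b, _ | ⟨c, l⟩⟩⟩
  · simp [barTerms, insertTerms, diffTerms, mulTerms, splits, H.h_curv, d_one]
  · simp only [barTerms, insertTerms, diffTerms, mulTerms, splits, BinaryHom.id, List.map_cons,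
      List.map_nil, List.sum_cons, List.sum_nil, op_one, op_nil, op_more, BinaryHom.op_nil,
      BinaryHom.op_one, AddMonoidHom.id_apply, List.cons_append, List.nil_append, zero_mul,
      mul_zero, mul_one, one_mul, add_zero, zero_add]
    calc _ = (A.d (H.h a) + H.h (A.d a)) + (a + F.unary a) := by abel
      _ = 0 := by rw [H.h_d, A.add_self]
  · rw [← H.h_mul a b]
    simp only [barTerms, insertTerms, diffTerms, mulTerms, splits, BinaryHom.id, List.map_cons,
      List.map_nil, List.sum_cons, List.sum_nil, op_one, op_nil, op_more, BinaryHom.op_nil,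
      BinaryHom.op_one, BinaryHom.op_two, AddMonoidHom.id_apply, AddMonoidHom.zero_apply,
      List.cons_append, List.nil_append, mul_zero, mul_one, add_zero, zero_add,
      map_zero]
    abel
  · rcases l with _ | ⟨d, l⟩ <;>
      simp [barTerms, insertTerms, diffTerms, mulTerms, splits, Function.comp_def, BinaryHom.id,
        H.binary_mul_h]

theorem closed_op' (l : List A) :
    A.d (H.op l) + ((splits l).map fun s => (BinaryHom.id A).op s.1 * H.op s.2).sum
    + ((splits l).map fun s => H.op s.1 * F.op s.2).sum
    + ((barTerms A l).map H.op).sum = 0 := by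
  rcases l with _ | ⟨a, _ | ⟨b, _ | ⟨c, l⟩⟩⟩
  · simp [barTerms, insertTerms, diffTerms, mulTerms, splits, H.h_curv, d_one]
  · simp only [barTerms, insertTerms, diffTerms, mulTerms, splits, BinaryHom.id, List.map_cons,
      List.map_nil, List.sum_cons, List.sum_nil, op_one, op_nil, op_more, BinaryHom.op_nil,
      BinaryHom.op_one, AddMonoidHom.id_apply, List.cons_append, List.nil_append, zero_mul,
      mul_zero, mul_one, one_mul, add_zero, zero_add]
    calc _ = (A.d (H.h a) + H.h (A.d a)) + (a + F.unary a) := by abel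
      _ = 0 := by rw [H.h_d, A.add_self]
  · rw [← H.h_mul' a b]
    simp only [barTerms, insertTerms, diffTerms, mulTerms, splits, BinaryHom.id, List.map_cons,
      List.map_nil, List.sum_cons, List.sum_nil, op_one, op_nil, op_more, BinaryHom.op_nil,
      BinaryHom.op_one, BinaryHom.op_two, AddMonoidHom.id_apply, AddMonoidHom.zero_apply,
      List.cons_append, List.nil_append, mul_zero, mul_one, one_mul, add_zero, zero_add,
      map_zero]
    abel
  · rcases l with _ | ⟨d, l⟩ <;>
      simp [barTerms, insertTerms, diffTerms, mulTerms, splits, Function.comp_def, BinaryHom.id,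
        H.h_mul_binary]

/-- This is `(1 + h)² = 1`: the two mixed terms cancel in characteristic two and products of values
of `h` vanish. One sequence therefore serves as the isomorphism and as its inverse. -/
theorem splits_op (l : List A) :
    ((splits l).map fun s => H.op s.1 * H.op s.2).sum = if l = [] then 1 else 0 := by
  rcases l with _ | ⟨a, _ | ⟨b, _ | ⟨c, l⟩⟩⟩
  · simp [splits]
  · simp [splits, A.add_self]
  · simp [splits, H.h_mul_h]
  · simp [splits, Function.comp_def]

theorem isomorphic (H : F.Contraction) {P : DAData A A} [Finite P.gen] {ε : P.gen ≃ Fin 2} (hP : P.IsRankOne ε)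
    (h : P.op = DAData.rankOneOps P P F.op) : DAData.Isomorphic P (idBimodule A) := by
  have hI := isRankOne_idBimodule A
  refine ⟨DAData.rankOneOps P (idBimodule A) H.op, DAData.rankOneOps (idBimodule A) P H.op,
    DAData.isHom_rankOneOps hP hI h (idBimodule_op A) H.isMultilinear_op H.closed_op,
    DAData.isHom_rankOneOps hI hP (idBimodule_op A) h H.isMultilinear_op H.closed_op', ?_, ?_⟩
  · rw [DAData.comp_rankOneOps hI, DAData.id_rankOne hP]
    simp only [H.splits_op]
  · rw [DAData.comp_rankOneOps hP, DAData.id_rankOne hI]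
    simp only [H.splits_op]

end Contraction

end BinaryHom


/-! ## Matrices -/

section

variable {A B C D : CurvedDGA} {W X Y Z : Type*}

/-- An additive map applied to each entry. -/
noncomputable def mmap (f : A →+ B) (M : X → Y →₀ A) : X → Y →₀ B :=
  fun x => (M x).mapRange f f.map_zero

/-- The matrix product for a biadditive map in place of the multiplication. -/
noncomputable def mmul (f : A →+ B →+ C) (M : X → Y →₀ A) (N : Y → Z →₀ B) : X → Z →₀ C :=
  fun x => (M x).sum fun y a => (N y).mapRange (f a) (f a).map_zero

theorem mmap_apply (f : A →+ B) (M : X → Y →₀ A) (x : X) (y : Y) : mmap f M x y = f (M x y) := rfl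

theorem mdiff_apply (M : X → Y →₀ A) (x : X) (y : Y) : mdiff M x y = A.d (M x y) := rfl

theorem mmul_apply (f : A →+ B →+ C) (M : X → Y →₀ A) (N : Y → Z →₀ B) (x : X) (z : Z) :
    mmul f M N x z = (M x).sum fun y a => f a (N y z) := by
  simp [mmul, Finsupp.sum, Finsupp.finsetSum_apply]

theorem mcomp_eq_mmul (M : X → Y →₀ A) (N : Y → Z →₀ A) :
    mcomp M N = mmul AddMonoidHom.mul M N := by
  funext x
  ext z
  rw [mcomp_apply, mmul_apply]
  rfl

theorem mmap_add (f : A →+ B) (M N : X → Y →₀ A) : mmap f (M + N) = mmap f M + mmap f N := by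
  funext x
  ext y
  exact f.map_add _ _

theorem mmap_zero (f : A →+ B) : mmap f (0 : X → Y →₀ A) = 0 := by
  funext x
  ext y
  exact f.map_zero

theorem mmul_zero_left (f : A →+ B →+ C) (N : Y → Z →₀ B) :
    mmul f (0 : X → Y →₀ A) N = 0 := rfl

theorem mmul_zero_right (f : A →+ B →+ C) (M : X → Y →₀ A) :
    mmul f M (0 : Y → Z →₀ B) = 0 := by
  funext x
  ext y
  simp [mmul_apply]

theorem mmul_add_left (f : A →+ B →+ C) (M M' : X → Y →₀ A) (N : Y → Z →₀ B) :
    mmul f (M + M') N = mmul f M N + mmul f M' N := by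
  funext x
  ext z
  rw [Pi.add_apply, Finsupp.add_apply, mmul_apply, mmul_apply, mmul_apply, Pi.add_apply,
    Finsupp.sum_add_index'] <;> simp

theorem mmul_add_right (f : A →+ B →+ C) (M : X → Y →₀ A) (N N' : Y → Z →₀ B) :
    mmul f M (N + N') = mmul f M N + mmul f M N' := by
  funext x
  ext z
  simp [mmul_apply]

/-- The support can shrink under `f`; additivity of `g y` ensures that the lost terms are zero. This
lemma and the similar ones below turn matrix identities into identities between entries. -/
theorem sum_mmap {G : Type*} [AddCommMonoid G] (f : A →+ B) (M : X → Y →₀ A) (x : X)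
    (g : Y → B →+ G) : ((mmap f M x).sum fun y b => g y b) = (M x).sum fun y a => g y (f a) :=
  Finsupp.sum_mapRange_index (by simp)

theorem sum_mdiff {G : Type*} [AddCommMonoid G] (M : X → Y →₀ A) (x : X)
    (g : Y → A →+ G) : ((mdiff M x).sum fun y b => g y b) = (M x).sum fun y a => g y (A.d a) :=
  Finsupp.sum_mapRange_index (by simp)

theorem sum_mmul {G : Type*} [AddCommMonoid G] (f : A →+ B →+ C) (M : X → Y →₀ A)
    (N : Y → Z →₀ B) (x : X) (g : Z → C →+ G) :
    ((mmul f M N x).sum fun z c => g z c)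
      = (M x).sum fun y a => (N y).sum fun z b => g z (f a b) := by
  rw [mmul, Finsupp.sum_sum_index (by simp) (by simp)]
  exact Finsupp.sum_congr fun y _ => Finsupp.sum_mapRange_index (by simp)

theorem sum_mcomp {G : Type*} [AddCommMonoid G] (M : X → Y →₀ A)
    (N : Y → Z →₀ A) (x : X) (g : Z → A →+ G) :
    ((mcomp M N x).sum fun z c => g z c)
      = (M x).sum fun y a => (N y).sum fun z b => g z (a * b) := by
  rw [mcomp_eq_mmul, sum_mmul]
  rfl

theorem mmul_mcomp_left (f : A →+ B →+ C) (M : W → X →₀ A) (N : X → Y →₀ A) (P : Y → Z →₀ B)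
    (w : W) (z : Z) : mmul f (mcomp M N) P w z
      = (M w).sum fun x a => (N x).sum fun y b => f (a * b) (P y z) := by
  rw [mmul_apply]
  exact sum_mcomp M N w fun y => f.flip (P y z)

theorem mmul_mcomp_right (f : A →+ B →+ C) (M : W → X →₀ A) (N : X → Y →₀ B) (P : Y → Z →₀ B)
    (w : W) (z : Z) : mmul f M (mcomp N P) w z
      = (M w).sum fun x a => (N x).sum fun y b => f a (b * P y z) := by
  rw [mmul_apply]
  refine Finsupp.sum_congr fun x _ => ?_
  rw [mcomp_apply, map_finsuppSum]

theorem mcomp_mmap_left (f : A →+ B) (M : X → Y →₀ A) (N : Y → Z →₀ B) (x : X) (z : Z) :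
    mcomp (mmap f M) N x z = (M x).sum fun y a => f a * N y z := by
  rw [mcomp_apply]
  exact sum_mmap f M x fun y => AddMonoidHom.mulRight (N y z)

theorem mcomp_mmul_left (f : A →+ B →+ C) (M : W → X →₀ A) (N : X → Y →₀ B) (P : Y → Z →₀ C)
    (w : W) (z : Z) : mcomp (mmul f M N) P w z
      = (M w).sum fun x a => (N x).sum fun y b => f a b * P y z := by
  rw [mcomp_apply]
  exact sum_mmul f M N w fun y => AddMonoidHom.mulRight (P y z)

theorem mmul_mdiff_left (f : A →+ B →+ C) (M : X → Y →₀ A) (N : Y → Z →₀ B) (x : X) (z : Z) :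
    mmul f (mdiff M) N x z = (M x).sum fun y a => f (A.d a) (N y z) := by
  rw [mmul_apply]
  exact sum_mdiff M x fun y => f.flip (N y z)

theorem mmul_mmap_left (g : D →+ A) (f : A →+ B →+ C) (M : X → Y →₀ D) (N : Y → Z →₀ B) (x : X)
    (z : Z) : mmul f (mmap g M) N x z = (M x).sum fun y a => f (g a) (N y z) := by
  rw [mmul_apply]
  exact sum_mmap g M x fun y => f.flip (N y z)

theorem mmap_mcomp (f : A →+ B) (M : X → Y →₀ A) (N : Y → Z →₀ A) (x : X) (z : Z) :
    mmap f (mcomp M N) x z = (M x).sum fun y a => f (a * N y z) := by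
  rw [mmap_apply, mcomp_apply, map_finsuppSum]

theorem mdiff_mmul (f : A →+ B →+ C) (M : X → Y →₀ A) (N : Y → Z →₀ B) (x : X) (z : Z) :
    mdiff (mmul f M N) x z = (M x).sum fun y a => C.d (f a (N y z)) := by
  rw [mdiff_apply, mmul_apply, map_finsuppSum]

/-- The diagonal matrix whose entries are the products of `c` and the idempotents. -/
noncomputable def diag (c : A) (i : X → Fin 2) : X → X →₀ A :=
  fun x => Finsupp.single x (c * A.e (i x))

theorem diag_apply (c : A) (i : X → Fin 2) (x : X) :
    diag c i x = Finsupp.single x (c * A.e (i x)) := rfl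

theorem mmap_diag (f : A →+ B) (hf : ∀ i a, f (a * A.e i) = f a * B.e i) (c : A) (i : X → Fin 2) :
    mmap f (diag c i) = diag (f c) i := by
  funext x
  refine Finsupp.mapRange_single.trans ?_
  rw [hf]
  rfl

end

/-! ### Matrix form of the relations for binary morphisms and contractions -/

namespace BinaryHom

variable {A B : CurvedDGA} (F : BinaryHom A B) {W X Y Z : Type*}

theorem mmap_mdiff (M : X → Y →₀ A) : mmap F.unary (mdiff M) = mdiff (mmap F.unary M) := by
  funext x
  ext y
  exact F.unary_d _

theorem mmap_mul (M : X → Y →₀ A) (N : Y → Z →₀ A) :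
    mmul F.binary (mdiff M) N + mmul F.binary M (mdiff N) + mmap F.unary (mcomp M N)
      = mdiff (mmul F.binary M N) + mcomp (mmap F.unary M) (mmap F.unary N) := by
  funext x
  ext z
  simp only [Pi.add_apply, Finsupp.add_apply, mmul_mdiff_left, mmap_mcomp, mdiff_mmul,
    mcomp_mmap_left]
  rw [mmul_apply, ← Finsupp.sum_add, ← Finsupp.sum_add, ← Finsupp.sum_add]
  exact Finsupp.sum_congr fun y _ => F.unary_mul _ _

theorem mmul_mul (M : W → X →₀ A) (N : X → Y →₀ A) (P : Y → Z →₀ A) :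
    mmul F.binary (mcomp M N) P + mmul F.binary M (mcomp N P)
      = mcomp (mmap F.unary M) (mmul F.binary N P)
        + mcomp (mmul F.binary M N) (mmap F.unary P) := by
  funext w
  ext z
  simp only [Pi.add_apply, Finsupp.add_apply, mmul_mcomp_left, mmul_mcomp_right, mcomp_mmap_left,
    mcomp_mmul_left]
  rw [← Finsupp.sum_add, ← Finsupp.sum_add]
  refine Finsupp.sum_congr fun x _ => ?_
  rw [mmul_apply, Finsupp.mul_sum, ← Finsupp.sum_add, ← Finsupp.sum_add]
  exact Finsupp.sum_congr fun y _ => F.binary_mul _ _ _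

theorem mmul_mul_mmul {V : Type*} (M : V → W →₀ A) (N : W → X →₀ A) (P : X → Y →₀ A)
    (Q : Y → Z →₀ A) : mcomp (mmul F.binary M N) (mmul F.binary P Q) = 0 := by
  funext w
  ext z
  rw [mcomp_mmul_left]
  simp [mmul_apply, Finsupp.mul_sum, F.binary_mul_binary]

/-- The idempotent on the diagonal moves to the second argument by balancedness, leaving `c` alone
in the first. This is applied to the curvature and to the unit. -/
theorem mmul_diag_left {c : A} (hc : ∀ a, F.binary c a = 0) (i : X → Fin 2) (N : X → Y →₀ A) :
    mmul F.binary (diag c i) N = 0 := by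
  funext x
  ext y
  rw [mmul_apply, diag_apply, Finsupp.sum_single_index (by simp), F.binary_balanced, hc]
  rfl

theorem mmul_diag_right {c : A} (hc : ∀ a, F.binary a c = 0) (i : Y → Fin 2) (M : X → Y →₀ A) :
    mmul F.binary M (diag c i) = 0 := by
  funext x
  ext y
  rw [mmul_apply]
  refine Finset.sum_eq_zero fun z _ => ?_
  by_cases h : z = y
  · subst h
    dsimp only
    rw [diag_apply, Finsupp.single_eq_same, F.binary_mul_e, hc, zero_mul]
  · dsimp only
    rw [diag_apply, Finsupp.single_eq_of_ne' h, map_zero]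

namespace Contraction

variable {F : BinaryHom A A} (H : F.Contraction)

theorem mmap_d (M : X → Y →₀ A) :
    mdiff (mmap H.h M) + mmap H.h (mdiff M) = M + mmap F.unary M := by
  funext x
  ext y
  exact H.h_d _

theorem mmap_mul (M : X → Y →₀ A) (N : Y → Z →₀ A) :
    mmul F.binary M N + mcomp (mmap F.unary M) (mmap H.h N) + mcomp (mmap H.h M) N
      + mmap H.h (mcomp M N) = 0 := by
  funext x
  ext z
  simp only [Pi.add_apply, Finsupp.add_apply, mmap_mcomp, mcomp_mmap_left]
  rw [mmul_apply, ← Finsupp.sum_add, ← Finsupp.sum_add, ← Finsupp.sum_add]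
  exact Finset.sum_eq_zero fun y _ => H.h_mul _ _

theorem mmap_mul' (M : X → Y →₀ A) (N : Y → Z →₀ A) :
    mmul F.binary M N + mcomp M (mmap H.h N) + mcomp (mmap H.h M) (mmap F.unary N)
      + mmap H.h (mcomp M N) = 0 := by
  funext x
  ext z
  simp only [Pi.add_apply, Finsupp.add_apply, mmap_mcomp, mcomp_mmap_left]
  rw [mmul_apply, mcomp_apply, ← Finsupp.sum_add, ← Finsupp.sum_add, ← Finsupp.sum_add]
  exact Finset.sum_eq_zero fun y _ => H.h_mul' _ _

theorem mmap_mul_mmap (M : X → Y →₀ A) (N : Y → Z →₀ A) :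
    mcomp (mmap H.h M) (mmap H.h N) = 0 := by
  funext x
  ext z
  rw [mcomp_mmap_left]
  exact Finset.sum_eq_zero fun y _ => H.h_mul_h _ _

theorem mmap_mul_mmul (M : W → X →₀ A) (N : X → Y →₀ A) (P : Y → Z →₀ A) :
    mcomp (mmap H.h M) (mmul F.binary N P) = 0 := by
  funext x
  ext z
  rw [mcomp_mmap_left]
  simp [mmul_apply, Finsupp.mul_sum, H.h_mul_binary]

theorem mmul_mul_mmap (M : W → X →₀ A) (N : X → Y →₀ A) (P : Y → Z →₀ A) :
    mcomp (mmul F.binary M N) (mmap H.h P) = 0 := by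
  funext x
  ext z
  rw [mcomp_mmul_left]
  simp [mmap_apply, H.binary_mul_h]

end Contraction

end BinaryHom

/-! ## Induced type-`D` modules and functors -/

theorem zsmul_matrix_eq_zero {A : CurvedDGA} {X Y : Type*} (M : X → Y →₀ A) :
    (2 : ℤ) • M = 0 := by
  rw [two_zsmul, madd_self]

theorem neg_zsmul_matrix_eq_zero {A : CurvedDGA} {X Y : Type*} (M : X → Y →₀ A) :
    (-2 : ℤ) • M = 0 := by
  rw [neg_zsmul, zsmul_matrix_eq_zero, neg_zero]

namespace TypeD

variable {A : CurvedDGA}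

theorem sumWords_eq_zero {M : Type*} [AddCommMonoid M] {X : TypeD.{u} A} :
    ∀ {Y : TypeD.{u} A} (p : Quiver.Path X Y) (K : List A → Y.gen → M) (x : X.gen),
      (∀ l y, l.length = p.length → K l y = 0) → sumWords p K x = 0
  | _, .nil, K, x, h => h [] x rfl
  | _, .cons p f, K, x, h => sumWords_eq_zero p _ x fun l y hl =>
      Finset.sum_eq_zero fun z _ => h _ z (by simp [hl])

theorem length_of_mem_insertions {X : TypeD.{u} A} : ∀ (k : ℕ) {Y : TypeD.{u} A}
    (p q : Quiver.Path X Y), q ∈ insertions k p → q.length = k + p.length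
  | 0, _, p, q, h => by
    rw [insertions, List.mem_singleton] at h
    simp [h]
  | k + 1, _, .nil, q, h => by
    rw [insertions] at h
    obtain ⟨r, hr, rfl⟩ := List.mem_map.1 h
    simp [length_of_mem_insertions k _ r hr]
  | k + 1, _, .cons p f, q, h => by
    rw [insertions] at h
    rcases List.mem_append.1 h with h | h
    · obtain ⟨r, hr, rfl⟩ := List.mem_map.1 h
      have := length_of_mem_insertions k _ r hr
      simp at this ⊢
      omega
    · obtain ⟨r, hr, rfl⟩ := List.mem_map.1 h
      have := length_of_mem_insertions (k + 1) _ r hr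
      simp at this ⊢
      omega
  termination_by k _ p => (k, p.length)

end TypeD

namespace BinaryHom

open TypeD

variable {A B : CurvedDGA} (F : BinaryHom A B)

/-- After `k` insertions the operation receives `k + p.length` inputs, and only one or two inputs
give a nonzero value. -/
theorem push_term_eq_zero {X Y : TypeD.{u} A} (p : Quiver.Path X Y) (x : X.gen) (k : ℕ)
    (h : k + p.length = 0 ∨ 2 < k + p.length) :
    ((insertions k p).map fun q =>
      sumWords q (fun l y => Finsupp.single y (F.op l)) x).sum = 0 := by
  refine List.sum_eq_zero fun r hr => ?_
  obtain ⟨q, hq, rfl⟩ := List.mem_map.1 hr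
  refine sumWords_eq_zero q _ x fun l y hl => ?_
  rw [length_of_mem_insertions k p q hq] at hl
  have : F.op l = 0 := by
    rcases h with h | h
    · rw [List.length_eq_zero_iff.1 (hl.trans h), op_nil]
    · exact F.op_eq_zero (hl ▸ h)
  rw [this, Finsupp.single_zero]

theorem push_eq {X Y : TypeD.{u} A} (p : Quiver.Path X Y) (x : X.gen) :
    F.toAInfHom.push p x = ∑ k ∈ Finset.range 3, ((insertions k p).map fun q =>
      sumWords q (fun l y => Finsupp.single y (F.op l)) x).sum := by
  refine finsum_eq_sum_of_support_subset _ fun k hk => ?_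
  by_contra h
  refine hk (F.push_term_eq_zero p x k (Or.inr ?_))
  simp at h
  omega

theorem sumWords_one {X Y : TypeD.{u} A} (f : X ⟶ Y) (x : X.gen) :
    sumWords (Quiver.Path.cons .nil f) (fun l y => Finsupp.single y (F.op l)) x
      = mmap F.unary (matrix f) x :=
  (Finsupp.sum_mapRange_index (h := fun y b => Finsupp.single y b) (by simp)).symm.trans
    (Finsupp.sum_single _)

theorem sumWords_two {X Y Z : TypeD.{u} A} (f : X ⟶ Y) (g : Y ⟶ Z) (x : X.gen) :
    sumWords (Quiver.Path.cons (.cons .nil f) g) (fun l y => Finsupp.single y (F.op l)) x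
      = mmul F.binary (matrix f) (matrix g) x := by
  change ((matrix f x).sum fun y a => (matrix g y).sum fun z b =>
    Finsupp.single z (F.binary a b)) = _
  exact Finsupp.sum_congr fun y _ =>
    (Finsupp.sum_mapRange_index (h := fun y b => Finsupp.single y b) (by simp)).symm.trans
    (Finsupp.sum_single _)

theorem push_nil (X : TypeD.{u} A) : F.toAInfHom.push (.nil : Quiver.Path X X)
    = mmap F.unary X.δ + mmul F.binary X.δ X.δ := by
  funext x
  rw [push_eq, Finset.sum_range_succ, Finset.sum_range_succ, Finset.sum_range_succ]
  simp only [Finset.range_zero, Finset.sum_empty, insertions, List.map_cons, List.map_nil,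
    List.sum_cons, List.sum_nil, sumWords_one, sumWords_two]
  simp [sumWords]
  rfl

theorem push_one {X Y : TypeD.{u} A} (f : X ⟶ Y) : F.toAInfHom.push (.cons .nil f)
    = mmap F.unary (matrix f) + mmul F.binary (matrix f) Y.δ + mmul F.binary X.δ (matrix f) := by
  funext x
  rw [push_eq, Finset.sum_range_succ, Finset.sum_range_succ, Finset.sum_range_succ,
    F.push_term_eq_zero _ _ 2 (Or.inr (by simp))]
  simp only [Finset.range_zero, Finset.sum_empty, insertions, List.map_cons, List.map_nil,
    List.sum_cons, List.sum_nil, sumWords_one, sumWords_two, List.cons_append, List.nil_append,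
    add_zero, zero_add, add_assoc]
  rfl

theorem push_two {X Y Z : TypeD.{u} A} (f : X ⟶ Y) (g : Y ⟶ Z) :
    F.toAInfHom.push (.cons (.cons .nil f) g) = mmul F.binary (matrix f) (matrix g) := by
  funext x
  rw [push_eq, Finset.sum_range_succ, Finset.sum_range_succ, Finset.sum_range_succ,
    F.push_term_eq_zero _ _ 2 (Or.inr (by simp)), F.push_term_eq_zero _ _ 1 (Or.inr (by simp))]
  simp [insertions, sumWords_two]

theorem push_eq_zero {X Y : TypeD.{u} A} (p : Quiver.Path X Y) (h : 2 < p.length) :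
    F.toAInfHom.push p = 0 := by
  funext x
  rw [push_eq]
  exact Finset.sum_eq_zero fun k _ => F.push_term_eq_zero p x k (Or.inr (by omega))

/-- The structure equation of the new module is the sum of the relations of `F` on `(δ, δ)` and `(δ,
δ, δ)`, together with the images of the old structure equation under `F.unary`, under `F.binary`
with `δ` on the right, and under `F.binary` with `δ` on the left. The curvature survives only
through `F.unary`. -/
theorem preservesTypeD : F.toAInfHom.PreservesTypeD := by
  intro X x
  have hrel : mcomp X.δ X.δ + mdiff X.δ + diag A.curv X.idem = 0 := funext X.rel
  refine congrFun (?_ : mcomp (F.toAInfHom.push (.nil : Quiver.Path X X))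
    (F.toAInfHom.push (.nil : Quiver.Path X X)) + mdiff (F.toAInfHom.push
    (.nil : Quiver.Path X X)) + diag B.curv X.idem = (0 : X.gen → X.gen →₀ B)) x
  rw [push_nil]
  have h1 := congrArg (mmap F.unary) hrel
  have h2 := congrArg (fun M => mmul F.binary M X.δ) hrel
  have h3 := congrArg (fun M => mmul F.binary X.δ M) hrel
  have h4 := F.mmap_mul X.δ X.δ
  have h5 := F.mmul_mul X.δ X.δ X.δ
  simp only [mmap_add, mmul_add_left, mmul_add_right, mcomp_add_left, mcomp_add_right, mdiff_add,
    F.mmul_diag_left F.binary_curv_left, F.mmul_diag_right F.binary_curv_right,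
    mmap_diag F.unary F.unary_mul_e, F.mmap_mdiff, F.unary_curv, F.mmul_mul_mmul, mmap_zero,
    mmul_zero_left, mmul_zero_right, add_zero] at h1 h2 h3 h4 h5 ⊢
  linear_combination (norm := skip) h1 + h2 + h3 + h4 + h5
  abel_nf
  simp only [zsmul_matrix_eq_zero, neg_zsmul_matrix_eq_zero, add_zero]

end BinaryHom


/-! ### Induced maps on morphisms and the `A∞`-functor relations -/

open CategoryTheory

section Paths

universe v w

variable {C : Type w} [Category.{v} C]

theorem length_of_mem_pathSplits {X : C} : ∀ {Y : C} (p : Quiver.Path X Y)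
    (s : Σ Z : C, Quiver.Path X Z × Quiver.Path Z Y), s ∈ pathSplits p →
    s.2.1.length + s.2.2.length = p.length
  | _, .nil, s, h => by
    rw [pathSplits, List.mem_singleton] at h
    subst h
    rfl
  | _, .cons p f, s, h => by
    rw [pathSplits] at h
    rcases List.mem_cons.1 h with rfl | h
    · rfl
    · obtain ⟨r, hr, rfl⟩ := List.mem_map.1 h
      have := length_of_mem_pathSplits p r hr
      simp only [Quiver.Path.length_cons]
      omega

theorem length_of_mem_pathComps {X : C} : ∀ {Y : C} (p q : Quiver.Path X Y), q ∈ pathComps p →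
    q.length + 1 = p.length
  | _, .nil, q, h => by simp [pathComps] at h
  | _, .cons .nil f, q, h => by simp [pathComps] at h
  | _, .cons (.cons p f) g, q, h => by
    rw [pathComps] at h
    rcases List.mem_cons.1 h with rfl | h
    · rfl
    · obtain ⟨r, hr, rfl⟩ := List.mem_map.1 h
      have := length_of_mem_pathComps _ r hr
      simp only [Quiver.Path.length_cons] at this ⊢
      omega

theorem length_of_mem_pathDiffs [Preadditive C] [DGCategory C] {X : C} :
    ∀ {Y : C} (p q : Quiver.Path X Y), q ∈ pathDiffs p → q.length = p.length
  | _, .nil, q, h => by simp [pathDiffs] at h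
  | _, .cons p f, q, h => by
    rw [pathDiffs] at h
    rcases List.mem_cons.1 h with rfl | h
    · rfl
    · obtain ⟨r, hr, rfl⟩ := List.mem_map.1 h
      have := length_of_mem_pathDiffs _ r hr
      simp only [Quiver.Path.length_cons] at this ⊢
      omega

end Paths

namespace TypeD

variable {A : CurvedDGA}

theorem matrix_injective {X Y : TypeD.{u} A} {f g : X ⟶ Y} (h : matrix f = matrix g) : f = g :=
  Subtype.ext h

theorem matrix_add {X Y : TypeD.{u} A} (f g : X ⟶ Y) :
    matrix (f + g) = matrix f + matrix g := rfl

theorem matrix_comp {X Y Z : TypeD.{u} A} (f : X ⟶ Y) (g : Y ⟶ Z) :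
    matrix (f ≫ g) = mcomp (matrix f) (matrix g) := rfl

theorem matrix_d {X Y : TypeD.{u} A} (f : X ⟶ Y) : matrix (DGCategory.d f)
    = mdiff (matrix f) + mcomp (matrix f) Y.δ + mcomp X.δ (matrix f) := rfl

theorem matrix_id (X : TypeD.{u} A) : matrix (𝟙 X) = diag 1 X.idem := by
  funext x
  rw [diag_apply, one_mul]
  rfl

end TypeD

namespace BinaryHom

open TypeD AInfFunctorData

variable {A B : CurvedDGA} (F : BinaryHom A B)

/-- The induced functor on type-`D` modules. -/
noncomputable abbrev functor : AInfFunctorData (TypeD.{u} A) (TypeD.{u} B) :=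
  F.toAInfHom.functor F.preservesTypeD

theorem functor_obj_δ (X : TypeD.{u} A) :
    (F.functor.obj X).δ = mmap F.unary X.δ + mmul F.binary X.δ X.δ := F.push_nil X

theorem functor_map_nil (X : TypeD.{u} A) :
    F.functor.map (.nil : Quiver.Path X X) = 0 := rfl

theorem matrix_functor_map_one {X Y : TypeD.{u} A} (f : X ⟶ Y) :
    matrix (F.functor.map (.cons .nil f)) = mmap F.unary (matrix f)
      + mmul F.binary (matrix f) Y.δ + mmul F.binary X.δ (matrix f) := F.push_one f

theorem matrix_functor_map_two {X Y Z : TypeD.{u} A} (f : X ⟶ Y) (g : Y ⟶ Z) :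
    matrix (F.functor.map (.cons (.cons .nil f) g)) = mmul F.binary (matrix f) (matrix g) :=
  F.push_two f g

theorem functor_map_eq_zero {X Y : TypeD.{u} A} (p : Quiver.Path X Y) (h : 2 < p.length) :
    F.functor.map p = 0 := by
  cases p with
  | nil => rfl
  | cons p f => exact matrix_injective (F.push_eq_zero _ h)

theorem functor_map_more {V W X Y Z : TypeD.{u} A} (p : Quiver.Path V W) (f : W ⟶ X) (g : X ⟶ Y)
    (k : Y ⟶ Z) : F.functor.map (.cons (.cons (.cons p f) g) k) = 0 :=
  F.functor_map_eq_zero _ (by simp)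

theorem functor_map_add {W X Y Z : TypeD.{u} A} (p : Quiver.Path W X) (f g : X ⟶ Y)
    (q : Quiver.Path Y Z) : F.functor.map ((p.cons (f + g)).comp q)
      = F.functor.map ((p.cons f).comp q) + F.functor.map ((p.cons g).comp q) := by
  by_cases h : 2 < p.length + 1 + q.length
  · rw [functor_map_eq_zero, functor_map_eq_zero, functor_map_eq_zero, add_zero] <;>
      simpa [Quiver.Path.length_comp] using h
  · apply matrix_injective
    rw [matrix_add]
    rcases q with _ | ⟨_ | ⟨q, k'⟩, k⟩
    · rcases p with _ | ⟨_ | ⟨p, l'⟩, l⟩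
      · simp only [Quiver.Path.comp_nil, matrix_functor_map_one, matrix_add, mmap_add,
          mmul_add_left, mmul_add_right]
        abel
      · simp only [Quiver.Path.comp_nil, matrix_functor_map_two, matrix_add, mmul_add_right]
        rfl
      · simp at h
    · rcases p with _ | ⟨p, l⟩
      · simp only [Quiver.Path.comp_nil, Quiver.Path.comp_cons, matrix_functor_map_two,
          matrix_add, mmul_add_left]
        rfl
      · simp at h
    · simp at h
      omega

theorem δ_rel (X : TypeD.{u} A) : mcomp X.δ X.δ + mdiff X.δ + diag A.curv X.idem = 0 :=
  funext X.rel

/-- Sum of the relations of `F` over all sequences of length two and three with one entry `f` and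
all others `δ`; the structure equations of `X` and `Y` remove the terms with adjacent `δ`. The next
two lemmas follow the same pattern with two and three morphisms. -/
theorem push_one_d {X Y : TypeD.{u} A} (f : X ⟶ Y) :
    F.toAInfHom.push (.cons .nil (DGCategory.d f)) = mdiff (F.toAInfHom.push (.cons .nil f))
      + mcomp (F.toAInfHom.push (.cons .nil f)) (F.toAInfHom.push (.nil : Quiver.Path Y Y))
      + mcomp (F.toAInfHom.push (.nil : Quiver.Path X X)) (F.toAInfHom.push (.cons .nil f)) := by
  rw [push_one, push_one, push_nil, push_nil, matrix_d]
  have h1 := congrArg (fun M => mmul F.binary M (matrix f)) (δ_rel X)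
  have h2 := congrArg (mmul F.binary (matrix f)) (δ_rel Y)
  have h3 := F.mmap_mul X.δ (matrix f)
  have h4 := F.mmap_mul (matrix f) Y.δ
  have h5 := F.mmul_mul X.δ X.δ (matrix f)
  have h6 := F.mmul_mul X.δ (matrix f) Y.δ
  have h7 := F.mmul_mul (matrix f) Y.δ Y.δ
  simp only [mmap_add, mmul_add_left, mmul_add_right, mcomp_add_left, mcomp_add_right, mdiff_add,
    F.mmul_diag_left F.binary_curv_left, F.mmul_diag_right F.binary_curv_right,
    F.mmap_mdiff, F.mmul_mul_mmul, mmul_zero_left, mmul_zero_right, add_zero]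
    at h1 h2 h3 h4 h5 h6 h7 ⊢
  linear_combination (norm := skip) h1 + h2 + h3 + h4 + h5 + h6 + h7
  abel_nf
  simp only [neg_zsmul_matrix_eq_zero, add_zero]

theorem push_two_d {X Y Z : TypeD.{u} A} (f : X ⟶ Y) (g : Y ⟶ Z) :
    F.toAInfHom.push (.cons (.cons .nil f) (DGCategory.d g))
      + F.toAInfHom.push (.cons (.cons .nil (DGCategory.d f)) g)
      + F.toAInfHom.push (.cons .nil (f ≫ g))
      = mdiff (F.toAInfHom.push (.cons (.cons .nil f) g))
      + mcomp (F.toAInfHom.push (.cons (.cons .nil f) g))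
          (F.toAInfHom.push (.nil : Quiver.Path Z Z))
      + mcomp (F.toAInfHom.push (.nil : Quiver.Path X X))
          (F.toAInfHom.push (.cons (.cons .nil f) g))
      + mcomp (F.toAInfHom.push (.cons .nil f)) (F.toAInfHom.push (.cons .nil g)) := by
  simp only [push_two, push_one, push_nil, matrix_d, matrix_comp]
  have h1 := F.mmap_mul (matrix f) (matrix g)
  have h2 := F.mmul_mul X.δ (matrix f) (matrix g)
  have h3 := F.mmul_mul (matrix f) Y.δ (matrix g)
  have h4 := F.mmul_mul (matrix f) (matrix g) Z.δ
  simp only [mmul_add_left, mmul_add_right, mcomp_add_left, mcomp_add_right,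
    F.mmul_mul_mmul, add_zero] at h1 h2 h3 h4 ⊢
  linear_combination (norm := skip) h1 + h2 + h3 + h4
  abel_nf

theorem push_three_d {W X Y Z : TypeD.{u} A} (f : W ⟶ X) (g : X ⟶ Y) (k : Y ⟶ Z) :
    F.toAInfHom.push (.cons (.cons .nil f) (g ≫ k))
      + F.toAInfHom.push (.cons (.cons .nil (f ≫ g)) k)
      = mcomp (F.toAInfHom.push (.cons (.cons .nil f) g)) (F.toAInfHom.push (.cons .nil k))
      + mcomp (F.toAInfHom.push (.cons .nil f)) (F.toAInfHom.push (.cons (.cons .nil g) k)) := by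
  simp only [push_two, push_one, matrix_comp, mcomp_add_left, mcomp_add_right, F.mmul_mul_mmul,
    add_zero]
  rw [add_comm, F.mmul_mul, add_comm]

/-- Since `F` accepts at most two inputs, paths with more than four morphisms give no nonzero term:
composing two morphisms leaves a path that is still too long, and a splitting always has a part with
more than two morphisms. -/
theorem functor_rel {X Y : TypeD.{u} A} (p : Quiver.Path X Y) :
    ((pathDiffs p).map F.functor.map).sum + ((pathComps p).map F.functor.map).sum
      = DGCategory.d (F.functor.map p)
        + ((pathSplits p).map fun s => F.functor.map s.2.1 ≫ F.functor.map s.2.2).sum := by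
  by_cases h : 4 < p.length
  · rw [List.sum_eq_zero, List.sum_eq_zero, List.sum_eq_zero,
      F.functor_map_eq_zero p (by omega), map_zero, add_zero]
    · intro r hr
      obtain ⟨s, hs, rfl⟩ := List.mem_map.1 hr
      have := length_of_mem_pathSplits p s hs
      by_cases h' : 2 < s.2.1.length
      · rw [F.functor_map_eq_zero _ h', Limits.zero_comp]
      · rw [F.functor_map_eq_zero s.2.2 (by omega), Limits.comp_zero]
    · intro r hr
      obtain ⟨s, hs, rfl⟩ := List.mem_map.1 hr
      have := length_of_mem_pathComps p s hs
      exact F.functor_map_eq_zero _ (by omega)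
    · intro r hr
      obtain ⟨s, hs, rfl⟩ := List.mem_map.1 hr
      have := length_of_mem_pathDiffs p s hs
      exact F.functor_map_eq_zero _ (by omega)
  · rcases p with _ | ⟨_ | ⟨_ | ⟨_ | ⟨_ | ⟨p, a⟩, b⟩, c⟩, f⟩, g⟩
    · simp [pathDiffs, pathComps, pathSplits, functor_map_nil]
    · simp only [pathDiffs, pathComps, pathSplits, functor_map_nil, List.map_cons, List.map_nil,
        List.sum_cons, List.sum_nil, Limits.comp_zero, Limits.zero_comp, add_zero]
      exact matrix_injective (F.push_one_d g)
    · simp only [pathDiffs, pathComps, pathSplits, functor_map_nil, List.map_cons, List.map_nil,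
        List.sum_cons, List.sum_nil, Limits.comp_zero, Limits.zero_comp, add_zero, zero_add]
      exact matrix_injective (F.push_two_d f g)
    · simp only [pathDiffs, pathComps, pathSplits, functor_map_nil, functor_map_more,
        List.map_cons, List.map_nil, List.sum_cons, List.sum_nil, Limits.comp_zero,
        add_zero, zero_add, map_zero]
      exact matrix_injective (F.push_three_d c f g)
    · simp only [pathDiffs, pathComps, pathSplits, functor_map_nil, functor_map_more,
        List.map_cons, List.map_nil, List.sum_cons, List.sum_nil, Limits.comp_zero,
        Limits.zero_comp, add_zero, zero_add, map_zero]
      -- With four morphisms the only surviving splitting is two and two, a product of binary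
      -- values.
      refine matrix_injective (Eq.symm ?_)
      refine (congrArg₂ mcomp (F.push_two b c) (F.push_two f g)).trans ?_
      exact F.mmul_mul_mmul _ _ _ _
    · simp at h

theorem isAInfFunctor : (F.functor : AInfFunctorData (TypeD.{u} A) _).IsAInfFunctor where
  map_nil X := rfl
  map_add p f g q := F.functor_map_add p f g q
  map_id X := by
    apply matrix_injective
    rw [matrix_id]
    refine (F.matrix_functor_map_one _).trans ?_
    rw [matrix_id, F.mmul_diag_left F.binary_one_left, F.mmul_diag_right F.binary_one_right,
      mmap_diag F.unary F.unary_mul_e, F.unary_one, add_zero, add_zero]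
    rfl
  rel p := F.functor_rel p

end BinaryHom


/-! ### Composition of the induced functors -/

open CategoryTheory TypeD AInfFunctorData

section Images

universe v v' w w'

variable {C : Type w} {D : Type w'} [Category.{v} C] [Category.{v'} D]
  (F : AInfFunctorData C D)

/-- The path contains a zero morphism. -/
def HasZero [Preadditive D] {X Y : D} (q : Quiver.Path X Y) : Prop :=
  ∃ (Z W : D) (p : Quiver.Path X Z) (r : Quiver.Path W Y), q = (p.cons (0 : Z ⟶ W)).comp r

theorem length_pos_of_mem_images {X : C} : ∀ {Y Z : C} (p : Quiver.Path X Y)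
    (r : Quiver.Path Y Z) (q : Quiver.Path (F.obj X) (F.obj Z)), q ∈ F.images p r → 0 < q.length
  | _, _, .nil, r, q, h => by
    rw [images, List.mem_singleton] at h
    subst h
    exact Nat.one_pos
  | _, _, .cons p f, r, q, h => by
    rw [images] at h
    rcases List.mem_append.1 h with h | h
    · obtain ⟨q', -, rfl⟩ := List.mem_map.1 h
      simp
    · exact length_pos_of_mem_images p _ q h

/-- The last piece `r` can only grow before its image is taken, so once it has more than one
morphism it produces a zero. -/
theorem hasZero_of_mem_images [Preadditive D]
    (hF : ∀ {X Y : C} (p : Quiver.Path X Y), 1 < p.length → F.map p = 0)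
    {X : C} : ∀ {Y Z : C} (p : Quiver.Path X Y) (r : Quiver.Path Y Z)
      (q : Quiver.Path (F.obj X) (F.obj Z)), q ∈ F.images p r → 1 < r.length → HasZero q
  | _, _, .nil, r, q, h, hr => by
    rw [images, List.mem_singleton] at h
    subst h
    exact ⟨_, _, .nil, .nil, by rw [hF r hr]; rfl⟩
  | _, _, .cons p f, r, q, h, hr => by
    rw [images] at h
    rcases List.mem_append.1 h with h | h
    · obtain ⟨q', -, rfl⟩ := List.mem_map.1 h
      exact ⟨_, _, q', .nil, by rw [hF r hr]; rfl⟩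
    · exact hasZero_of_mem_images hF p _ q h (by rw [Quiver.Path.length_comp]; omega)

/-- If `F` acts only on single morphisms, the partition into single morphisms is the only one
without a zero entry, and it preserves the length. -/
theorem hasZero_or_length [Preadditive D]
    (hF : ∀ {X Y : C} (p : Quiver.Path X Y), 1 < p.length → F.map p = 0)
    {X : C} : ∀ {Y Z : C} (p : Quiver.Path X Y) (r : Quiver.Path Y Z)
      (q : Quiver.Path (F.obj X) (F.obj Z)), q ∈ F.images p r → 0 < r.length →
      HasZero q ∨ q.length = p.length + 1
  | _, _, .nil, r, q, h, hr => by
    rw [images, List.mem_singleton] at h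
    subst h
    exact Or.inr rfl
  | _, _, .cons p f, r, q, h, hr => by
    rw [images] at h
    rcases List.mem_append.1 h with h | h
    · obtain ⟨q', hq', rfl⟩ := List.mem_map.1 h
      rcases hasZero_or_length hF p _ q' hq' Nat.one_pos with ⟨Z, W, s, t, rfl⟩ | h'
      · exact Or.inl ⟨Z, W, s, t.cons (F.map r), rfl⟩
      · exact Or.inr (by simp [h'])
    · refine Or.inl (hasZero_of_mem_images F hF p _ q h ?_)
      rw [Quiver.Path.length_comp]
      exact Nat.lt_add_of_pos_right hr

end Images

namespace BinaryHom

section Comp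

variable {A B C : CurvedDGA} (F : BinaryHom A B) (G : BinaryHom B C)

theorem functor_map_hasZero {X Y : TypeD.{u} A} (q : Quiver.Path X Y) (hq : HasZero q) :
    F.functor.map q = 0 := by
  obtain ⟨Z, W, p, r, rfl⟩ := hq
  have := F.functor_map_add p 0 0 r
  rw [add_zero] at this
  exact left_eq_add.1 this

theorem zero_mmul {A B C : CurvedDGA} {X Y Z : Type*} (M : X → Y →₀ A) (N : Y → Z →₀ B) :
    mmul (0 : A →+ B →+ C) M N = 0 := by
  funext x
  ext y
  simp [mmul_apply]

theorem functor_map_eq_zero_of_binary (hF : F.binary = 0) {X Y : TypeD.{u} A}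
    (p : Quiver.Path X Y) (hp : 1 < p.length) : F.functor.map p = 0 := by
  rcases p with _ | ⟨_ | ⟨_ | ⟨p, a⟩, f⟩, g⟩
  · rfl
  · simp at hp
  · apply matrix_injective
    rw [matrix_functor_map_two, hF, zero_mmul]
    rfl
  · exact F.functor_map_more _ _ _ _

variable (h : F.binary = 0 ∨ G.binary = 0)

theorem mmap_comp {X Y : Type*} (M : X → Y →₀ A) :
    mmap (F.comp G h).unary M = mmap G.unary (mmap F.unary M) := by
  funext x
  ext y
  rfl

theorem mmul_comp {X Y Z : Type*} (M : X → Y →₀ A) (N : Y → Z →₀ A) :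
    mmul (F.comp G h).binary M N = mmap G.unary (mmul F.binary M N)
      + mmul G.binary (mmap F.unary M) (mmap F.unary N) := by
  funext x
  ext z
  rw [Pi.add_apply, Finsupp.add_apply, mmul_mmap_left, mmul_apply, mmap_apply, mmul_apply,
    map_finsuppSum, ← Finsupp.sum_add]
  rfl

theorem mmul_mmul_left (h : F.binary = 0 ∨ G.binary = 0) {W X Y Z : Type*} (M : W → X →₀ A) (N : X → Y →₀ A) (P : Y → Z →₀ B) :
    mmul G.binary (mmul F.binary M N) P = 0 := by
  rcases h with h | h
  · rw [h, zero_mmul, mmul_zero_left]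
  · rw [h, zero_mmul]

theorem mmul_mmul_right (h : F.binary = 0 ∨ G.binary = 0) {W X Y Z : Type*} (M : W → X →₀ B) (N : X → Y →₀ A) (P : Y → Z →₀ A) :
    mmul G.binary M (mmul F.binary N P) = 0 := by
  rcases h with h | h
  · rw [h, zero_mmul, mmul_zero_right]
  · rw [h, zero_mmul]

/-- Pushing the structure map forward twice produces the operations of the composite and, in
addition, terms with `G.binary` applied to values of `F.binary`; the latter vanish. The same
expansion handles one and two morphisms below. -/
theorem comp_push_nil (X : TypeD.{u} A) :
    mmap G.unary (F.toAInfHom.push (.nil : Quiver.Path X X))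
      + mmul G.binary (F.toAInfHom.push (.nil : Quiver.Path X X))
        (F.toAInfHom.push (.nil : Quiver.Path X X))
      = (F.comp G h).toAInfHom.push (.nil : Quiver.Path X X) := by
  rw [push_nil, push_nil, mmap_comp, mmul_comp]
  simp only [mmap_add, mmul_add_left, mmul_add_right, mmul_mmul_left F G h,
    mmul_mmul_right F G h, add_zero]
  abel

theorem comp_push_one {X Y : TypeD.{u} A} (f : X ⟶ Y) :
    mmap G.unary (F.toAInfHom.push (.cons .nil f))
      + mmul G.binary (F.toAInfHom.push (.cons .nil f))
        (F.toAInfHom.push (.nil : Quiver.Path Y Y))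
      + mmul G.binary (F.toAInfHom.push (.nil : Quiver.Path X X))
        (F.toAInfHom.push (.cons .nil f))
      = (F.comp G h).toAInfHom.push (.cons .nil f) := by
  rw [push_nil, push_nil, push_one, push_one, mmap_comp, mmul_comp, mmul_comp]
  simp only [mmap_add, mmul_add_left, mmul_add_right, mmul_mmul_left F G h,
    mmul_mmul_right F G h, add_zero]
  abel

theorem comp_push_two {X Y Z : TypeD.{u} A} (f : X ⟶ Y) (g : Y ⟶ Z) :
    mmul G.binary (F.toAInfHom.push (.cons .nil f)) (F.toAInfHom.push (.cons .nil g))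
      + (mmap G.unary (F.toAInfHom.push (.cons (.cons .nil f) g))
      + mmul G.binary (F.toAInfHom.push (.cons (.cons .nil f) g))
        (F.toAInfHom.push (.nil : Quiver.Path Z Z))
      + mmul G.binary (F.toAInfHom.push (.nil : Quiver.Path X X))
        (F.toAInfHom.push (.cons (.cons .nil f) g)))
      = (F.comp G h).toAInfHom.push (.cons (.cons .nil f) g) := by
  rw [push_nil, push_nil, push_one, push_one, push_two, push_two, mmul_comp]
  simp only [mmul_add_left, mmul_add_right, mmul_mmul_left F G h,
    mmul_mmul_right F G h, add_zero]
  abel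

/-- The generators of the iterated image are definitionally those of `X`, so structure maps and
morphisms are compared as matrices, without transport along an equality of objects. -/
theorem comp_functor_obj_δ (X : TypeD.{u} A) :
    ((F.functor.comp G.functor).obj X).δ = (F.comp G h).toAInfHom.push
      (.nil : Quiver.Path X X) :=
  (G.functor_obj_δ _).trans (comp_push_nil F G h X)

theorem comp_functor_map_one {X Y : TypeD.{u} A} (f : X ⟶ Y) :
    matrix ((F.functor.comp G.functor).map (.cons .nil f))
      = (F.comp G h).toAInfHom.push (.cons .nil f) := by
  have : (F.functor.comp G.functor).map (.cons .nil f)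
      = G.functor.map (.cons .nil (F.functor.map (.cons .nil f))) := add_zero _
  rw [this]
  exact (G.matrix_functor_map_one _).trans (comp_push_one F G h f)

theorem comp_functor_map_two {X Y Z : TypeD.{u} A} (f : X ⟶ Y) (g : Y ⟶ Z) :
    matrix ((F.functor.comp G.functor).map (.cons (.cons .nil f) g))
      = (F.comp G h).toAInfHom.push (.cons (.cons .nil f) g) := by
  -- A pair of morphisms is either cut into two pieces or left whole.
  have : (F.functor.comp G.functor).map (.cons (.cons .nil f) g)
      = G.functor.map (.cons (.cons .nil (F.functor.map (.cons .nil f)))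
          (F.functor.map (.cons .nil g)))
        + G.functor.map (.cons .nil (F.functor.map (.cons (.cons .nil f) g))) :=
    congrArg (G.functor.map (.cons (.cons .nil (F.functor.map (.cons .nil f)))
      (F.functor.map (.cons .nil g))) + ·) (add_zero _)
  rw [this]
  exact (congrArg₂ (· + ·) (G.matrix_functor_map_two _ _) (G.matrix_functor_map_one _)).trans
    (comp_push_two F G h f g)

/-- If `F.binary = 0`, only the partition into single morphisms could survive, and it gives `G` more
than two inputs. If `G.binary = 0`, only the undivided path could survive, and it gives `F` more
than two inputs. -/
theorem comp_functor_map_eq_zero (h : F.binary = 0 ∨ G.binary = 0) {X Y : TypeD.{u} A} (p : Quiver.Path X Y) (hp : 2 < p.length) :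
    (F.functor.comp G.functor).map p = 0 := by
  cases p with
  | nil => rfl
  | cons p f =>
    refine List.sum_eq_zero fun r hr => ?_
    obtain ⟨q, hq, rfl⟩ := List.mem_map.1 hr
    rcases h with h | h
    · rcases hasZero_or_length F.functor (F.functor_map_eq_zero_of_binary h) p _ q hq Nat.one_pos
        with h' | h'
      · exact G.functor_map_hasZero q h'
      · exact G.functor_map_eq_zero q (by rw [h']; exact hp)
    -- The statement is generalized to an arbitrary unfinished last piece `r` because the recursion
    -- in `images` lets that piece grow.
    · have key : ∀ {Y Z : TypeD.{u} A} (p : Quiver.Path X Y) (r : Quiver.Path Y Z)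
          (q : Quiver.Path (F.functor.obj X) (F.functor.obj Z)), q ∈ F.functor.images p r →
          2 < p.length + r.length → G.functor.map q = 0 := by
        intro Y Z p
        induction p with
        | nil =>
          intro r q hq hl
          rw [images, List.mem_singleton] at hq
          subst hq
          rw [F.functor_map_eq_zero r (by simpa using hl)]
          exact G.functor_map_hasZero _ ⟨_, _, .nil, .nil, rfl⟩
        | cons p f ih =>
          intro r q hq hl
          rw [images] at hq
          rcases List.mem_append.1 hq with hq | hq
          · obtain ⟨q', hq', rfl⟩ := List.mem_map.1 hq
            refine G.functor_map_eq_zero_of_binary h _ ?_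
            have := length_pos_of_mem_images F.functor _ _ _ hq'
            simpa using this
          · refine ih _ q hq ?_
            rw [Quiver.Path.length_comp]
            simp at hl ⊢
            omega
      exact key p _ q hq hp

end Comp

end BinaryHom


/-! ### Matrix identities for the natural transformations -/

open CategoryTheory TypeD AInfFunctorData

namespace TypeD

variable {A : CurvedDGA}

theorem matrix_mem {X Y : TypeD.{u} A} (f : X ⟶ Y) : matrix f ∈ homs X Y := f.2

theorem mdiff_idMatrix (X : TypeD.{u} A) : mdiff (idMatrix X) = 0 := by
  funext x
  refine Finsupp.mapRange_single.trans ?_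
  rw [← one_mul (A.e _), A.d_mul_e, BinaryHom.Contraction.d_one, zero_mul, Finsupp.single_zero]
  rfl

end TypeD

namespace BinaryHom

namespace Contraction

variable {A : CurvedDGA} {F : BinaryHom A A} (H : F.Contraction)

/-- The matrices of the natural transformations between the functor induced by `F` and the identity
functor. -/
noncomputable def transfer {X : TypeD.{u} A} : ∀ {Y : TypeD.{u} A}, Quiver.Path X Y →
    X.gen → Y.gen →₀ A
  | _, .nil => idMatrix X + mmap H.h X.δ
  | _, .cons .nil f => mmap H.h (matrix f)
  | _, .cons (.cons _ _) _ => 0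

theorem mmap_h_mem {X Y : TypeD.{u} A} {M : X.gen → Y.gen →₀ A} (hM : M ∈ homs X Y) :
    mmap H.h M ∈ homs X Y := by
  intro x y
  have h := hM x y
  rw [mmap_apply]
  exact ⟨by rw [← H.h_e_mul, h.1], by rw [← H.h_mul_e, h.2]⟩

theorem transfer_mem {X : TypeD.{u} A} : ∀ {Y : TypeD.{u} A} (p : Quiver.Path X Y),
    H.transfer p ∈ homs X Y
  | _, .nil => add_mem (idMatrix_mem X) (H.mmap_h_mem (δ_mem X))
  | _, .cons .nil f => H.mmap_h_mem f.2
  | _, .cons (.cons _ _) _ => zero_mem _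

theorem transfer_nil (X : TypeD.{u} A) :
    H.transfer (.nil : Quiver.Path X X) = idMatrix X + mmap H.h X.δ := rfl

theorem transfer_one {X Y : TypeD.{u} A} (f : X ⟶ Y) :
    H.transfer (.cons .nil f) = mmap H.h (matrix f) := rfl

theorem transfer_eq_zero {X Y : TypeD.{u} A} (p : Quiver.Path X Y) (h : 1 < p.length) :
    H.transfer p = 0 := by
  rcases p with _ | ⟨_ | ⟨p, f⟩, g⟩
  · simp at h
  · simp at h
  · rfl

theorem transfer_add {W X Y Z : TypeD.{u} A} (p : Quiver.Path W X) (f g : X ⟶ Y)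
    (q : Quiver.Path Y Z) : H.transfer ((p.cons (f + g)).comp q)
      = H.transfer ((p.cons f).comp q) + H.transfer ((p.cons g).comp q) := by
  by_cases h : 1 < p.length + 1 + q.length
  · rw [transfer_eq_zero, transfer_eq_zero, transfer_eq_zero, add_zero] <;>
      simpa [Quiver.Path.length_comp] using h
  · rcases q with _ | ⟨q, k⟩
    · rcases p with _ | ⟨p, l⟩
      · exact mmap_add H.h _ _
      · simp at h
    · simp at h
      omega

theorem id_mcomp_push {X Y : TypeD.{u} A} (p : Quiver.Path X Y) :
    mcomp (idMatrix X) (F.toAInfHom.push p) = F.toAInfHom.push p :=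
  id_mcomp fun x y => F.toAInfHom.push_mem p x y

theorem mcomp_push_id {X Y : TypeD.{u} A} (p : Quiver.Path X Y) :
    mcomp (F.toAInfHom.push p) (idMatrix Y) = F.toAInfHom.push p :=
  mcomp_id fun x y => F.toAInfHom.push_mem p x y

/-- The homotopy vanishes on the curvature, so the image of the structure equation under `h` has no
curvature term. -/
theorem mmap_δ_rel (X : TypeD.{u} A) :
    mmap H.h (mcomp X.δ X.δ) + mmap H.h (mdiff X.δ) = 0 := by
  have h := congrArg (mmap H.h) (δ_rel X)
  rw [mmap_add, mmap_add, mmap_diag H.h H.h_mul_e, H.h_curv, mmap_zero] at h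
  have h0 : diag (0 : A) X.idem = 0 := by
    funext x
    rw [diag_apply, zero_mul, Finsupp.single_zero]
    rfl
  rwa [h0, add_zero] at h

/-- This is closedness of `1 + h` on one and two inputs, evaluated at `δ` and `(δ, δ)`. The
structure equation replaces the bar differential, and a product of a binary value with a value of
`h` vanishes. -/
theorem closed_nil (X : TypeD.{u} A) :
    mdiff (H.transfer (.nil : Quiver.Path X X)) + mcomp (H.transfer (.nil : Quiver.Path X X)) X.δ
      + mcomp (F.toAInfHom.push (.nil : Quiver.Path X X))
        (H.transfer (.nil : Quiver.Path X X)) = 0 := by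
  have h1 := H.mmap_δ_rel X
  have h2 := H.mmap_d X.δ
  have h3 := H.mmap_mul X.δ X.δ
  rw [transfer_nil, mdiff_add, mcomp_add_left, mcomp_add_right, id_mcomp (δ_mem X),
    mcomp_push_id, push_nil, mcomp_add_left, H.mmul_mul_mmap, mdiff_idMatrix]
  linear_combination (norm := skip) h1 + h2 + h3
  abel_nf
  simp only [zsmul_matrix_eq_zero, neg_zsmul_matrix_eq_zero, add_zero]

theorem closed_nil' (X : TypeD.{u} A) :
    mdiff (H.transfer (.nil : Quiver.Path X X)) + mcomp (H.transfer (.nil : Quiver.Path X X))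
        (F.toAInfHom.push (.nil : Quiver.Path X X))
      + mcomp X.δ (H.transfer (.nil : Quiver.Path X X)) = 0 := by
  have h1 := H.mmap_δ_rel X
  have h2 := H.mmap_d X.δ
  have h3 := H.mmap_mul' X.δ X.δ
  rw [transfer_nil, mdiff_add, mcomp_add_left, mcomp_add_right, mcomp_id (δ_mem X),
    id_mcomp_push, push_nil, mcomp_add_right, H.mmap_mul_mmul, mdiff_idMatrix]
  linear_combination (norm := skip) h1 + h2 + h3
  abel_nf
  simp only [zsmul_matrix_eq_zero, neg_zsmul_matrix_eq_zero, add_zero]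

/-- The homotopy formula for `f` is added to the product rules for `(δ, f)` and `(f, δ)`. The terms
in which `h` is applied to a product are those of `h` applied to the differential of `f`. -/
theorem closed_one {X Y : TypeD.{u} A} (f : X ⟶ Y) :
    mdiff (H.transfer (.cons .nil f)) + mcomp (H.transfer (.cons .nil f)) Y.δ
      + mcomp (F.toAInfHom.push (.nil : Quiver.Path X X)) (H.transfer (.cons .nil f))
      + mcomp (H.transfer (.nil : Quiver.Path X X)) (matrix f)
      + mcomp (F.toAInfHom.push (.cons .nil f)) (H.transfer (.nil : Quiver.Path Y Y))
      + H.transfer (.cons .nil (DGCategory.d f)) = 0 := by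
  have h1 := H.mmap_d (matrix f)
  have h2 := H.mmap_mul X.δ (matrix f)
  have h3 := H.mmap_mul (matrix f) Y.δ
  rw [transfer_nil, transfer_nil, transfer_one, transfer_one, matrix_d, mcomp_add_left,
    mcomp_add_right, id_mcomp (matrix_mem f), mcomp_push_id, push_nil, push_one]
  simp only [mcomp_add_left, mmap_add, H.mmul_mul_mmap]
  linear_combination (norm := skip) h1 + h2 + h3
  abel_nf
  simp only [zsmul_matrix_eq_zero, add_zero]

theorem closed_one' {X Y : TypeD.{u} A} (f : X ⟶ Y) :
    mdiff (H.transfer (.cons .nil f))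
      + mcomp (H.transfer (.cons .nil f)) (F.toAInfHom.push (.nil : Quiver.Path Y Y))
      + mcomp X.δ (H.transfer (.cons .nil f))
      + mcomp (H.transfer (.nil : Quiver.Path X X)) (F.toAInfHom.push (.cons .nil f))
      + mcomp (matrix f) (H.transfer (.nil : Quiver.Path Y Y))
      + H.transfer (.cons .nil (DGCategory.d f)) = 0 := by
  have h1 := H.mmap_d (matrix f)
  have h2 := H.mmap_mul' X.δ (matrix f)
  have h3 := H.mmap_mul' (matrix f) Y.δ
  rw [transfer_nil, transfer_nil, transfer_one, transfer_one, matrix_d, mcomp_add_left,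
    mcomp_add_right (matrix f), mcomp_id (matrix_mem f), id_mcomp_push, push_nil, push_one]
  simp only [mcomp_add_right, mmap_add, H.mmap_mul_mmul]
  linear_combination (norm := skip) h1 + h2 + h3
  abel_nf
  simp only [zsmul_matrix_eq_zero, add_zero]

theorem closed_two {X Y Z : TypeD.{u} A} (f : X ⟶ Y) (g : Y ⟶ Z) :
    mcomp (H.transfer (.cons .nil f)) (matrix g)
      + (mcomp (F.toAInfHom.push (.cons (.cons .nil f) g)) (H.transfer (.nil : Quiver.Path Z Z))
        + mcomp (F.toAInfHom.push (.cons .nil f)) (H.transfer (.cons .nil g)))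
      + H.transfer (.cons .nil (f ≫ g)) = 0 := by
  have h1 := H.mmap_mul (matrix f) (matrix g)
  rw [transfer_nil, transfer_one, transfer_one, transfer_one, matrix_comp, mcomp_add_right,
    mcomp_push_id, push_two, push_one]
  simp only [mcomp_add_left, H.mmul_mul_mmap]
  linear_combination (norm := skip) h1
  abel_nf

theorem closed_two' {X Y Z : TypeD.{u} A} (f : X ⟶ Y) (g : Y ⟶ Z) :
    (mcomp (H.transfer (.cons .nil f)) (F.toAInfHom.push (.cons .nil g))
      + mcomp (H.transfer (.nil : Quiver.Path X X)) (F.toAInfHom.push (.cons (.cons .nil f) g)))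
      + mcomp (matrix f) (H.transfer (.cons .nil g))
      + H.transfer (.cons .nil (f ≫ g)) = 0 := by
  have h1 := H.mmap_mul' (matrix f) (matrix g)
  rw [transfer_nil, transfer_one, transfer_one, transfer_one, matrix_comp, mcomp_add_left,
    id_mcomp_push, push_two, push_one]
  simp only [mcomp_add_right, H.mmap_mul_mmul]
  linear_combination (norm := skip) h1
  abel_nf

/-- The square of `id + h(δ)` is the identity because `h(δ) h(δ) = 0` and `h(δ)` occurs twice. Since
the functors keep the generators, the same matrix represents the maps in both directions. -/
theorem transfer_nil_nil (X : TypeD.{u} A) :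
    mcomp (H.transfer (.nil : Quiver.Path X X)) (H.transfer (.nil : Quiver.Path X X))
      = idMatrix X := by
  rw [transfer_nil, mcomp_add_left, mcomp_add_right, mcomp_add_right, H.mmap_mul_mmap,
    id_mcomp (idMatrix_mem X), id_mcomp (H.mmap_h_mem (δ_mem X)),
    mcomp_id (H.mmap_h_mem (δ_mem X)), add_zero, add_assoc, madd_self, add_zero]

theorem transfer_nil_one {X Y : TypeD.{u} A} (f : X ⟶ Y) :
    mcomp (H.transfer (.cons .nil f)) (H.transfer (.nil : Quiver.Path Y Y))
      + mcomp (H.transfer (.nil : Quiver.Path X X)) (H.transfer (.cons .nil f)) = 0 := by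
  rw [transfer_nil, transfer_nil, transfer_one, mcomp_add_left, mcomp_add_right,
    H.mmap_mul_mmap, H.mmap_mul_mmap, id_mcomp (H.mmap_h_mem (matrix_mem f)), mcomp_id (H.mmap_h_mem (matrix_mem f)),
    add_zero, madd_self]

theorem transfer_one_one {X Y Z : TypeD.{u} A} (f : X ⟶ Y) (g : Y ⟶ Z) :
    mcomp (H.transfer (.cons .nil f)) (H.transfer (.cons .nil g)) = 0 :=
  H.mmap_mul_mmap _ _

end Contraction

end BinaryHom


/-! ### Natural isomorphisms with the identity functor -/

open CategoryTheory TypeD AInfFunctorData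

namespace BinaryHom

variable {A B : CurvedDGA} (F : BinaryHom A B) (G : BinaryHom B A)
  (h : F.binary = 0 ∨ G.binary = 0)

namespace Contraction

variable {F G h} (H : (F.comp G h).Contraction)

/-- The natural transformation from the composite functor to the identity functor. -/
noncomputable def counit : PreTrans (F.functor.comp G.functor) (AInfFunctorData.id (TypeD.{u} A)) :=
  fun {X Y} p => ⟨transfer H (X := X) (Y := Y) p, transfer_mem H (X := X) (Y := Y) p⟩

/-- The natural transformation from the identity functor to the composite functor. -/
noncomputable def unit : PreTrans (AInfFunctorData.id (TypeD.{u} A)) (F.functor.comp G.functor) :=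
  fun {X Y} p => ⟨transfer H (X := X) (Y := Y) p, transfer_mem H (X := X) (Y := Y) p⟩

theorem counit_eq_zero {X Y : TypeD.{u} A} (p : Quiver.Path X Y) (hp : 1 < p.length) :
    H.counit p = 0 := matrix_injective (H.transfer_eq_zero p hp)

theorem unit_eq_zero {X Y : TypeD.{u} A} (p : Quiver.Path X Y) (hp : 1 < p.length) :
    H.unit p = 0 := matrix_injective (H.transfer_eq_zero p hp)

theorem counit_more {W X Y Z : TypeD.{u} A} (p : Quiver.Path W X) (f : X ⟶ Y) (g : Y ⟶ Z) :
    H.counit ((p.cons f).cons g) = 0 := H.counit_eq_zero _ (by simp)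

theorem unit_more {W X Y Z : TypeD.{u} A} (p : Quiver.Path W X) (f : X ⟶ Y) (g : Y ⟶ Z) :
    H.unit ((p.cons f).cons g) = 0 := H.unit_eq_zero _ (by simp)

theorem comp_map_nil (X : TypeD.{u} A) :
    (F.functor.comp G.functor).map (.nil : Quiver.Path X X) = 0 := rfl

theorem id_map_nil (X : TypeD.{u} A) :
    (AInfFunctorData.id (TypeD.{u} A)).map (.nil : Quiver.Path X X) = 0 := rfl

theorem id_map_more {W X Y Z : TypeD.{u} A} (p : Quiver.Path W X) (f : X ⟶ Y) (g : Y ⟶ Z) :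
    (AInfFunctorData.id (TypeD.{u} A)).map ((p.cons f).cons g) = 0 := rfl

theorem id_map_eq_zero {X Y : TypeD.{u} A} (p : Quiver.Path X Y) (hp : 1 < p.length) :
    (AInfFunctorData.id (TypeD.{u} A)).map p = 0 := by
  rcases p with _ | ⟨_ | ⟨p, f⟩, g⟩
  · rfl
  · simp at hp
  · rfl

theorem matrix_d_counit {X Y : TypeD.{u} A} (p : Quiver.Path X Y) :
    matrix (DGCategory.d (H.counit p)) = mdiff (H.transfer p) + mcomp (H.transfer p) Y.δ
      + mcomp ((F.comp G h).toAInfHom.push (.nil : Quiver.Path X X)) (H.transfer p) := by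
  refine (matrix_d _).trans ?_
  refine congrArg (fun M : X.gen → X.gen →₀ A => mdiff (H.transfer p) + mcomp (H.transfer p) Y.δ
    + mcomp M (H.transfer p)) (comp_functor_obj_δ F G h X)

theorem matrix_d_unit {X Y : TypeD.{u} A} (p : Quiver.Path X Y) :
    matrix (DGCategory.d (H.unit p)) = mdiff (H.transfer p)
      + mcomp (H.transfer p) ((F.comp G h).toAInfHom.push (.nil : Quiver.Path Y Y))
      + mcomp X.δ (H.transfer p) := by
  refine (matrix_d _).trans ?_
  refine congrArg (fun M : Y.gen → Y.gen →₀ A => mdiff (H.transfer p) + mcomp (H.transfer p) M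
    + mcomp X.δ (H.transfer p)) (comp_functor_obj_δ F G h Y)

/-- The transformation accepts at most one morphism and the composite functor at most two, so only
paths of length at most three matter. Lengths zero, one and two are `closed_nil`, `closed_one` and
`closed_two`. The transformation `unit` is treated with the primed identities. -/
theorem isNatTrans_counit : IsNatTrans (H.counit : PreTrans (F.functor.comp G.functor)
    (AInfFunctorData.id (TypeD.{u} A))) where
  map_add p f g q := matrix_injective (H.transfer_add p f g q)
  closed {X Y} p := by
    have hP := @comp_functor_map_eq_zero.{u} _ _ _ F G h
    by_cases hp : 3 < p.length
    · rw [H.counit_eq_zero p (by omega), map_zero, List.sum_eq_zero, List.sum_eq_zero,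
        List.sum_eq_zero, List.sum_eq_zero]
      · simp
      · intro r hr
        obtain ⟨s, hs, rfl⟩ := List.mem_map.1 hr
        have := length_of_mem_pathComps p s hs
        exact H.counit_eq_zero _ (by omega)
      · intro r hr
        obtain ⟨s, hs, rfl⟩ := List.mem_map.1 hr
        have := length_of_mem_pathDiffs p s hs
        exact H.counit_eq_zero _ (by omega)
      · intro r hr
        obtain ⟨s, hs, rfl⟩ := List.mem_map.1 hr
        have := length_of_mem_pathSplits p s hs
        by_cases h' : 1 < s.2.2.length
        · rw [H.counit_eq_zero _ h']
          exact Limits.comp_zero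
        · rw [hP s.2.1 (by omega)]
          exact Limits.zero_comp
      · intro r hr
        obtain ⟨s, hs, rfl⟩ := List.mem_map.1 hr
        have := length_of_mem_pathSplits p s hs
        by_cases h' : 1 < s.2.1.length
        · rw [H.counit_eq_zero _ h']
          exact Limits.zero_comp
        · rw [id_map_eq_zero s.2.2 (by omega)]
          exact Limits.comp_zero
    · rcases p with _ | ⟨_ | ⟨_ | ⟨_ | ⟨p, a⟩, k⟩, f⟩, g⟩
      · simp only [pathDiffs, pathComps, pathSplits, List.map_cons, List.map_nil,
          List.sum_cons, List.sum_nil, comp_map_nil, id_map_nil, Limits.zero_comp, Limits.comp_zero, add_zero]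
        exact matrix_injective ((H.matrix_d_counit _).trans (H.closed_nil X))
      · simp only [pathDiffs, pathComps, pathSplits, List.map_cons, List.map_nil,
          List.sum_cons, List.sum_nil, comp_map_nil, id_map_nil, Limits.zero_comp, Limits.comp_zero, add_zero,
          zero_add]
        exact matrix_injective ((congrArg₂ (fun D M : X.gen → Y.gen →₀ A =>
          D + mcomp (H.transfer (.nil : Quiver.Path X X)) (matrix g)
            + mcomp M (H.transfer (.nil : Quiver.Path Y Y))
            + H.transfer (.cons .nil (DGCategory.d g))) (H.matrix_d_counit _)
          (comp_functor_map_one F G h g)).trans (H.closed_one g))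
      · simp only [pathDiffs, pathComps, pathSplits, List.map_cons, List.map_nil,
          List.sum_cons, List.sum_nil, comp_map_nil, id_map_nil, id_map_more, H.counit_more, map_zero,
          Limits.comp_zero, add_zero, zero_add]
        rename_i Z
        exact matrix_injective ((congrArg₂ (fun (M : X.gen → Y.gen →₀ A)
          (M' : X.gen → Z.gen →₀ A) => mcomp (H.transfer (.cons .nil f)) (matrix g)
            + (mcomp M (H.transfer (.nil : Quiver.Path Y Y))
              + mcomp M' (H.transfer (.cons .nil g)))
            + H.transfer (.cons .nil (f ≫ g))) (comp_functor_map_two F G h f g)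
          (comp_functor_map_one F G h f)).trans (H.closed_two f g))
      · simp only [pathDiffs, pathComps, pathSplits, List.map_cons, List.map_nil,
          List.sum_cons, List.sum_nil, comp_map_nil, id_map_nil, id_map_more, H.counit_more, map_zero,
          Limits.zero_comp, Limits.comp_zero, add_zero, zero_add]
        -- With three morphisms there remains a binary value on two of them times `h` of the third,
        -- which is zero.
        rw [hP _ (by simp), Limits.zero_comp, zero_add]
        exact matrix_injective ((congrArg (fun M => mcomp M (H.transfer (.cons .nil g)))
          (comp_functor_map_two F G h k f)).trans
            ((congrArg (fun M => mcomp M _) (push_two _ k f)).trans (H.mmul_mul_mmap _ _ _)))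
      · simp at hp

theorem isNatTrans_unit : IsNatTrans (H.unit : PreTrans (AInfFunctorData.id (TypeD.{u} A))
    (F.functor.comp G.functor)) where
  map_add p f g q := matrix_injective (H.transfer_add p f g q)
  closed {X Y} p := by
    have hP := @comp_functor_map_eq_zero.{u} _ _ _ F G h
    by_cases hp : 3 < p.length
    · rw [H.unit_eq_zero p (by omega), map_zero, List.sum_eq_zero, List.sum_eq_zero,
        List.sum_eq_zero, List.sum_eq_zero]
      · simp
      · intro r hr
        obtain ⟨s, hs, rfl⟩ := List.mem_map.1 hr
        have := length_of_mem_pathComps p s hs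
        exact H.unit_eq_zero _ (by omega)
      · intro r hr
        obtain ⟨s, hs, rfl⟩ := List.mem_map.1 hr
        have := length_of_mem_pathDiffs p s hs
        exact H.unit_eq_zero _ (by omega)
      · intro r hr
        obtain ⟨s, hs, rfl⟩ := List.mem_map.1 hr
        have := length_of_mem_pathSplits p s hs
        by_cases h' : 1 < s.2.2.length
        · rw [H.unit_eq_zero _ h']
          exact Limits.comp_zero
        · rw [id_map_eq_zero s.2.1 (by omega)]
          exact Limits.zero_comp
      · intro r hr
        obtain ⟨s, hs, rfl⟩ := List.mem_map.1 hr
        have := length_of_mem_pathSplits p s hs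
        by_cases h' : 1 < s.2.1.length
        · rw [H.unit_eq_zero _ h']
          exact Limits.zero_comp
        · rw [hP s.2.2 (by omega)]
          exact Limits.comp_zero
    · rcases p with _ | ⟨_ | ⟨_ | ⟨_ | ⟨p, a⟩, k⟩, f⟩, g⟩
      · simp only [pathDiffs, pathComps, pathSplits, List.map_cons, List.map_nil,
          List.sum_cons, List.sum_nil, comp_map_nil, id_map_nil, Limits.zero_comp, Limits.comp_zero, add_zero]
        exact matrix_injective ((H.matrix_d_unit _).trans (H.closed_nil' X))
      · simp only [pathDiffs, pathComps, pathSplits, List.map_cons, List.map_nil,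
          List.sum_cons, List.sum_nil, comp_map_nil, id_map_nil, Limits.zero_comp, Limits.comp_zero, add_zero,
          zero_add]
        exact matrix_injective ((congrArg₂ (fun D M : X.gen → Y.gen →₀ A =>
          D + mcomp (H.transfer (.nil : Quiver.Path X X)) M
            + mcomp (matrix g) (H.transfer (.nil : Quiver.Path Y Y))
            + H.transfer (.cons .nil (DGCategory.d g))) (H.matrix_d_unit _)
          (comp_functor_map_one F G h g)).trans (H.closed_one' g))
      · simp only [pathDiffs, pathComps, pathSplits, List.map_cons, List.map_nil,
          List.sum_cons, List.sum_nil, comp_map_nil, id_map_nil, id_map_more, H.unit_more, map_zero,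
          Limits.zero_comp, Limits.comp_zero, add_zero, zero_add]
        rename_i Z
        exact matrix_injective ((congrArg₂ (fun (M : Z.gen → Y.gen →₀ A)
          (M' : X.gen → Y.gen →₀ A) => mcomp (H.transfer (.cons .nil f)) M
            + mcomp (H.transfer (.nil : Quiver.Path X X)) M'
            + mcomp (matrix f) (H.transfer (.cons .nil g))
            + H.transfer (.cons .nil (f ≫ g))) (comp_functor_map_one F G h g)
          (comp_functor_map_two F G h f g)).trans (H.closed_two' f g))
      · simp only [pathDiffs, pathComps, pathSplits, List.map_cons, List.map_nil,
          List.sum_cons, List.sum_nil, comp_map_nil, id_map_nil, id_map_more, H.unit_more, map_zero,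
          Limits.zero_comp, Limits.comp_zero, add_zero, zero_add]
        rw [hP (.cons (.cons (.cons .nil k) f) g) (by simp), Limits.comp_zero, add_zero]
        exact matrix_injective ((congrArg (mcomp (H.transfer (.cons .nil k)))
          (comp_functor_map_two F G h f g)).trans
            ((congrArg (mcomp _) (push_two _ f g)).trans (H.mmap_mul_mmul _ _ _)))
      · simp at hp

theorem comp_counit_unit {X Y : TypeD.{u} A} (p : Quiver.Path X Y) :
    PreTrans.comp H.counit H.unit p = PreTrans.id (F.functor.comp G.functor) p := by
  by_cases hp : 2 < p.length
  · refine (List.sum_eq_zero fun r hr => ?_).trans ?_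
    · obtain ⟨s, hs, rfl⟩ := List.mem_map.1 hr
      have := length_of_mem_pathSplits p s hs
      beta_reduce
      by_cases h' : 1 < s.2.1.length
      · rw [H.counit_eq_zero _ h', Limits.zero_comp]
      · rw [H.unit_eq_zero s.2.2 (by omega), Limits.comp_zero]
    · cases p with
      | nil => simp at hp
      | cons p f => rfl
  · rcases p with _ | ⟨_ | ⟨_ | ⟨p, k⟩, f⟩, g⟩
    · simp only [PreTrans.comp, pathSplits, List.map_cons, List.map_nil, List.sum_cons,
        List.sum_nil, add_zero]
      exact matrix_injective (H.transfer_nil_nil X)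
    · simp only [PreTrans.comp, pathSplits, List.map_cons, List.map_nil, List.sum_cons,
        List.sum_nil, add_zero]
      exact matrix_injective (H.transfer_nil_one g)
    · simp only [PreTrans.comp, pathSplits, List.map_cons, List.map_nil, List.sum_cons,
        List.sum_nil, add_zero, zero_add, counit_more, unit_more, Limits.zero_comp,
        Limits.comp_zero]
      exact matrix_injective (H.transfer_one_one f g)
    · simp at hp

theorem comp_unit_counit {X Y : TypeD.{u} A} (p : Quiver.Path X Y) :
    PreTrans.comp H.unit H.counit p = PreTrans.id (AInfFunctorData.id (TypeD.{u} A)) p := by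
  by_cases hp : 2 < p.length
  · refine (List.sum_eq_zero fun r hr => ?_).trans ?_
    · obtain ⟨s, hs, rfl⟩ := List.mem_map.1 hr
      have := length_of_mem_pathSplits p s hs
      beta_reduce
      by_cases h' : 1 < s.2.1.length
      · rw [H.unit_eq_zero _ h', Limits.zero_comp]
      · rw [H.counit_eq_zero s.2.2 (by omega), Limits.comp_zero]
    · cases p with
      | nil => simp at hp
      | cons p f => rfl
  · rcases p with _ | ⟨_ | ⟨_ | ⟨p, k⟩, f⟩, g⟩
    · simp only [PreTrans.comp, pathSplits, List.map_cons, List.map_nil, List.sum_cons,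
        List.sum_nil, add_zero]
      exact matrix_injective (H.transfer_nil_nil X)
    · simp only [PreTrans.comp, pathSplits, List.map_cons, List.map_nil, List.sum_cons,
        List.sum_nil, add_zero]
      exact matrix_injective (H.transfer_nil_one g)
    · simp only [PreTrans.comp, pathSplits, List.map_cons, List.map_nil, List.sum_cons,
        List.sum_nil, add_zero, zero_add, counit_more, unit_more, Limits.zero_comp,
        Limits.comp_zero]
      exact matrix_injective (H.transfer_one_one f g)
    · simp at hp

theorem box_isomorphic (H : (F.comp G h).Contraction) : DAData.Isomorphic
    (DAData.box G.toAInfHom.bimodule F.toAInfHom.bimodule) (idBimodule A) :=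
  H.isomorphic (AInfHom.isRankOne_box _ _) (F.box_op G h)

theorem functor_isomorphic (H : (F.comp G h).Contraction) : AInfFunctorData.Isomorphic
    (F.functor.comp G.functor) (AInfFunctorData.id (TypeD.{u} A)) :=
  ⟨counit H, unit H, isNatTrans_counit H, isNatTrans_unit H, comp_counit_unit H,
    comp_unit_counit H⟩

end Contraction

end BinaryHom

end SurgeryKoszul

theorem mainTheorem5 (N : ℕ) (hN : 4 ≤ N) :
    ∃ (ι : SurgeryKoszul.AInfHom SurgeryKoszul.koszulDual SurgeryKoszul.completedKoszulDual)
      (φ : SurgeryKoszul.AInfHom SurgeryKoszul.completedKoszulDual SurgeryKoszul.koszulDual),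
      ι.op = SurgeryKoszul.inclusionOp ∧
      φ.op = SurgeryKoszul.phiOp N ∧
      ι.bimodule.IsBimodule ∧
      φ.bimodule.IsBimodule ∧
      (SurgeryKoszul.DAData.box φ.bimodule ι.bimodule).IsBimodule ∧
      (SurgeryKoszul.DAData.box ι.bimodule φ.bimodule).IsBimodule ∧
      SurgeryKoszul.DAData.Isomorphic (SurgeryKoszul.DAData.box φ.bimodule ι.bimodule)
        (SurgeryKoszul.idBimodule SurgeryKoszul.koszulDual) ∧
      SurgeryKoszul.DAData.Isomorphic (SurgeryKoszul.DAData.box ι.bimodule φ.bimodule)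
        (SurgeryKoszul.idBimodule SurgeryKoszul.completedKoszulDual) ∧
      ∃ (hι : SurgeryKoszul.AInfHom.PreservesTypeD.{u} ι)
        (hφ : SurgeryKoszul.AInfHom.PreservesTypeD.{u} φ),
        SurgeryKoszul.AInfFunctorData.AreInverseEquivalences (ι.functor hι) (φ.functor hφ) := by
  -- The number `n = N - 2` is the largest length of a word that `φ₁` keeps in the coefficient of
  -- `θ`; `N ≥ 4` gives the bound `2 ≤ n` used in the lemmas on division.
  obtain ⟨n, rfl⟩ : ∃ n, N = n + 2 := ⟨N - 2, by omega⟩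
  have hn : 2 ≤ n := by omega
  open SurgeryKoszul BinaryHom in
  exact ⟨inclusionHom.toAInfHom, (truncationHom n hn).toAInfHom, inclusionHom_op,
    truncationHom_op hn, AInfHom.isBimodule_bimodule _, AInfHom.isBimodule_bimodule _,
    isBimodule_box inclusionHom (truncationHom n hn) (Or.inl rfl),
    isBimodule_box (truncationHom n hn) inclusionHom (Or.inr rfl),
    (finiteContraction n hn).box_isomorphic, (completedContraction n hn).box_isomorphic,
    inclusionHom.preservesTypeD, (truncationHom n hn).preservesTypeD,
    inclusionHom.isAInfFunctor, (truncationHom n hn).isAInfFunctor,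
    (finiteContraction n hn).functor_isomorphic, (completedContraction n hn).functor_isomorphic⟩
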